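/- **Proposition (linear models).** Let $T=(V,E)$ be a finite semi-labelled tree with set of regular nodes $W\subseteq V$ (so every vertex of degree at most $2$ lies in $W$; the other vertices are latent), and let $\Delta$ be its maximal degree. Let $Y=(Y_v)_{v\in V}$ be a random vector with square-integrable components $Y_v$ in $\mathbb R^k$ whose law has, with respect to some product of $\sigma$-finite measures, a density of the form $\prod_{uv\in E}\psi_{uv}(y_u,y_v)$ with measurable $\psi_{uv}\ge 0$. Suppose that for every edge $uv$ of $T$ (in both orientations) $\mathbb E[Y_u\mid Y_v]$ is almost surely an affine function of $Y_v$. Let $\Sigma_{uv}=\mathrm{cov}(Y_u,Y_v)$, assume that every $\Sigma_{vv}$ is invertible, put $$\tau_{uv}=\det\bigl(\Sigma_{uu}^{-1/2}\,\Sigma_{uv}\,\Sigma_{vv}^{-1/2}\bigr),$$ and assume that $\tau_{uv}\neq 0$ and $|\tau_{uv}|\ne 1$ for every edge $uv$ of $T$. Then the randomized algorithm below, with parameter $\kappa=\Delta$ and applied to the distances $d(i,j)=-\log|\tau_{ij}|$, $i,j\in W$, recovers $T$: for every choice of the initial node, it halts with probability one, and whenever it halts, its output is the edge set of $T$ up to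 the names of the latent nodes. *Algorithm.* A bag $B$ is a finite set of nodes with a marked representative $\rho(B)\in B$. Start with the skeleton $S=\emptyset$ and with a queue that contains only the bag $W$, with an arbitrary representative. While the queue is non-empty, remove its first bag $B$. If $|B|\le\kappa$, add to $S$ the edges of a semi-labelled tree with regular nodes $B$ and new latent nodes which realizes $d|_{B\times B}$ as path metric for positive edge lengths. If $|B|>\kappa$, repeat the following until all resulting bags have size at most $|B|/\sqrt\Delta$, with a fresh sample each time: sample $u_1,\dots,u_\kappa$ uniformly without replacement from $B\setminus\{\rho(B)\}$; start with the collection $\{B\}$; for $i=1,\dots,\kappa$, find the bag $B^*$ of the collection that contains $u_i$ and, if $u_i\ne\rho(B^*)$, replace it by the bags that $\mathrm{basic}(B^*,u_i)$ returns; finally replace every bag $B'$ of the collection by the bags that $\mathrm{explode}(B')$ returns. After the last repetition, add to $S$ the edges found by $\mathrm{basic}$ in it, and add its bags to the rear of the queue. * $\mathrm{basic}(B,\alpha)$, with $\rho=\rho(B)$: group the nodes $v\in B$ by the value of $d(v,\alpha)-d(v,\rho)$, in increasing order, into $B_1,\dots,B_m$. Let $u_i$ minimize $d(\cdot,\alpha)$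 on $B_i$. If $d(\rho,u_i)+d(u_i,\alpha)=d(\rho,\alpha)$, put $\rho(B_i)=u_i$; otherwise add a new latent node $w_i$ to $B_i$, put $\rho(B_i)=w_i$ and store $d(w_i,v)=\frac12\bigl(d(v,\alpha)+d(v,\rho)-d(\alpha,\rho)\bigr)$ for the other $v\in B_i$. Return the bags $B_i$ and the edges $\rho(B_i)\rho(B_{i+1})$, $1\le i<m$. * $\mathrm{explode}(B)$, with $\rho=\rho(B)$: while $B\neq\{\rho\}$, take $u\in B\setminus\{\rho\}$, output the bag $\{v\in B\setminus\{\rho\}: d(u,v)<d(u,\rho)+d(v,\rho)\}\cup\{\rho\}$ with representative $\rho$, and remove its nodes other than $\rho$ from $B$. -/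

import Mathlib

open MeasureTheory ProbabilityTheory Filter
open scoped ENNReal NNReal Topology MatrixOrder

namespace LatentTree

/-! ### Semi-labelled trees and tree metrics -/

section Trees

/-- `T` is a tree and `W` contains every vertex of degree at most two. The vertices in `W` are
the regular ones, the others are latent. -/
def IsSemiLabelledTree {V : Type*} (T : SimpleGraph V) (W : Set V) : Prop :=
  T.IsTree ∧ ∀ v, (T.neighborSet v).ncard ≤ 2 → v ∈ W

/-- On the set `W`, the function `d` is the path metric of the tree `T` for the strictly positive
edge lengths `ℓ`. -/
def RealizesOn {V : Type*} (T : SimpleGraph V) (W : Set V) (ℓ : Sym2 V → ℝ) (d : V → V → ℝ) :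
    Prop :=
  (∀ e ∈ T.edgeSet, 0 < ℓ e) ∧
    ∀ i ∈ W, ∀ j ∈ W, ∀ p : T.Walk i j, p.IsPath → d i j = (p.edges.map ℓ).sum

end Trees

/-! ### The randomized reconstruction algorithm -/

section Algorithm

/-- Names of nodes handled by the algorithm: `Sum.inl w` is the regular node labelled `w`, and the
`Sum.inr n` are names for the latent nodes that the algorithm discovers. -/
abbrev Node (L : Type*) := L ⊕ ℕ

/-- A bag of nodes with its representative. -/
structure Bag (L : Type*) where
  nodes : Finset (Node L)
  rep : Node L

/-- The distance oracle, with the stored distances of the latent nodes found so far, and the first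
unused name of a latent node. -/
structure Oracle (L : Type*) where
  dist : Node L → Node L → ℝ
  next : ℕ

/-- The distance oracle at the start: only distances between regular nodes are known. -/
def Oracle.init {L : Type*} (d : L → L → ℝ) : Oracle L where
  dist
    | Sum.inl i, Sum.inl j => d i j
    | _, _ => 0
  next := 0

/-- Record in the oracle a new latent node, whose distance to each node `v ∈ B` is `f v`. -/
def Oracle.addLatent {L : Type*} [DecidableEq L] (o : Oracle L) (B : Finset (Node L))
    (f : Node L → ℝ) : Oracle L where
  dist x y :=
    if x = Sum.inr o.next ∧ y ∈ B then f y
    else if y = Sum.inr o.next ∧ x ∈ B then f x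
    else if x = Sum.inr o.next ∧ y = Sum.inr o.next then 0
    else o.dist x y
  next := o.next + 1

/-- An element of `s` at which `f` is minimal (`a` if `s` is empty). -/
noncomputable def argmin {α : Type*} (s : Finset α) (f : α → ℝ) (a : α) : α :=
  open Classical in
  if h : s.Nonempty then (s.exists_min_image f h).choose else a

/-- The quantity `D(v) = d(v, α) - d(v, ρ)`. -/
def Oracle.offset {L : Type*} (o : Oracle L) (α ρ v : Node L) : ℝ :=
  o.dist v α - o.dist v ρ

/-- One pass of the loop of `basic`: treats the nodes `v` of `B` with `D(v) = x`. The oracle `o` is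
the one with which `basic` was called; `acc` holds the bags formed so far and the updated oracle. -/
noncomputable def basicStep {L : Type*} [DecidableEq L] (o : Oracle L) (B : Bag L) (α : Node L)
    (acc : List (Bag L) × Oracle L) (x : ℝ) : List (Bag L) × Oracle L :=
  let Bi := B.nodes.filter (fun v => o.offset α B.rep v = x)
  let u := argmin Bi (fun v => o.dist v α) α
  if o.dist B.rep u + o.dist u α = o.dist B.rep α then
    (acc.1 ++ [⟨Bi, u⟩], acc.2)
  else
    (acc.1 ++ [⟨insert (Sum.inr acc.2.next) Bi, Sum.inr acc.2.next⟩],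
      acc.2.addLatent Bi (fun v => (o.dist v α + o.dist v B.rep - o.dist α B.rep) / 2))

/-- The edges joining consecutive elements of a list. -/
def pathEdges {N : Type*} [DecidableEq N] (l : List N) : Finset (Sym2 N) :=
  (List.zipWith (fun a b => s(a, b)) l l.tail).toFinset

/-- `basic(B, α)`: groups the nodes of `B` by the values of `D`, in increasing order, and finds
the representatives of the groups. Returns the bags, the skeleton and the updated oracle. -/
noncomputable def basic {L : Type*} [DecidableEq L] (o : Oracle L) (B : Bag L) (α : Node L) :
    List (Bag L) × Finset (Sym2 (Node L)) × Oracle L :=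
  let r := ((B.nodes.image (o.offset α B.rep)).sort (· ≤ ·)).foldl (basicStep o B α) ([], o)
  (r.1, pathEdges (r.1.map Bag.rep), r.2)

/-- The loop of `explode`: `R` is the set of the nodes other than the representative `ρ` that are
still to be treated. The first argument bounds the number of passes. -/
noncomputable def explodeLoop {L : Type*} [DecidableEq L] (d : Node L → Node L → ℝ) (ρ : Node L) :
    ℕ → Finset (Node L) → List (Bag L)
  | 0, _ => []
  | m + 1, R =>
    open Classical in
    if h : R.Nonempty then
      let u := h.choose
      let C := R.filter (fun v => d u v < d u ρ + d v ρ)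
      ⟨insert ρ C, ρ⟩ :: explodeLoop d ρ m (R \ C)
    else []

/-- `explode(B)`. Every pass removes at least the node `u` from the bag, as
`d(u, u) = 0 < 2 d(u, ρ)`, so that `|B|` passes are enough. -/
noncomputable def explode {L : Type*} [DecidableEq L] (d : Node L → Node L → ℝ) (B : Bag L) :
    List (Bag L) :=
  explodeLoop d B.rep B.nodes.card (B.nodes.erase B.rep)

/-- The data inside `bigsplit`: current bags, skeleton and oracle. -/
structure Split (L : Type*) where
  bags : List (Bag L)
  skel : Finset (Sym2 (Node L))
  oracle : Oracle L

/-- One pass of the for-loop of `bigsplit`, for the sampled node `u`. -/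
noncomputable def splitAt {L : Type*} [DecidableEq L] (s : Split L) (u : Node L) : Split L :=
  match s.bags.find? (fun B => u ∈ B.nodes) with
  | none => s
  | some B =>
    if u = B.rep then s
    else
      let r := basic s.oracle B u
      { bags := s.bags.eraseP (fun B => u ∈ B.nodes) ++ r.1
        skel := s.skel ∪ r.2.1
        oracle := r.2.2 }

/-- One pass of the while-loop of `bigsplit(B, u₁, …, u_k)`: the bag is split at `u₁, …, u_k` in
turn, and then all resulting bags are exploded. -/
noncomputable def splitRound {L : Type*} [DecidableEq L] (o : Oracle L) (B : Bag L)
    (us : List (Node L)) : Split L :=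
  let s := us.foldl splitAt { bags := [B], skel := ∅, oracle := o }
  { s with bags := s.bags.flatMap (explode s.oracle.dist) }

/-- `r.1` is a full skeleton for the tree induced by the set `B` of nodes: the edge set of a
semi-labelled tree with set of regular nodes `B`, and with latent nodes that carry unused names
(from `next` on and below `r.2`), which realizes the distances on `B` by positive edge lengths. -/
def IsFullSkeleton {L : Type*} (d : Node L → Node L → ℝ) (next : ℕ) (B : Finset (Node L))
    (r : Finset (Sym2 (Node L)) × ℕ) : Prop :=
  next ≤ r.2 ∧
  ∃ U : Finset (Node L), B ⊆ U ∧
    (∀ x ∈ U, x ∉ B → ∃ n, next ≤ n ∧ n < r.2 ∧ x = Sum.inr n) ∧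
    ∃ (T : SimpleGraph U) (ℓ : Sym2 U → ℝ),
      IsSemiLabelledTree T {x | x.1 ∈ B} ∧
      RealizesOn T {x | x.1 ∈ B} ℓ (fun x y => d x.1 y.1) ∧
      (r.1 : Set (Sym2 (Node L))) = Sym2.map Subtype.val '' T.edgeSet

/-- Find a full skeleton for the tree induced by `B` from all distances between nodes of `B`
(return nothing if there is none). -/
noncomputable def findFullSkeleton {L : Type*} (o : Oracle L) (B : Finset (Node L)) :
    Finset (Sym2 (Node L)) × ℕ :=
  open Classical in
  if h : ∃ r, IsFullSkeleton o.dist o.next B r then h.choose else (∅, o.next)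

/-- The state of the algorithm: the queue of bags, the skeleton found so far, and the oracle. -/
structure State (L : Type*) where
  queue : List (Bag L)
  skel : Finset (Sym2 (Node L))
  oracle : Oracle L

/-- The algorithm stops when the queue is empty. -/
def State.Halted {L : Type*} (s : State L) : Prop := s.queue = []

/-- The state at the start, when `u` is picked as the representative of the bag of all regular
nodes. -/
def State.init {L : Type*} [Fintype L] [DecidableEq L] (d : L → L → ℝ) (u : L) : State L where
  queue := [⟨Finset.univ.image Sum.inl, Sum.inl u⟩]
  skel := ∅
  oracle := Oracle.init d

/-- The effect of one pass of the while-loop of `bigsplit` on the first bag `B` of the queue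
(the rest of which is `Q`) with sampled nodes `us`. If all bags that result have size at most
`|B| / √Δ`, then the loop ends: the skeleton is extended and the bags go to the rear of the queue.
Otherwise nothing changes, so that the next step samples afresh from the same bag. -/
noncomputable def State.trySplit {L : Type*} [DecidableEq L] (Δ : ℕ) (s : State L) (B : Bag L)
    (Q : List (Bag L)) (us : List (Node L)) : State L :=
  open Classical in
  let r := splitRound s.oracle B us
  if ∀ B' ∈ r.bags, (B'.nodes.card : ℝ) ≤ (B.nodes.card : ℝ) / Real.sqrt (Δ : ℝ) then
    { queue := Q ++ r.bags, skel := s.skel ∪ r.skel, oracle := r.oracle }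
  else s

/-- One step of the algorithm with parameter `κ = Δ`. A bag with at most `κ` nodes is solved
directly; from a larger bag `B`, an ordered sample of `κ` nodes other than the representative is
drawn uniformly without replacement, and one pass of the loop of `bigsplit` is carried out. -/
noncomputable def State.step {L : Type*} [DecidableEq L] (Δ : ℕ) (s : State L) : PMF (State L) :=
  open Classical in
  match s.queue with
  | [] => PMF.pure s
  | B :: Q =>
    if B.nodes.card ≤ Δ then
      let r := findFullSkeleton s.oracle B.nodes
      PMF.pure { queue := Q, skel := s.skel ∪ r.1, oracle := { s.oracle with next := r.2 } }
    else if _h : Nonempty (Fin Δ ↪ ↥(B.nodes.erase B.rep)) then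
      (PMF.uniformOfFintype (Fin Δ ↪ ↥(B.nodes.erase B.rep))).map
        (fun u => s.trySplit Δ B Q (List.ofFn (fun i => (u i : Node L))))
    else PMF.pure s

/-- The law of the state after `t` steps of the algorithm with parameter `κ = Δ`, applied to the
distances `d`, with `u` picked as first representative. -/
noncomputable def run {L : Type*} [Fintype L] [DecidableEq L] (Δ : ℕ) (d : L → L → ℝ) (u : L) :
    ℕ → PMF (State L)
  | 0 => PMF.pure (State.init d u)
  | t + 1 => (run Δ d u t).bind (State.step Δ)

/-- The skeleton `S` is the tree `T` with regular nodes `W`, up to the names of latent nodes. -/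
def IsSkeletonOf {V : Type*} (T : SimpleGraph V) (W : Finset V) (S : Finset (Sym2 (Node W))) :
    Prop :=
  ∃ φ : V ↪ Node W, (∀ w : W, φ w = Sum.inl w) ∧
    (S : Set (Sym2 (Node W))) = Sym2.map φ '' T.edgeSet

/-- The algorithm with parameter `κ = maxdeg T`, applied to the distances `d` between the regular
nodes `W` of `T`, recovers `T`: whichever node is picked at the start, a run that halts always
outputs `T`, and the algorithm halts with probability one. -/
def AlgorithmRecovers {V : Type*} [Fintype V] [DecidableEq V] (T : SimpleGraph V)
    [DecidableRel T.Adj] (W : Finset V) (d : W → W → ℝ) : Prop :=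
  ∀ u : W,
    (∀ t, ∀ s ∈ (run T.maxDegree d u t).support, s.Halted → IsSkeletonOf T W s.skel) ∧
    Tendsto (fun t => (run T.maxDegree d u t).toOuterMeasure {s | s.Halted}) atTop (𝓝 1)

end Algorithm

/-! ### Linear models -/

section Models

variable {V Ω : Type*} [MeasurableSpace Ω] {k : ℕ}

/-- The law of `Y` has, with respect to some product of σ-finite measures, a density which
factorizes according to `T`, as a product over the edges `uv` of nonnegative potentials that are
functions of `(y_u, y_v)`. -/
def Factorizes [Fintype V] [DecidableEq V] (T : SimpleGraph V) [DecidableRel T.Adj]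
    (P : Measure Ω) (Y : V → Ω → Fin k → ℝ) : Prop :=
  ∃ (μ : V → Measure (Fin k → ℝ)) (ψ : Sym2 V → (V → Fin k → ℝ) → ℝ≥0),
    (∀ v, SigmaFinite (μ v)) ∧
    (∀ e ∈ T.edgeSet, Measurable (ψ e) ∧ DependsOn (ψ e) {v | v ∈ e}) ∧
    P.map (fun ω v => Y v ω) =
      (Measure.pi μ).withDensity (fun y => ∏ e ∈ T.edgeFinset, (ψ e y : ℝ≥0∞))

/-- The matrix `Σ_uv = cov(Y_u, Y_v)`. -/
noncomputable def covMatrix (P : Measure Ω) (Y : V → Ω → Fin k → ℝ) (u v : V) :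
    Matrix (Fin k) (Fin k) ℝ :=
  Matrix.of fun i j => cov[fun ω => Y u ω i, fun ω => Y v ω j; P]

/-- `τ_uv = det (Σ_uu^{-1/2} Σ_uv Σ_vv^{-1/2})`. -/
noncomputable def tau (P : Measure Ω) (Y : V → Ω → Fin k → ℝ) (u v : V) : ℝ :=
  ((CFC.sqrt (covMatrix P Y u u))⁻¹ * covMatrix P Y u v * (CFC.sqrt (covMatrix P Y v v))⁻¹).det

/-- A linear model over the tree `T`: a square-integrable random vector `Y = (Y_v)` with values
`Y_v` in `ℝ^k` whose density factorizes according to `T`, and such that for every edge `uv` the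
conditional expectation of `Y_u` given `Y_v` is an affine function of `Y_v`. -/
structure IsLinearModel [Fintype V] [DecidableEq V] (T : SimpleGraph V) [DecidableRel T.Adj]
    (P : Measure Ω) (Y : V → Ω → Fin k → ℝ) : Prop where
  measurable : ∀ v, Measurable (Y v)
  memLp : ∀ v, MemLp (Y v) 2 P
  factorizes : Factorizes T P Y
  affine : ∀ u v, T.Adj u v → ∃ (A : Matrix (Fin k) (Fin k) ℝ) (b : Fin k → ℝ),
    P[Y u | MeasurableSpace.comap (Y v) inferInstance] =ᵐ[P] fun ω => A.mulVec (Y v ω) + b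

end Models

end LatentTree

namespace LatentTree

/-! ### Tree metrics -/

/-! The proof has a probabilistic half and a combinatorial half, which meet in one fact: `-log |τ|`
is the path metric of `T` for positive edge lengths (`IsLinearModel.realizesOn`).

Probability. Deleting an edge `uv` of the tree splits the density into a factor on the side of `u`,
together with `v`, and a factor on the side of `v`. For a node `w` beyond `v` this yields the Markov
property (`Factorizes.markov`). If `E[Y_u | Y_v] = A Y_v + b`, then the residual `Y_u - A Y_v - b`
has conditional mean zero given `Y_v`, hence also given `Y_w`, so it is uncorrelated with `Y_w` and
`Σ_uw = A Σ_vw`. Taking determinants for `w` and for `w = v` gives `τ_uw = τ_uv τ_vw`; along a path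
the logarithms add up. The residual covariance `Σ_uu - A Σ_vv Aᵀ` is positive semidefinite, and
monotonicity of the determinant gives `|τ_uv| ≤ 1`, so edge lengths are positive under the
hypotheses on `τ`.

Correctness. Each bag stands for a piece of the tree: a set `X` of nodes with a root `r` through
which every path leaves `X`. The bag holds the regular nodes of `X` and `r`. The offset `d(v,α) -
d(v,ρ)` depends only on the projection of `v` to the path from `α` to `ρ`, and separates the nodes
of this path. Since a latent node has degree at least three, some regular node hangs off the path at
each of its latent interior nodes; thus `basic` sees the whole path and replaces a piece by the
fibers of the projection (`basic_spec`). `explode` cuts a piece at its root into components, because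
positivity of the Gromov product at the root is an equivalence relation (`explode_spec`). A small
bag is solved by any semi-labelled tree realizing its distances, as such a tree is unique
(`IsTreeMetric.exists_isometry`). The queue invariant `QueueInv` says that every edge is found
already or has an end that is a non-root of a queued piece; an empty queue therefore means that the
skeleton is `T`.

Termination. Let the weight of a state be the number of nodes in queued bags other than
representatives. Solving a small bag or completing a split lowers it; a failed round leaves the
state unchanged. For a large bag a successful sample exists (`exists_good_sample`): choose one node
below each minimal node that has many bag nodes below it, and there are at most `Δ` such minimal
nodes. As only boundedly many samples are possible, the expected weight decays geometrically, and
Markov's inequality finishes the proof. The one-node tree, where `Δ = 0`, is treated separately. -/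

/-- The point `z` lies between `x` and `y` for the metric `δ`. -/
def Btw {V : Type*} (δ : V → V → ℝ) (x z y : V) : Prop := δ x z + δ z y = δ x y

/-- The metric properties of the path metric `δ` of a tree `T` with positive edge lengths. -/
structure IsTreeMetric {V : Type*} (T : SimpleGraph V) (δ : V → V → ℝ) : Prop where
  self : ∀ x, δ x x = 0
  symm : ∀ x y, δ x y = δ y x
  pos : ∀ x y, x ≠ y → 0 < δ x y
  tri : ∀ x y z, δ x z ≤ δ x y + δ y z
  four : ∀ x y a b, δ x y + δ a b ≤ δ x a + δ y b ∨ δ x y + δ a b ≤ δ x b + δ y a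
  median : ∀ x y z, ∃ m, Btw δ x m y ∧ Btw δ x m z ∧ Btw δ y m z
  adj_btw : ∀ x y z, T.Adj x y → Btw δ x z y → z = x ∨ z = y
  toward : ∀ x y, x ≠ y → ∃ z, T.Adj x z ∧ Btw δ x z y

/-! ### The path metric of a tree with positive edge lengths -/

section OfTree

variable {V : Type*} {T : SimpleGraph V} {ℓ : Sym2 V → ℝ} {δ : V → V → ℝ}

/-- Deleting the edge `xy` separates `z` from one of its ends, so the path from that end is the edge
followed by the path from the other end. This is the source of all inductions along paths below. -/
theorem RealizesOn.edge_dichotomy (hT : T.IsTree) (h : RealizesOn T Set.univ ℓ δ) {x y : V}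
    (hxy : T.Adj x y) (z : V) :
    (∃ p : T.Walk y z, p.IsPath ∧ x ∉ p.support ∧ δ x z = ℓ s(x, y) + δ y z) ∨
    (∃ p : T.Walk x z, p.IsPath ∧ y ∉ p.support ∧ δ y z = ℓ s(x, y) + δ x z) := by
  classical
  obtain ⟨p, hp, -⟩ := hT.existsUnique_path x z
  obtain ⟨q, hq, -⟩ := hT.existsUnique_path y z
  by_cases hx : x ∈ q.support
  · right
    have hy : y ∉ p.support := by
      have := hT.2.ne_mem_support_of_support_of_adj_of_isPath (p := q.reverse) (q := p.reverse)
        hq.reverse hp.reverse hxy.symm (by simpa using hx)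
      simpa using this
    refine ⟨p, hp, hy, ?_⟩
    rw [h.2 y trivial z trivial (.cons hxy.symm p) (by simp [hp, hy]), h.2 x trivial z trivial p hp]
    simp [Sym2.eq_swap]
  · left
    refine ⟨q, hq, hx, ?_⟩
    rw [h.2 x trivial z trivial (.cons hxy q) (by simp [hq, hx]), h.2 y trivial z trivial q hq]
    simp

theorem RealizesOn.self (h : RealizesOn T Set.univ ℓ δ) (x : V) : δ x x = 0 := by
  simpa using h.2 x trivial x trivial .nil (by simp)

theorem RealizesOn.symm (hT : T.IsTree) (h : RealizesOn T Set.univ ℓ δ) (x y : V) :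
    δ x y = δ y x := by
  obtain ⟨p, hp, -⟩ := hT.existsUnique_path x y
  rw [h.2 x trivial y trivial p hp, h.2 y trivial x trivial p.reverse hp.reverse]
  simp [List.sum_reverse]

theorem RealizesOn.len_pos (h : RealizesOn T Set.univ ℓ δ) {x y : V} (hxy : T.Adj x y) :
    0 < ℓ s(x, y) := h.1 _ hxy

theorem RealizesOn.adj (h : RealizesOn T Set.univ ℓ δ) {x y : V} (hxy : T.Adj x y) :
    δ x y = ℓ s(x, y) := by
  simpa using h.2 x trivial y trivial (.cons hxy .nil) (by simp [hxy.ne])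

theorem RealizesOn.walk_nonneg (h : RealizesOn T Set.univ ℓ δ) {x y : V} (p : T.Walk x y) :
    0 ≤ (p.edges.map ℓ).sum := by
  apply List.sum_nonneg
  simp only [List.mem_map, forall_exists_index, and_imp, forall_apply_eq_imp_iff₂]
  exact fun e he => (h.1 e (p.edges_subset_edgeSet he)).le

theorem RealizesOn.pos (hT : T.IsTree) (h : RealizesOn T Set.univ ℓ δ) (x y : V) (hxy : x ≠ y) :
    0 < δ x y := by
  obtain ⟨p, hp, -⟩ := hT.existsUnique_path x y
  rw [h.2 x trivial y trivial p hp]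
  cases p with
  | nil => exact absurd rfl hxy
  | cons hadj p =>
    have := h.walk_nonneg p
    have := h.len_pos hadj
    simp only [SimpleGraph.Walk.edges_cons, List.map_cons, List.sum_cons]
    linarith

theorem RealizesOn.tri (hT : T.IsTree) (h : RealizesOn T Set.univ ℓ δ) (x y z : V) :
    δ x z ≤ δ x y + δ y z := by
  obtain ⟨p, hp, -⟩ := hT.existsUnique_path x y
  rw [h.2 x trivial y trivial p hp]
  -- The bound holds for every walk, since one edge changes the distance to `z` by exactly its
  -- length, up or down.
  clear hp
  induction p with
  | nil => simp
  | cons hadj p ih =>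
    simp only [SimpleGraph.Walk.edges_cons, List.map_cons, List.sum_cons]
    have := h.len_pos hadj
    rcases h.edge_dichotomy hT hadj z with ⟨_, _, _, h1⟩ | ⟨_, _, _, h1⟩ <;> linarith

/-- Paths leaving an edge on its two sides can be concatenated. -/
theorem RealizesOn.concat (hT : T.IsTree) (h : RealizesOn T Set.univ ℓ δ) {x y a b : V}
    (hxy : T.Adj x y) (ha : δ x a = ℓ s(x, y) + δ y a) (hb : δ y b = ℓ s(x, y) + δ x b) :
    δ a b = δ a y + ℓ s(x, y) + δ x b := by
  have hl := h.len_pos hxy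
  rcases h.edge_dichotomy hT hxy a with ⟨p, hp, hxp, -⟩ | ⟨_, _, _, h1⟩
  swap; · linarith
  rcases h.edge_dichotomy hT hxy b with ⟨_, _, _, h1⟩ | ⟨q, hq, hyq, -⟩
  · linarith
  have key : (p.reverse.append (.cons hxy.symm q)).IsPath := by
    -- In a forest a walk is a path once consecutive edges differ, so only the two junctions with
    -- the edge `yx` need a check. A repetition there would put `y` on `q` or `x` on `p`.
    rw [hT.2.isPath_iff_isChain]
    simp only [SimpleGraph.Walk.edges_append, SimpleGraph.Walk.edges_reverse,
      SimpleGraph.Walk.edges_cons]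
    have hp' := (hT.2.isPath_iff_isChain _).1 hp.reverse
    have hq' := (hT.2.isPath_iff_isChain _).1 hq
    rw [SimpleGraph.Walk.edges_reverse] at hp'
    rw [List.isChain_append]
    refine ⟨hp', List.isChain_cons.2 ⟨?_, hq'⟩, ?_⟩
    · rintro e he rfl
      exact hyq (q.fst_mem_support_of_mem_edges (List.mem_of_mem_head? he))
    · intro e he e' he'
      simp only [List.head?_cons, Option.mem_def, Option.some.injEq] at he'
      rintro rfl
      subst he'
      have := List.mem_of_mem_getLast? he
      exact hxp (p.snd_mem_support_of_mem_edges (by simpa using this))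
  rw [h.2 a trivial b trivial _ key, h.symm hT a y, h.2 y trivial a trivial p hp,
    h.2 x trivial b trivial q hq]
  simp only [SimpleGraph.Walk.edges_append, SimpleGraph.Walk.edges_reverse,
    SimpleGraph.Walk.edges_cons, List.map_append, List.map_reverse, List.sum_append,
    List.sum_reverse, List.map_cons, List.sum_cons]
  rw [Sym2.eq_swap (a := y)]; ring

theorem RealizesOn.edge_cases (hT : T.IsTree) (h : RealizesOn T Set.univ ℓ δ) {x y : V}
    (hxy : T.Adj x y) (z : V) :
    δ x z = ℓ s(x, y) + δ y z ∨ δ y z = ℓ s(x, y) + δ x z := by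
  rcases h.edge_dichotomy hT hxy z with ⟨_, _, _, h1⟩ | ⟨_, _, _, h1⟩
  exacts [Or.inl h1, Or.inr h1]

/-- Walk from `x` to `y` as long as the next edge leads toward `z`. The first node from which it
leads away is the median, and `y` is the median if there is none. -/
theorem RealizesOn.median (hT : T.IsTree) (h : RealizesOn T Set.univ ℓ δ) (x y z : V) :
    ∃ m, Btw δ x m y ∧ Btw δ x m z ∧ Btw δ y m z := by
  obtain ⟨p, hp, -⟩ := hT.existsUnique_path x y
  induction p with
  | @nil u => exact ⟨u, by simp [Btw, h.self], by simp [Btw, h.self], by simp [Btw, h.self]⟩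
  | @cons u v w hadj p ih =>
    have hδ : δ u w = ℓ s(u, v) + δ v w := by
      rw [h.2 u trivial w trivial _ hp, h.2 v trivial w trivial p hp.of_cons]; simp
    rcases h.edge_cases hT hadj z with h1 | h1
    · obtain ⟨m, h2, h3, h4⟩ := ih hp.of_cons
      have t1 := h.tri hT u m w
      have t2 := h.tri hT u m z
      have t3 := h.tri hT u v m
      have := h.adj hadj
      refine ⟨m, ?_, ?_, h4⟩ <;> unfold Btw at * <;> linarith
    · refine ⟨u, by simp [Btw, h.self], by simp [Btw, h.self], ?_⟩
      have := h.concat hT hadj hδ h1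
      have := h.symm hT u w
      have := h.symm hT v w
      unfold Btw; linarith

/-- If `z` is on the side of `a`, the route from `r` to `z` passes through `a`, so `z` lies between
`a` and `r` only when `z = a`. -/
theorem RealizesOn.btw_cons (hT : T.IsTree) (h : RealizesOn T Set.univ ℓ δ) {a b r z : V}
    (hab : T.Adj a b) (hr : δ a r = ℓ s(a, b) + δ b r) :
    Btw δ a z r ↔ z = a ∨ (Btw δ b z r ∧ δ a z = ℓ s(a, b) + δ b z) := by
  have hl := h.len_pos hab
  constructor
  · intro hz
    rcases h.edge_cases hT hab z with h1 | h1
    · right; unfold Btw at *; exact ⟨by linarith, h1⟩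
    · left
      have := h.concat hT hab hr h1
      have := h.symm hT r b
      have := h.symm hT r z
      by_contra hne
      have := h.pos hT a z (Ne.symm hne)
      unfold Btw at *; linarith
  · rintro (rfl | ⟨h1, h2⟩)
    · simp [Btw, h.self]
    · unfold Btw at *; linarith

theorem RealizesOn.btw_total (hT : T.IsTree) (h : RealizesOn T Set.univ ℓ δ) (a r : V) :
    ∀ x y, Btw δ a x r → Btw δ a y r → Btw δ a x y ∨ Btw δ a y x := by
  obtain ⟨p, hp, -⟩ := hT.existsUnique_path a r
  induction p with
  | @nil u =>
    intro x y hx hy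
    left
    have e : x = u := by
      by_contra hne
      have := h.pos hT x u hne
      have := h.pos hT u x (Ne.symm hne)
      have := h.self u
      unfold Btw at *; linarith
    subst e
    simp [Btw, h.self]
  | @cons u v w hadj p ih =>
    have hδ : δ u w = ℓ s(u, v) + δ v w := by
      rw [h.2 u trivial w trivial _ hp, h.2 v trivial w trivial p hp.of_cons]; simp
    intro x y hx hy
    rcases (h.btw_cons hT hadj hδ).1 hx with rfl | ⟨hx, hx'⟩
    · left; simp [Btw, h.self]
    rcases (h.btw_cons hT hadj hδ).1 hy with rfl | ⟨hy, hy'⟩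
    · right; simp [Btw, h.self]
    rcases ih hp.of_cons x y hx hy with h1 | h1
    · left; unfold Btw at *; linarith
    · right; unfold Btw at *; linarith

theorem RealizesOn.mem_support_iff (hT : T.IsTree) (h : RealizesOn T Set.univ ℓ δ) {a r : V}
    (p : T.Walk a r) (hp : p.IsPath) (z : V) : z ∈ p.support ↔ Btw δ a z r := by
  induction p with
  | @nil u =>
    simp only [SimpleGraph.Walk.support_nil, List.mem_singleton]
    constructor
    · rintro rfl; simp [Btw, h.self]
    · intro hz
      by_contra hne
      have := h.pos hT z u hne
      have := h.pos hT u z (Ne.symm hne)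
      have := h.self u
      unfold Btw at *; linarith
  | @cons u v w hadj p ih =>
    have hδ : δ u w = ℓ s(u, v) + δ v w := by
      rw [h.2 u trivial w trivial _ hp, h.2 v trivial w trivial p hp.of_cons]; simp
    rw [SimpleGraph.Walk.support_cons, List.mem_cons, h.btw_cons hT hadj hδ, ih hp.of_cons]
    refine or_congr_right ⟨fun hz => ⟨hz, ?_⟩, fun hz => hz.1⟩
    rcases h.edge_cases hT hadj z with h1 | h1
    · exact h1
    · have := h.tri hT u z w
      have := h.len_pos hadj
      unfold Btw at *; linarith

theorem RealizesOn.support_sorted (hT : T.IsTree) (h : RealizesOn T Set.univ ℓ δ) {a r : V}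
    (p : T.Walk a r) (hp : p.IsPath) : p.support.Pairwise (fun x y => δ a x < δ a y) := by
  induction p with
  | @nil u => simp
  | @cons u v w hadj p ih =>
    have hδ : δ u w = ℓ s(u, v) + δ v w := by
      rw [h.2 u trivial w trivial _ hp, h.2 v trivial w trivial p hp.of_cons]; simp
    rw [SimpleGraph.Walk.support_cons, List.pairwise_cons]
    have hne : ∀ z ∈ p.support, z ≠ u := by
      rintro z hz rfl
      exact ((SimpleGraph.Walk.cons_isPath_iff hadj p).1 hp).2 hz
    refine ⟨fun z hz => ?_, (ih hp.of_cons).imp_of_mem ?_⟩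
    · rw [h.self]; exact h.pos hT _ _ (hne z hz).symm
    · intro x y hx hy hxy
      have e : ∀ z ∈ p.support, δ u z = ℓ s(u, v) + δ v z := fun z hz => by
        have hz' : z ∈ (SimpleGraph.Walk.cons hadj p).support := by simp [hz]
        have := (h.btw_cons hT hadj hδ).1 ((h.mem_support_iff hT _ hp z).1 hz')
        exact (this.resolve_left (hne z hz)).2
      rw [e x hx, e y hy]; linarith

/-- The path metric of a tree has all properties of a tree metric. -/
theorem RealizesOn.isTreeMetric (hT : T.IsTree) (h : RealizesOn T Set.univ ℓ δ) :
    IsTreeMetric T δ where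
  self := h.self
  symm := h.symm hT
  pos := h.pos hT
  tri := h.tri hT
  median := h.median hT
  four x y a r := by
    -- Project `x` and `y` to nodes `p` and `q` of the path from `a` to `r`. The order of `p` and
    -- `q` on it decides which alternative holds.
    obtain ⟨p, h1, h2, h3⟩ := h.median hT x a r
    obtain ⟨q, h4, h5, h6⟩ := h.median hT y a r
    have := h.tri hT x p y
    have := h.tri hT p q y
    have := h.symm hT
    have e1 := this q y
    have e2 := this p a
    have e3 := this q a
    have e4 := this p q
    rcases h.btw_total hT a r p q h3 h6 with h7 | h7 <;> unfold Btw at *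
    · right; linarith
    · left; linarith
  adj_btw x y z hxy hz := by
    have e := h.adj hxy
    have e1 := h.symm hT z y
    have e2 := h.symm hT z x
    rcases h.edge_cases hT hxy z with h1 | h1
    · right; by_contra hne
      have := h.pos hT z y hne
      unfold Btw at *; linarith
    · left; by_contra hne
      have := h.pos hT z x hne
      unfold Btw at *; linarith
  toward x y hxy := by
    obtain ⟨p, hp, -⟩ := hT.existsUnique_path x y
    cases p with
    | nil => exact absurd rfl hxy
    | @cons _ v _ hadj p =>
      refine ⟨v, hadj, ?_⟩
      have e := h.adj hadj
      unfold Btw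
      rw [h.2 x trivial y trivial _ hp, h.2 v trivial y trivial p hp.of_cons, e]; simp

end OfTree

/-! ### Betweenness in trees -/

section Metric

variable {V : Type*} {T : SimpleGraph V} {δ : V → V → ℝ}

/-- The offset `δ(v, a) - δ(v, r)`. -/
def offs (δ : V → V → ℝ) (a r v : V) : ℝ := δ v a - δ v r

namespace IsTreeMetric

theorem eq_of_le (h : IsTreeMetric T δ) {x y : V} (hxy : δ x y ≤ 0) : x = y := by
  by_contra hne
  exact absurd (h.pos x y hne) (not_lt.2 hxy)

theorem btw_left (h : IsTreeMetric T δ) (x y : V) : Btw δ x x y := by simp [Btw, h.self]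

theorem btw_right (h : IsTreeMetric T δ) (x y : V) : Btw δ x y y := by simp [Btw, h.self]

theorem btw_comm (h : IsTreeMetric T δ) {x y z : V} (hb : Btw δ x y z) : Btw δ z y x := by
  unfold Btw at *
  rw [h.symm z y, h.symm y x, h.symm z x]; linarith

theorem btw_trans (h : IsTreeMetric T δ) {x y z w : V} (h1 : Btw δ x y z) (h2 : Btw δ x z w) :
    Btw δ x y w := by
  have := h.tri y z w
  have := h.tri x y w
  unfold Btw at *; linarith

theorem btw_trans_right (h : IsTreeMetric T δ) {x y z w : V} (h1 : Btw δ x y z)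
    (h2 : Btw δ x z w) : Btw δ y z w := by
  have := h.tri y z w
  have := h.tri x y w
  unfold Btw at *; linarith

theorem btw_antisymm (h : IsTreeMetric T δ) {x y z : V} (h1 : Btw δ x y z) (h2 : Btw δ x z y) :
    y = z := by
  apply h.eq_of_le
  have := h.symm y z
  unfold Btw at *; linarith

/-- For the pairs `xy` and `ar`, the two alternatives of the four-point condition are the two
possible orders of `x` and `y` on the segment. -/
theorem btw_total (h : IsTreeMetric T δ) {a r x y : V} (hx : Btw δ a x r) (hy : Btw δ a y r) :
    Btw δ a x y ∨ Btw δ a y x := by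
  have t1 := h.tri a x y
  have t2 := h.tri a y x
  have s1 := h.symm x y
  have s2 := h.symm x a
  have s3 := h.symm y a
  rcases h.four x y a r with h1 | h1 <;> unfold Btw at *
  · right; linarith
  · left; linarith

theorem toward_unique (h : IsTreeMetric T δ) {x y y' a : V} (hy : T.Adj x y) (hy' : T.Adj x y')
    (hb : Btw δ x y a) (hb' : Btw δ x y' a) : y = y' := by
  rcases h.btw_total hb hb' with h1 | h1
  · rcases h.adj_btw _ _ _ hy' h1 with h2 | h2
    · exact absurd h2 hy.ne'
    · exact h2
  · rcases h.adj_btw _ _ _ hy h1 with h2 | h2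
    · exact absurd h2 hy'.ne'
    · exact h2.symm

theorem edge_cases (h : IsTreeMetric T δ) {x y : V} (hxy : T.Adj x y) (z : V) :
    Btw δ x y z ∨ Btw δ y x z := by
  obtain ⟨m, h1, h2, h3⟩ := h.median x y z
  rcases h.adj_btw _ _ _ hxy h1 with rfl | rfl
  · exact Or.inr h3
  · exact Or.inl h2

theorem not_btw_both (h : IsTreeMetric T δ) {x y z : V} (hne : x ≠ y) (h1 : Btw δ x y z)
    (h2 : Btw δ y x z) : False := by
  have := h.pos x y hne
  have := h.symm x y
  unfold Btw at *; linarith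

/-- If the median of `v`, `a`, `b` differs from `v`, the first edge from `v` toward it leads toward
both `a` and `b`. -/
theorem btw_of_branches (h : IsTreeMetric T δ) {v a b : V}
    (hn : ∀ y, T.Adj v y → Btw δ v y a → Btw δ v y b → False) : Btw δ a v b := by
  obtain ⟨m, h1, h2, h3⟩ := h.median v a b
  by_cases hm : v = m
  · rw [hm]; exact h3
  · obtain ⟨y, hy, hb⟩ := h.toward v m hm
    exact (hn y hy (h.btw_trans hb h1) (h.btw_trans hb h2)).elim

theorem btw_of_edge (h : IsTreeMetric T δ) {x y a r : V} (hxy : T.Adj x y) (h1 : Btw δ x y a)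
    (h2 : Btw δ y x r) : Btw δ a x r ∧ Btw δ a y r := by
  have hx : Btw δ a x r := by
    refine h.btw_of_branches fun z hz hza hzr => ?_
    obtain rfl := h.toward_unique hz hxy hza h1
    exact h.not_btw_both hxy.ne hzr h2
  refine ⟨hx, ?_⟩
  have := h.symm x a
  have := h.symm y a
  have := h.symm x y
  unfold Btw at *; linarith

/-- Crossing an edge changes the distances to `a` and to `r` by its length. The two changes cancel
in the offset unless the edge separates `a` from `r`. -/
theorem offs_adj (h : IsTreeMetric T δ) (a r : V) {x y : V} (hxy : T.Adj x y) :
    offs δ a r x = offs δ a r y ∨ (Btw δ a x r ∧ Btw δ a y r) := by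
  have := h.symm x y
  rcases h.edge_cases hxy a with h1 | h1 <;> rcases h.edge_cases hxy r with h2 | h2
  · left; unfold offs Btw at *; linarith
  · right; exact h.btw_of_edge hxy h1 h2
  · right
    have := h.btw_of_edge hxy h2 h1
    exact ⟨h.btw_comm this.1, h.btw_comm this.2⟩
  · left; unfold offs Btw at *; linarith

/-- Between `a` and `r` the offset equals `2 δ(a, ·) - δ(a, r)`, and the points of a segment are
told apart by their distance from `a`. -/
theorem offs_inj (h : IsTreeMetric T δ) {a r p q : V} (hp : Btw δ a p r) (hq : Btw δ a q r)
    (e : offs δ a r p = offs δ a r q) : p = q := by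
  have s1 := h.symm p a
  have s2 := h.symm q a
  apply h.eq_of_le
  have := h.symm p q
  rcases h.btw_total hp hq with h1 | h1 <;> unfold offs Btw at * <;> linarith

/-- The projection `p` of `x` to the segment is the median of `x`, `a`, `r`; the detour from `x` to
`p` cancels in the offset. With `offs_inj`, the level sets of the offset are the fibers of the
projection. -/
theorem gate (h : IsTreeMetric T δ) (a r x : V) :
    ∃ p, Btw δ a p r ∧ Btw δ x p a ∧ Btw δ x p r ∧ offs δ a r x = offs δ a r p := by
  obtain ⟨p, h1, h2, h3⟩ := h.median x a r
  refine ⟨p, h3, h1, h2, ?_⟩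
  unfold offs Btw at *; linarith

theorem gate_of_offs (h : IsTreeMetric T δ) {a r p x : V} (hp : Btw δ a p r)
    (e : offs δ a r x = offs δ a r p) : Btw δ x p a ∧ Btw δ x p r := by
  obtain ⟨q, h1, h2, h3, h4⟩ := h.gate a r x
  obtain rfl := h.offs_inj hp h1 (e.symm.trans h4)
  exact ⟨h2, h3⟩

theorem adj_of_btw (h : IsTreeMetric T δ) {x y : V} (hne : x ≠ y)
    (hb : ∀ z, Btw δ x z y → z = x ∨ z = y) : T.Adj x y := by
  obtain ⟨z, hz, hb'⟩ := h.toward x y hne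
  rcases hb z hb' with rfl | rfl
  · exact absurd rfl hz.ne
  · exact hz

/-! ### Labels -/

variable {L : Set V}

/-- At most one neighbour of `v` leads toward `a` and at most one toward `r`, whereas a latent node
has at least three neighbours. -/
theorem exists_off_branch (h : IsTreeMetric T δ) (hL : ∀ v, (T.neighborSet v).ncard ≤ 2 → v ∈ L)
    {v : V} (hv : v ∉ L) (a r : V) : ∃ y, T.Adj v y ∧ ¬ Btw δ v y a ∧ ¬ Btw δ v y r := by
  by_contra! hcon
  refine hv (hL v ?_)
  classical
  have hone : ∀ c, ∃ z, ∀ y, T.Adj v y → Btw δ v y c → y = z := fun c => by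
    by_cases hc : ∃ z, T.Adj v z ∧ Btw δ v z c
    · obtain ⟨z, hz, hzc⟩ := hc
      exact ⟨z, fun y hy hyc => h.toward_unique hy hz hyc hzc⟩
    · push Not at hc
      exact ⟨v, fun y hy hyc => (hc y hy hyc).elim⟩
  obtain ⟨z1, h1⟩ := hone a
  obtain ⟨z2, h2⟩ := hone r
  have hsub : T.neighborSet v ⊆ {z1, z2} := fun y hy => by
    by_cases hya : Btw δ v y a
    · exact Or.inl (h1 y hy hya)
    · exact Or.inr (h2 y hy (hcon y hy hya))
  exact (Set.ncard_le_ncard hsub (by simp)).trans ((Set.ncard_insert_le _ _).trans (by simp))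

/-- Behind every node, as seen from any other node, there is a label. -/
theorem exists_label_behind [Finite V] (h : IsTreeMetric T δ)
    (hL : ∀ v, (T.neighborSet v).ncard ≤ 2 → v ∈ L) (v v' : V) : ∃ l ∈ L, Btw δ v v' l := by
  -- A farthest node `z` behind `v'` must be a label: from a latent `z` some edge leads away from
  -- `v`, to a node that is still behind `v'`.
  obtain ⟨z, hz, hmax⟩ := Set.exists_max_image {z | Btw δ v v' z} (δ v) (Set.toFinite _)
    ⟨v', h.btw_right v v'⟩
  refine ⟨z, ?_, hz⟩
  by_contra hzL
  obtain ⟨y, hy, hyv, -⟩ := h.exists_off_branch hL hzL v v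
  have h1 := (h.edge_cases hy v).resolve_left hyv
  have h2 := h.btw_trans hz (h.btw_comm h1)
  have := hmax y h2
  have := h.pos z y hy.ne
  have := h.symm v z
  have := h.symm y z
  have := h.symm y v
  unfold Btw at *; linarith

/-- Every node is the median of three labels. -/
theorem exists_triple [Finite V] (h : IsTreeMetric T δ)
    (hL : ∀ v, (T.neighborSet v).ncard ≤ 2 → v ∈ L) (v : V) :
    ∃ a ∈ L, ∃ b ∈ L, ∃ c ∈ L, Btw δ a v b ∧ Btw δ a v c ∧ Btw δ b v c := by
  by_cases hv : v ∈ L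
  · exact ⟨v, hv, v, hv, v, hv, h.btw_left _ _, h.btw_left _ _, h.btw_left _ _⟩
  have hd : 2 < (T.neighborSet v).ncard := by
    by_contra hle
    exact hv (hL v (not_lt.1 hle))
  obtain ⟨y1, hy1, y2, hy2, y3, hy3, h12, h13, h23⟩ := (Set.two_lt_ncard (Set.toFinite _)).1 hd
  -- Labels behind two different neighbours of `v` are separated by `v`.
  have key : ∀ y y' l l', T.Adj v y → T.Adj v y' → y ≠ y' → Btw δ v y l → Btw δ v y' l' →
      Btw δ l v l' := fun y y' l l' hy hy' hne hl hl' =>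
    h.btw_of_branches fun z hz hzl hzl' =>
      hne ((h.toward_unique hy hz hl hzl).trans (h.toward_unique hz hy' hzl' hl'))
  obtain ⟨a, ha, ha'⟩ := h.exists_label_behind hL v y1
  obtain ⟨b, hb, hb'⟩ := h.exists_label_behind hL v y2
  obtain ⟨c, hc, hc'⟩ := h.exists_label_behind hL v y3
  exact ⟨a, ha, b, hb, c, hc, key _ _ _ _ hy1 hy2 h12 ha' hb', key _ _ _ _ hy1 hy3 h13 ha' hc',
    key _ _ _ _ hy2 hy3 h23 hb' hc'⟩

/-- The node `m` lies between `l` and at least one of `a`, `b`; for the other one the triangle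
inequality bounds the difference. So distances from `m` to labels are computable from distances
between labels once `m` is a median of labels. -/
theorem dist_of_btw (h : IsTreeMetric T δ) {a b m : V} (hm : Btw δ a m b) (l : V) :
    δ m l = max (δ a l - δ m a) (δ b l - δ m b) := by
  have t1 := h.tri a m l
  have t2 := h.tri b m l
  have s1 := h.symm a m
  have s2 := h.symm b m
  have s3 := h.symm l m
  have s4 := h.symm l a
  have s5 := h.symm l b
  apply le_antisymm
  · rcases h.four l m a b with h1 | h1 <;> unfold Btw at *
    · exact le_max_of_le_left (by linarith)
    · exact le_max_of_le_right (by linarith)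
  · exact max_le (by linarith) (by linarith)

theorem median_dist (h : IsTreeMetric T δ) {a b c m : V} (h1 : Btw δ a m b) (h2 : Btw δ a m c)
    (h3 : Btw δ b m c) : δ m a = (δ a b + δ a c - δ b c) / 2 ∧ δ m b = (δ a b + δ b c - δ a c) / 2 := by
  have s1 := h.symm a m
  have s2 := h.symm b m
  unfold Btw at *
  constructor <;> linarith

end IsTreeMetric

/-! ### Uniqueness of semi-labelled trees -/

section Unique

variable {V₁ V₂ L : Type*} {T₁ : SimpleGraph V₁} {T₂ : SimpleGraph V₂}
  {δ₁ : V₁ → V₁ → ℝ} {δ₂ : V₂ → V₂ → ℝ} {i₁ : L → V₁} {i₂ : L → V₂}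

/-- Write `v` as the median of three labels and let `v'` be the median of the same labels in the
other tree. The distances from a median to all labels are given by the same formula in the label
distances. -/
theorem IsTreeMetric.exists_match [Finite V₁] (h₁ : IsTreeMetric T₁ δ₁)
    (h₂ : IsTreeMetric T₂ δ₂) (hL : ∀ v, (T₁.neighborSet v).ncard ≤ 2 → v ∈ Set.range i₁)
    (he : ∀ a b, δ₁ (i₁ a) (i₁ b) = δ₂ (i₂ a) (i₂ b)) (v : V₁) :
    ∃ v' : V₂, ∀ l, δ₂ v' (i₂ l) = δ₁ v (i₁ l) := by
  obtain ⟨_, ⟨a, rfl⟩, _, ⟨b, rfl⟩, _, ⟨c, rfl⟩, hab, hac, hbc⟩ := h₁.exists_triple hL v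
  obtain ⟨m, h1, h2, h3⟩ := h₂.median (i₂ a) (i₂ b) (i₂ c)
  refine ⟨m, fun l => ?_⟩
  obtain ⟨e1, e2⟩ := h₁.median_dist hab hac hbc
  obtain ⟨e3, e4⟩ := h₂.median_dist h1 h2 h3
  rw [h₁.dist_of_btw hab, h₂.dist_of_btw h1, e1, e2, e3, e4]
  simp only [he]

/-- A label behind `v'`, as seen from `v`, is farther from `v` than from `v'` by exactly `δ₁ v v'`.
-/
theorem IsTreeMetric.eq_of_label_dist [Finite V₁] (h₁ : IsTreeMetric T₁ δ₁)
    (hL : ∀ v, (T₁.neighborSet v).ncard ≤ 2 → v ∈ Set.range i₁) {v v' : V₁}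
    (he : ∀ l, δ₁ v (i₁ l) = δ₁ v' (i₁ l)) : v = v' := by
  obtain ⟨_, ⟨l, rfl⟩, hl⟩ := h₁.exists_label_behind hL v v'
  apply h₁.eq_of_le
  have := he l
  unfold Btw at *; linarith

/-- For a label behind `w`, the distance of `v` and `w` is a difference of label distances; in the
other tree the same difference is a lower bound. -/
theorem IsTreeMetric.le_of_label_dist [Finite V₁] (h₁ : IsTreeMetric T₁ δ₁)
    (h₂ : IsTreeMetric T₂ δ₂) (hL : ∀ v, (T₁.neighborSet v).ncard ≤ 2 → v ∈ Set.range i₁)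
    {v w : V₁} {v' w' : V₂} (hv : ∀ l, δ₂ v' (i₂ l) = δ₁ v (i₁ l))
    (hw : ∀ l, δ₂ w' (i₂ l) = δ₁ w (i₁ l)) : δ₁ v w ≤ δ₂ v' w' := by
  obtain ⟨_, ⟨l, rfl⟩, hl⟩ := h₁.exists_label_behind hL v w
  have := h₂.tri v' w' (i₂ l)
  have := hv l
  have := hw l
  unfold Btw at *; linarith

/-- A semi-labelled tree is determined by the distances between its labels. -/
theorem IsTreeMetric.exists_isometry [Finite V₁] [Finite V₂] (h₁ : IsTreeMetric T₁ δ₁)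
    (h₂ : IsTreeMetric T₂ δ₂) (hL₁ : ∀ v, (T₁.neighborSet v).ncard ≤ 2 → v ∈ Set.range i₁)
    (hL₂ : ∀ v, (T₂.neighborSet v).ncard ≤ 2 → v ∈ Set.range i₂)
    (he : ∀ a b, δ₁ (i₁ a) (i₁ b) = δ₂ (i₂ a) (i₂ b)) :
    ∃ e : T₁ ≃g T₂, ∀ l, e (i₁ l) = i₂ l := by
  choose f hf using h₁.exists_match h₂ hL₁ he
  choose g hg using h₂.exists_match h₁ hL₂ (fun a b => (he a b).symm)
  have hfg : ∀ v, f (g v) = v := fun v =>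
    h₂.eq_of_label_dist hL₂ fun l => (hf _ l).trans (hg v l)
  have hgf : ∀ v, g (f v) = v := fun v =>
    h₁.eq_of_label_dist hL₁ fun l => (hg _ l).trans (hf v l)
  have hiso : ∀ v w, δ₂ (f v) (f w) = δ₁ v w := fun v w =>
    le_antisymm (h₂.le_of_label_dist h₁ hL₂ (fun l => (hf v l).symm) (fun l => (hf w l).symm))
      (h₁.le_of_label_dist h₂ hL₁ (hf v) (hf w))
  let e : V₁ ≃ V₂ := ⟨f, g, hgf, hfg⟩
  refine ⟨⟨e, ?_⟩, fun l => h₂.eq_of_label_dist hL₂ fun l' => (hf _ l').trans (he l l')⟩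
  -- Adjacency means that no third node lies between, so an isometry of the node sets preserves it.
  intro v w
  constructor
  · intro hadj
    refine h₁.adj_of_btw (fun hvw => hadj.ne (congrArg f hvw)) fun z hz => ?_
    have : Btw δ₂ (f v) (f z) (f w) := by unfold Btw at *; simpa only [hiso] using hz
    rcases h₂.adj_btw _ _ _ hadj this with h | h
    · exact Or.inl (e.injective h)
    · exact Or.inr (e.injective h)
  · intro hadj
    refine h₂.adj_of_btw (fun hvw => hadj.ne (e.injective hvw)) fun z hz => ?_
    have : Btw δ₁ v (g z) w := by
      unfold Btw at *
      rw [← hiso, ← hiso, ← hiso, hfg]; exact hz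
    rcases h₁.adj_btw _ _ _ hadj this with h | h
    · left; rw [← h]; exact (hfg z).symm
    · right; rw [← h]; exact (hfg z).symm

end Unique

end Metric

/-! ### Pieces of a tree -/

section Pieces

variable {V : Type*} {T : SimpleGraph V} {δ : V → V → ℝ}

/-- The set `X` consists of `r` and of components of the tree without `r`. -/
def IsPiece (T : SimpleGraph V) (X : Finset V) (r : V) : Prop :=
  r ∈ X ∧ ∀ x ∈ X, x ≠ r → ∀ y, T.Adj x y → y ∈ X

/-- Consider the farthest node of `X` on the way from `x` to `y`. If it were not `r`, its neighbour
toward `y` would also belong to `X`. -/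
theorem IsPiece.exit {X : Finset V} {r : V} (hX : IsPiece T X r) (h : IsTreeMetric T δ) {x y : V}
    (hx : x ∈ X) (hy : y ∉ X) : Btw δ x r y := by
  classical
  obtain ⟨z, hz, hmax⟩ := Finset.exists_max_image {z ∈ X | Btw δ x z y} (δ x)
    ⟨x, by simp [hx, h.btw_left]⟩
  simp only [Finset.mem_filter, and_imp] at hz hmax
  by_cases hzr : z = r
  · exact hzr ▸ hz.2
  obtain ⟨z', hzz', hb⟩ := h.toward z y (fun e => hy (e ▸ hz.1))
  have h1 : Btw δ x z z' := h.btw_comm (h.btw_trans_right (h.btw_comm hb) (h.btw_comm hz.2))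
  have h2 : Btw δ x z' y := by
    have := hz.2
    unfold Btw at *; linarith
  have := hmax z' (hX.2 z hz.1 hzr z' hzz') h2
  have := h.pos z z' hzz'.ne
  unfold Btw at h1; linarith

theorem IsPiece.btw_mem {X : Finset V} {r : V} (hX : IsPiece T X r) (h : IsTreeMetric T δ)
    {x z : V} (hx : x ∈ X) (hz : Btw δ x z r) : z ∈ X := by
  by_contra hzX
  exact hzX (h.btw_antisymm hz (hX.exit h hx hzX) ▸ hX.1)

/-- A label behind `y`, as seen from `r`, is in `X`, because leaving `X` from `y` would mean passing
through `r`. -/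
theorem IsPiece.exists_label [Finite V] {X : Finset V} {r : V} (hX : IsPiece T X r)
    (h : IsTreeMetric T δ) {L : Set V} (hL : ∀ v, (T.neighborSet v).ncard ≤ 2 → v ∈ L) {y : V}
    (hy : y ∈ X) (hyr : y ≠ r) : ∃ l ∈ X, l ∈ L ∧ l ≠ r := by
  obtain ⟨l, hl, hb⟩ := h.exists_label_behind hL r y
  refine ⟨l, ?_, hl, ?_⟩
  · by_contra hlX
    have := hX.exit h hy hlX
    exact h.not_btw_both hyr this hb
  · rintro rfl
    refine hyr (h.eq_of_le ?_)
    have := h.self l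
    have := h.symm l y
    unfold Btw at hb; linarith

open Classical in
/-- The nodes of `X` which project to the same node of the path from `a` to `r` as `z`. -/
noncomputable def fiber (δ : V → V → ℝ) (a r : V) (X : Finset V) (z : V) : Finset V :=
  {x ∈ X | offs δ a r x = offs δ a r z}

theorem mem_fiber {a r : V} {X : Finset V} {z x : V} :
    x ∈ fiber δ a r X z ↔ x ∈ X ∧ offs δ a r x = offs δ a r z := by
  simp [fiber]

/-- A node of the fiber other than `p` is off the path from `a` to `r`, so the edges at it preserve
the offset; it is not `r` either, so they stay in `X`. -/
theorem IsPiece.isPiece_fiber {X : Finset V} {r : V} (hX : IsPiece T X r) (h : IsTreeMetric T δ) {a p : V}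
    (hp : Btw δ a p r) (hpX : p ∈ X) : IsPiece T (fiber δ a r X p) p := by
  refine ⟨mem_fiber.2 ⟨hpX, rfl⟩, fun x hx hxp y hxy => ?_⟩
  rw [mem_fiber] at hx ⊢
  have hnot : ¬ Btw δ a x r := fun hb => hxp (h.offs_inj hb hp hx.2)
  refine ⟨hX.2 x hx.1 (fun e => hnot (e ▸ h.btw_right _ _)) y hxy, ?_⟩
  rcases h.offs_adj a r hxy with e | e
  · rw [← e, hx.2]
  · exact (hnot e.1).elim

/-- If `p` is latent and not `r`, some edge at `p` leaves the path, and the branch behind it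
contains a label. Hence no node of the path is missed when `basic` groups the nodes of the bag by
offset. -/
theorem IsPiece.exists_label_fiber [Finite V] {X : Finset V} {r : V} (hX : IsPiece T X r)
    (h : IsTreeMetric T δ) {L : Set V} (hL : ∀ v, (T.neighborSet v).ncard ≤ 2 → v ∈ L) {a p : V}
    (hp : Btw δ a p r) (hpX : p ∈ X) : ∃ l ∈ fiber δ a r X p, l ∈ L ∨ l = r := by
  by_cases hpc : p ∈ L ∨ p = r
  · exact ⟨p, mem_fiber.2 ⟨hpX, rfl⟩, hpc⟩
  push Not at hpc
  obtain ⟨y, hy, hya, hyr⟩ := h.exists_off_branch hL hpc.1 a r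
  have h1 := (h.edge_cases hy a).resolve_left hya
  have h2 := (h.edge_cases hy r).resolve_left hyr
  have hyf : y ∈ fiber δ a r X p := by
    refine mem_fiber.2 ⟨hX.2 p hpX hpc.2 y hy, ?_⟩
    unfold offs Btw at *; linarith
  obtain ⟨l, hl, hl', -⟩ := (hX.isPiece_fiber h hp hpX).exists_label h hL hyf hy.ne'
  exact ⟨l, hl, Or.inl hl'⟩

/-- The regular nodes of the piece `X`, and its representative `r`. -/
def core [DecidableEq V] (W X : Finset V) (r : V) : Finset V := {x ∈ X | x ∈ W ∨ x = r}

theorem mem_core [DecidableEq V] {W X : Finset V} {r x : V} :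
    x ∈ core W X r ↔ x ∈ X ∧ (x ∈ W ∨ x = r) := by simp [core]

end Pieces

/-! ### Names of the nodes found by the algorithm -/

section Config

variable {V : Type*} [DecidableEq V] {W : Finset V} {T : SimpleGraph V} {δ : V → V → ℝ}

/-- Names of the nodes of the tree, the set of the nodes that have been named, and the oracle. -/
structure Config (W : Finset V) where
  name : V → Node W
  named : Finset V
  oracle : Oracle W

/-- The names are distinct, extend the labels, and are in use by the oracle. -/
structure Config.Valid (c : Config W) : Prop where
  sub : W ⊆ c.named
  label : ∀ w : W, c.name w = Sum.inl w
  inj : Set.InjOn c.name c.named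
  lt : ∀ x ∈ c.named, ∀ n, c.name x = Sum.inr n → n < c.oracle.next

/-- The configuration `c'` extends `c`. -/
structure Config.Le (c c' : Config W) : Prop where
  sub : c.named ⊆ c'.named
  name : ∀ x ∈ c.named, c'.name x = c.name x
  dist : ∀ x ∈ c.named, ∀ y ∈ c.named,
    c'.oracle.dist (c.name x) (c.name y) = c.oracle.dist (c.name x) (c.name y)

/-- The names and the distances of all nodes of the core of a piece are known. -/
structure Config.Known (δ : V → V → ℝ) (c : Config W) (t : Finset V × V) : Prop where
  root : t.2 ∈ c.named
  dist : ∀ x ∈ core W t.1 t.2, ∀ y ∈ core W t.1 t.2, c.oracle.dist (c.name x) (c.name y) = δ x y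

/-- The latent nodes of the piece other than the representative have no names. -/
def Config.Fresh (c : Config W) (t : Finset V × V) : Prop :=
  ∀ x ∈ t.1, x ∈ c.named → x ≠ t.2 → x ∈ W

/-- The bag of names of a piece. -/
def mkBag (W : Finset V) (name : V → Node W) (t : Finset V × V) : Bag W :=
  ⟨(core W t.1 t.2).image name, name t.2⟩

theorem Config.Le.refl (c : Config W) : c.Le c := ⟨subset_rfl, fun _ _ => rfl, fun _ _ _ _ => rfl⟩

theorem Config.Le.trans {c c' c'' : Config W} (h : c.Le c') (h' : c'.Le c'') : c.Le c'' where
  sub := h.sub.trans h'.sub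
  name x hx := (h'.name x (h.sub hx)).trans (h.name x hx)
  dist x hx y hy := by
    have := h'.dist x (h.sub hx) y (h.sub hy)
    rw [h.name x hx, h.name y hy] at this
    rw [this, h.dist x hx y hy]

theorem Config.Valid.core_named {c : Config W} (hc : c.Valid) {t : Finset V × V}
    (ht : t.2 ∈ c.named) {x : V} (hx : x ∈ core W t.1 t.2) : x ∈ c.named := by
  rcases (mem_core.1 hx).2 with h | rfl
  exacts [hc.sub h, ht]

theorem Config.Known.mono {c c' : Config W} (hc : c.Valid) {t : Finset V × V} (ht : c.Known δ t)
    (h : c.Le c') : c'.Known δ t where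
  root := h.sub ht.root
  dist x hx y hy := by
    have hx' := hc.core_named ht.root hx
    have hy' := hc.core_named ht.root hy
    rw [h.name x hx', h.name y hy', h.dist x hx' y hy', ht.dist x hx y hy]

theorem Config.Known.mkBag_eq {c c' : Config W} (hc : c.Valid) {t : Finset V × V}
    (ht : c.Known δ t) (h : c.Le c') : mkBag W c'.name t = mkBag W c.name t := by
  unfold mkBag
  rw [h.name _ ht.root, Finset.image_congr (fun x hx => h.name x (hc.core_named ht.root hx))]

theorem argmin_spec {α : Type*} {s : Finset α} (f : α → ℝ) (a : α) (hs : s.Nonempty) :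
    argmin s f a ∈ s ∧ ∀ x ∈ s, f (argmin s f a) ≤ f x := by
  unfold argmin
  rw [dif_pos hs]
  exact (s.exists_min_image f hs).choose_spec

theorem Config.Known.offset_eq {c : Config W} {X : Finset V} {r : V} (ht : c.Known δ (X, r))
    {a x : V} (hr : r ∈ core W X r) (ha : a ∈ core W X r) (hx : x ∈ core W X r) :
    c.oracle.offset (c.name a) (c.name r) (c.name x) = offs δ a r x := by
  unfold Oracle.offset offs
  rw [ht.dist x hx a ha, ht.dist x hx r hr]

theorem basicStep_of_eq {L : Type*} [DecidableEq L] {o : Oracle L} {B : Bag L} {α u : Node L}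
    {acc : List (Bag L) × Oracle L} {x : ℝ} {S : Finset (Node L)}
    (hS : B.nodes.filter (fun v => o.offset α B.rep v = x) = S)
    (hu : argmin S (fun v => o.dist v α) α = u)
    (hcond : o.dist B.rep u + o.dist u α = o.dist B.rep α) :
    basicStep o B α acc x = (acc.1 ++ [⟨S, u⟩], acc.2) := by
  subst hS hu
  exact if_pos hcond

theorem basicStep_of_ne {L : Type*} [DecidableEq L] {o : Oracle L} {B : Bag L} {α u : Node L}
    {acc : List (Bag L) × Oracle L} {x : ℝ} {S : Finset (Node L)}
    (hS : B.nodes.filter (fun v => o.offset α B.rep v = x) = S)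
    (hu : argmin S (fun v => o.dist v α) α = u)
    (hcond : ¬ o.dist B.rep u + o.dist u α = o.dist B.rep α) :
    basicStep o B α acc x = (acc.1 ++ [⟨insert (Sum.inr acc.2.next) S, Sum.inr acc.2.next⟩],
      acc.2.addLatent S (fun v => (o.dist v α + o.dist v B.rep - o.dist α B.rep) / 2)) := by
  subst hS hu
  exact if_neg hcond

/-- One pass of `basic` finds the piece that hangs at the node `p` of the path. -/
theorem basicStep_spec [Finite V] (h : IsTreeMetric T δ)
    (hL : ∀ v, (T.neighborSet v).ncard ≤ 2 → v ∈ (W : Set V)) {c c₁ : Config W} (hc : c.Valid)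
    (hc₁ : c₁.Valid) (hle : c.Le c₁) {X : Finset V} {r a p : V} (hX : IsPiece T X r)
    (hk : c.Known δ (X, r)) (ha : a ∈ core W X r) (hp : Btw δ a p r)
    (hnew : p ∈ c₁.named → p ∈ core W X r) (bags : List (Bag W)) :
    ∃ c₂ : Config W, c₂.Valid ∧ c₁.Le c₂ ∧ c₂.named = insert p c₁.named ∧
      c₂.Known δ (fiber δ a r X p, p) ∧
      basicStep c.oracle (mkBag W c.name (X, r)) (c.name a) (bags, c₁.oracle) (offs δ a r p) =
        (bags ++ [mkBag W c₂.name (fiber δ a r X p, p)], c₂.oracle) := by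
  classical
  have hr : r ∈ core W X r := mem_core.2 ⟨hX.1, Or.inr rfl⟩
  have hpX : p ∈ X := hX.btw_mem h (mem_core.1 ha).1 hp
  set F := (core W X r).filter (fun x => offs δ a r x = offs δ a r p) with hF
  have hcn : ∀ x ∈ core W X r, x ∈ c.named := fun x hx => hc.core_named hk.root hx
  have hBi : (mkBag W c.name (X, r)).nodes.filter
      (fun v => c.oracle.offset (c.name a) (mkBag W c.name (X, r)).rep v = offs δ a r p) =
      F.image c.name := by
    change ((core W X r).image c.name).filter
      (fun v => c.oracle.offset (c.name a) (c.name r) v = offs δ a r p) = _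
    rw [Finset.filter_image]
    exact congrArg (Finset.image c.name)
      (Finset.filter_congr fun x hx => by rw [hk.offset_eq hr ha hx])
  have hFne : F.Nonempty := by
    obtain ⟨l, hl, hl'⟩ := hX.exists_label_fiber h hL hp hpX
    rw [mem_fiber] at hl
    exact ⟨l, by simp [hF, mem_core, hl.1, hl.2, by simpa using hl']⟩
  obtain ⟨hu, humin⟩ := argmin_spec (fun v => c.oracle.dist v (c.name a)) (c.name a)
    (hFne.image c.name)
  obtain ⟨x, hxF, hxu⟩ := Finset.mem_image.1 hu
  have hxc : x ∈ core W X r := (Finset.mem_filter.1 hxF).1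
  obtain ⟨hxa, hxr⟩ := h.gate_of_offs hp (Finset.mem_filter.1 hxF).2
  -- The test of `basic` asks whether the minimizer is on the path, and `p` is the only path node
  -- with this offset.
  have hcond : c.oracle.dist (c.name r) (c.name x) + c.oracle.dist (c.name x) (c.name a) =
      c.oracle.dist (c.name r) (c.name a) ↔ x = p := by
    rw [hk.dist r hr x hxc, hk.dist x hxc a ha, hk.dist r hr a ha]
    constructor
    · intro e
      exact h.offs_inj (h.btw_comm e) hp (Finset.mem_filter.1 hxF).2
    · rintro rfl
      exact h.btw_comm hp
  -- If `p` is in the bag, it is the minimizer, since it lies between `a` and every node of its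
  -- fiber. Otherwise `p` is latent and not yet named, and receives the next unused name.
  by_cases hpc : p ∈ core W X r
  · have hpF : p ∈ F := Finset.mem_filter.2 ⟨hpc, rfl⟩
    have hxp : x = p := by
      have := humin _ (Finset.mem_image_of_mem c.name hpF)
      rw [← hxu, hk.dist x hxc a ha, hk.dist p hpc a ha] at this
      apply h.eq_of_le
      unfold Btw at hxa; linarith
    have hcore : core W (fiber δ a r X p) p = F := by
      ext y
      simp only [hF, mem_core, mem_fiber, Finset.mem_filter]
      constructor
      · rintro ⟨⟨h1, h2⟩, h3 | rfl⟩
        · exact ⟨⟨h1, Or.inl h3⟩, h2⟩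
        · exact ⟨mem_core.1 hpc, rfl⟩
      · rintro ⟨⟨h1, h3 | rfl⟩, h2⟩
        · exact ⟨⟨h1, h2⟩, Or.inl h3⟩
        · exact ⟨⟨h1, h2⟩, Or.inr (h.offs_inj (h.btw_right _ _) hp h2)⟩
    rw [basicStep_of_eq hBi hxu.symm (hcond.2 hxp)]
    have hpn : p ∈ c₁.named := hle.sub (hcn p hpc)
    refine ⟨c₁, hc₁, Config.Le.refl _, (Finset.insert_eq_of_mem hpn).symm, ⟨hpn, ?_⟩, ?_⟩
    · have hk' := hk.mono hc hle
      rw [hcore]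
      exact fun y hy z hz => hk'.dist y (Finset.mem_filter.1 hy).1 z (Finset.mem_filter.1 hz).1
    · unfold mkBag
      rw [hcore, hxp, hle.name p (hcn p hpc),
        Finset.image_congr (fun y hy => hle.name y (hcn y (Finset.mem_filter.1 hy).1))]
  · have hxp : x ≠ p := fun e => hpc (e ▸ hxc)
    have hpn : p ∉ c₁.named := fun hh => hpc (hnew hh)
    have hpW : p ∉ W := fun hh => hpn (hc₁.sub hh)
    rw [basicStep_of_ne hBi hxu.symm (fun hh => hxp (hcond.1 hh))]
    have hcore : core W (fiber δ a r X p) p = insert p F := by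
      ext y
      simp only [hF, mem_core, mem_fiber, Finset.mem_filter, Finset.mem_insert]
      constructor
      · rintro ⟨⟨h1, h2⟩, h3 | rfl⟩
        · exact Or.inr ⟨⟨h1, Or.inl h3⟩, h2⟩
        · exact Or.inl rfl
      · rintro (rfl | ⟨⟨h1, h3 | rfl⟩, h2⟩)
        · exact ⟨⟨hpX, rfl⟩, Or.inr rfl⟩
        · exact ⟨⟨h1, h2⟩, Or.inl h3⟩
        · exact ⟨⟨h1, h2⟩, Or.inr (h.offs_inj (h.btw_right _ _) hp h2)⟩
    have hname : ∀ y ∈ c₁.named, Function.update c₁.name p (Sum.inr c₁.oracle.next) y = c₁.name y :=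
      fun y hy => Function.update_of_ne (by rintro rfl; exact hpn hy) _ _
    have hnext : ∀ y ∈ c₁.named, c₁.name y ≠ Sum.inr c₁.oracle.next := fun y hy e =>
      lt_irrefl _ (hc₁.lt y hy _ e)
    have hFn : ∀ y ∈ F, y ∈ c₁.named := fun y hy => hle.sub (hcn y (Finset.mem_filter.1 hy).1)
    have hFname : ∀ y ∈ F, c₁.name y = c.name y := fun y hy =>
      hle.name y (hcn y (Finset.mem_filter.1 hy).1)
    have himg : F.image c.name = F.image c₁.name :=
      (Finset.image_congr (fun y hy => hFname y hy)).symm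
    have hnextF : (Sum.inr c₁.oracle.next : Node W) ∉ F.image c.name := by
      rw [himg]
      intro hh
      obtain ⟨y, hy, e⟩ := Finset.mem_image.1 hh
      exact hnext y (hFn y hy) e
    refine ⟨⟨Function.update c₁.name p (Sum.inr c₁.oracle.next), insert p c₁.named,
      c₁.oracle.addLatent (F.image c.name) (fun v => (c.oracle.dist v (c.name a) +
        c.oracle.dist v (c.name r) - c.oracle.dist (c.name a) (c.name r)) / 2)⟩,
      ⟨hc₁.sub.trans (Finset.subset_insert _ _), ?_, ?_, ?_⟩,
      ⟨Finset.subset_insert _ _, hname, ?_⟩, rfl, ⟨Finset.mem_insert_self _ _, ?_⟩, ?_⟩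
    · intro w
      exact (hname w (hc₁.sub w.2)).trans (hc₁.label w)
    · simp only [Finset.coe_insert]
      rw [Set.injOn_insert (by simpa using hpn)]
      refine ⟨hc₁.inj.congr fun y hy => (hname y hy).symm, ?_⟩
      rintro ⟨y, hy, e⟩
      rw [hname y hy, Function.update_self] at e
      exact hnext y hy e
    · intro y hy n e
      dsimp only [Oracle.addLatent] at *
      rcases Finset.mem_insert.1 hy with rfl | hy
      · rw [Function.update_self] at e
        have := Sum.inr.inj e
        omega
      · rw [hname y hy] at e
        have := hc₁.lt y hy n e
        omega
    · intro y hy z hz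
      dsimp only [Oracle.addLatent]
      simp [hnext y hy, hnext z hz]
    · dsimp only
      rw [hcore]
      have hpF : p ∉ F := fun hh => hpn (hFn p hh)
      -- The stored value is the Gromov product of `a` and `r` at `y`, which is the distance from
      -- `y` to its projection `p`.
      have hval : ∀ y ∈ F, (c.oracle.dist (c₁.name y) (c.name a) +
          c.oracle.dist (c₁.name y) (c.name r) - c.oracle.dist (c.name a) (c.name r)) / 2 =
          δ y p := fun y hy => by
        have hyc := (Finset.mem_filter.1 hy).1
        rw [hFname y hy, hk.dist y hyc a ha, hk.dist y hyc r hr, hk.dist a ha r hr]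
        obtain ⟨h1, h2⟩ := h.gate_of_offs hp (Finset.mem_filter.1 hy).2
        have := h.symm p a
        unfold Btw at *; linarith
      have hmem : ∀ y ∈ F, c₁.name y ∈ F.image c.name := fun y hy => by
        rw [himg]; exact Finset.mem_image_of_mem _ hy
      intro y hy z hz
      rcases Finset.mem_insert.1 hy with rfl | hy <;> rcases Finset.mem_insert.1 hz with rfl | hz
      · rw [Function.update_self, h.self]
        dsimp only [Oracle.addLatent]
        rw [if_neg (fun hh => hnextF hh.2), if_neg (fun hh => hnextF hh.2), if_pos ⟨rfl, rfl⟩]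
      · rw [Function.update_self, hname z (hFn z hz)]
        dsimp only [Oracle.addLatent]
        rw [if_pos ⟨rfl, hmem z hz⟩, hval z hz, h.symm]
      · rw [Function.update_self, hname y (hFn y hy)]
        dsimp only [Oracle.addLatent]
        rw [if_neg (fun hh => hnext y (hFn y hy) hh.1), if_pos ⟨rfl, hmem y hy⟩, hval y hy]
      · rw [hname z (hFn z hz), hname y (hFn y hy)]
        dsimp only [Oracle.addLatent]
        rw [if_neg (fun hh => hnext y (hFn y hy) hh.1), if_neg (fun hh => hnext z (hFn z hz) hh.1),
          if_neg (fun hh => hnext y (hFn y hy) hh.1)]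
        exact (hk.mono hc hle).dist y (Finset.mem_filter.1 hy).1 z (Finset.mem_filter.1 hz).1
    · dsimp only [mkBag]
      rw [hcore, Finset.image_insert, Function.update_self,
        Finset.image_congr (fun y hy => (hname y (hFn y hy)).trans (hFname y hy))]

/-- The passes of `basic` along a part of the path. -/
theorem basicStep_foldl_spec [Finite V] (h : IsTreeMetric T δ)
    (hL : ∀ v, (T.neighborSet v).ncard ≤ 2 → v ∈ (W : Set V)) {c : Config W} (hc : c.Valid)
    {X : Finset V} {r a : V} (hX : IsPiece T X r) (hk : c.Known δ (X, r)) (ha : a ∈ core W X r)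
    (ps : List V) (hnd : ps.Nodup) (hps : ∀ p ∈ ps, Btw δ a p r) (c₁ : Config W) (hc₁ : c₁.Valid)
    (hle : c.Le c₁) (hnew : ∀ p ∈ ps, p ∈ c₁.named → p ∈ core W X r) (bags : List (Bag W)) :
    ∃ c₂ : Config W, c₂.Valid ∧ c₁.Le c₂ ∧ c₂.named = ps.toFinset ∪ c₁.named ∧
      (∀ p ∈ ps, c₂.Known δ (fiber δ a r X p, p)) ∧
      (ps.map (offs δ a r)).foldl
        (basicStep c.oracle (mkBag W c.name (X, r)) (c.name a)) (bags, c₁.oracle) =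
        (bags ++ ps.map (fun p => mkBag W c₂.name (fiber δ a r X p, p)), c₂.oracle) := by
  induction ps generalizing c₁ bags with
  | nil => exact ⟨c₁, hc₁, Config.Le.refl _, by simp, by simp, by simp⟩
  | cons p ps ih =>
    rw [List.nodup_cons] at hnd
    obtain ⟨c₂, hc₂, hle₂, hn₂, hk₂, e₂⟩ := basicStep_spec h hL hc hc₁ hle hX hk ha
      (hps p (by simp)) (hnew p (by simp)) bags
    obtain ⟨c₃, hc₃, hle₃, hn₃, hk₃, e₃⟩ := ih hnd.2 (fun q hq => hps q (by simp [hq])) c₂ hc₂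
      (hle.trans hle₂) (fun q hq hq' => by
        rw [hn₂, Finset.mem_insert] at hq'
        rcases hq' with rfl | hq'
        · exact (hnd.1 hq).elim
        · exact hnew q (by simp [hq]) hq') (bags ++ [mkBag W c₂.name (fiber δ a r X p, p)])
    refine ⟨c₃, hc₃, hle₂.trans hle₃, ?_, ?_, ?_⟩
    · rw [hn₃, hn₂]; ext; simp
    · intro q hq
      rcases List.mem_cons.1 hq with rfl | hq
      · exact hk₂.mono hc₂ hle₃
      · exact hk₃ q hq
    · rw [List.map_cons, List.foldl_cons, e₂, e₃, List.map_cons, hk₂.mkBag_eq hc₂ hle₃]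
      simp

theorem zipWith_support {N : Type*} (f : V → N) {a r : V} (p : T.Walk a r) :
    List.zipWith (fun x y => s(x, y)) (p.support.map f) (p.support.map f).tail =
      p.edges.map (Sym2.map f) := by
  induction p with
  | nil => simp
  | cons hadj p ih =>
    rw [SimpleGraph.Walk.support_cons, SimpleGraph.Walk.edges_cons, List.map_cons, List.tail_cons,
      List.map_cons, ← ih]
    cases p <;> simp

/-- The bags, the skeleton and the oracle that `basic` returns. -/
theorem basic_spec [Finite V] (h : IsTreeMetric T δ)
    (hL : ∀ v, (T.neighborSet v).ncard ≤ 2 → v ∈ (W : Set V)) {c : Config W} (hc : c.Valid)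
    {X : Finset V} {r a : V} (hX : IsPiece T X r) (hk : c.Known δ (X, r)) (hf : c.Fresh (X, r))
    (ha : a ∈ core W X r) (p : T.Walk a r) (hp : ∀ z, z ∈ p.support ↔ Btw δ a z r)
    (hs : p.support.Pairwise (fun x y => δ a x < δ a y)) :
    ∃ c₂ : Config W, c₂.Valid ∧ c.Le c₂ ∧ c₂.named = p.support.toFinset ∪ c.named ∧
      (∀ z ∈ p.support, c₂.Known δ (fiber δ a r X z, z)) ∧
      basic c.oracle (mkBag W c.name (X, r)) (c.name a) =
        (p.support.map (fun z => mkBag W c₂.name (fiber δ a r X z, z)),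
          p.edges.toFinset.image (Sym2.map c₂.name), c₂.oracle) := by
  classical
  have hr : r ∈ core W X r := mem_core.2 ⟨hX.1, Or.inr rfl⟩
  have hnd : p.support.Nodup := hs.imp (fun {x y} hxy e => by simp [e] at hxy)
  -- The offsets in the bag are exactly those of the path nodes: each node has the offset of its
  -- projection, and each path node has a core node in its fiber. Offsets increase from `a` to `r`,
  -- so sorting lists the path in its order.
  have hsort : ((mkBag W c.name (X, r)).nodes.image (c.oracle.offset (c.name a)
      (mkBag W c.name (X, r)).rep)).sort (· ≤ ·) = p.support.map (offs δ a r) := by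
    have hfin : (mkBag W c.name (X, r)).nodes.image (c.oracle.offset (c.name a)
        (mkBag W c.name (X, r)).rep) = (p.support.map (offs δ a r)).toFinset := by
      simp only [mkBag, Finset.image_image]
      ext y
      simp only [Finset.mem_image, List.mem_toFinset, List.mem_map, Function.comp_apply]
      constructor
      · rintro ⟨x, hx, rfl⟩
        obtain ⟨g, hg, -, -, e⟩ := h.gate a r x
        exact ⟨g, (hp g).2 hg, by rw [hk.offset_eq hr ha hx, e]⟩
      · rintro ⟨z, hz, rfl⟩
        have hz' := (hp z).1 hz
        obtain ⟨l, hl, hl'⟩ := hX.exists_label_fiber h hL hz' (hX.btw_mem h (mem_core.1 ha).1 hz')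
        rw [mem_fiber] at hl
        have hlc : l ∈ core W X r := mem_core.2 ⟨hl.1, by simpa using hl'⟩
        exact ⟨l, hlc, by rw [hk.offset_eq hr ha hlc, hl.2]⟩
    have hlt : (p.support.map (offs δ a r)).Pairwise (· < ·) := by
      rw [List.pairwise_map]
      refine hs.imp_of_mem fun {x y} hx hy hxy => ?_
      have h1 := (hp x).1 hx
      have h2 := (hp y).1 hy
      have := h.symm x a
      have := h.symm y a
      unfold offs Btw at *; linarith
    rw [hfin]
    exact (List.toFinset_sort _ (hlt.imp fun hxy => hxy.ne)).2 (hlt.imp fun hxy => hxy.le)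
  -- By freshness of the piece, a path node with a name is regular or equal to `r`, and so belongs
  -- to the core.
  obtain ⟨c₂, hc₂, hle, hn, hk₂, e⟩ := basicStep_foldl_spec h hL hc hX hk ha p.support hnd
    (fun z hz => (hp z).1 hz) c hc (Config.Le.refl c) (fun z hz hzn => by
      have hzX := hX.btw_mem h (mem_core.1 ha).1 ((hp z).1 hz)
      by_cases hzr : z = r
      · exact hzr ▸ hr
      · exact mem_core.2 ⟨hzX, Or.inl (hf z hzX hzn hzr)⟩) []
  refine ⟨c₂, hc₂, hle, hn, hk₂, ?_⟩
  unfold basic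
  rw [hsort, e]
  simp only [List.nil_append, List.map_map, Prod.mk.injEq, true_and, and_true]
  have : (Bag.rep ∘ fun z => mkBag W c₂.name (fiber δ a r X z, z)) = c₂.name := rfl
  rw [this, pathEdges, zipWith_support]
  ext; simp

end Config

/-! ### The components found by `explode` -/

section Explode

variable {V : Type*} {T : SimpleGraph V} {δ : V → V → ℝ}

/-- The nodes `x` and `y` lie in the same component of the tree without `r`. -/
def Same (δ : V → V → ℝ) (r x y : V) : Prop := δ x y < δ x r + δ y r

theorem Same.symm (h : IsTreeMetric T δ) {r x y : V} (hxy : Same δ r x y) : Same δ r y x := by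
  have := h.symm x y
  unfold Same at *; linarith

/-- The relation says that the Gromov product at `r` is positive, and the four-point condition
bounds this product for `x`, `z` below by the smaller of the other two. -/
theorem Same.trans (h : IsTreeMetric T δ) {r x y z : V} (hxy : Same δ r x y)
    (hyz : Same δ r y z) : Same δ r x z := by
  have := h.symm y z
  unfold Same at *
  rcases h.four x z y r with h1 | h1 <;> linarith

theorem Same.refl (h : IsTreeMetric T δ) {r x : V} (hx : x ≠ r) : Same δ r x x := by
  have := h.pos x r hx
  have := h.self x
  unfold Same; linarith

theorem not_same_root (h : IsTreeMetric T δ) (r x : V) : ¬ Same δ r x r := by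
  have := h.self r
  unfold Same; linarith

open Classical in
/-- The component of `x` in the piece `X` without `r`, together with `r`. -/
noncomputable def branch (δ : V → V → ℝ) (X : Finset V) (r x : V) : Finset V :=
  {y ∈ X | y = r ∨ Same δ r x y}

theorem mem_branch {X : Finset V} {r x y : V} :
    y ∈ branch δ X r x ↔ y ∈ X ∧ (y = r ∨ Same δ r x y) := by simp [branch]

theorem IsPiece.isPiece_branch {X : Finset V} {r : V} (hX : IsPiece T X r) (h : IsTreeMetric T δ)
    (x : V) : IsPiece T (branch δ X r x) r := by
  refine ⟨mem_branch.2 ⟨hX.1, Or.inl rfl⟩, fun y hy hyr z hyz => ?_⟩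
  rw [mem_branch] at hy ⊢
  refine ⟨hX.2 y hy.1 hyr z hyz, ?_⟩
  by_cases hzr : z = r
  · exact Or.inl hzr
  right
  have hy' := hy.2.resolve_left hyr
  have := h.symm x y
  have := h.symm x z
  have := h.pos z r hzr
  unfold Same at *
  rcases h.offs_adj x r hyz with e | ⟨-, e⟩
  · unfold offs at e; linarith
  · unfold Btw at e; linarith

/-- A component of the tree without `r` is attached to `r` by a single edge. -/
theorem IsPiece.exists_neck {X : Finset V} {r : V} (hX : IsPiece T X r) (h : IsTreeMetric T δ)
    {x : V} (hx : x ∈ X) (hxr : x ≠ r) :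
    ∃ z ∈ branch δ X r x, z ≠ r ∧ ∀ y ∈ branch δ X r x, y ≠ r → Btw δ r z y := by
  obtain ⟨z, hz, hb⟩ := h.toward r x hxr.symm
  have hzx : Same δ r x z := by
    have := h.pos r z hz.ne
    have := h.symm z r
    have := h.symm x z
    have := h.symm x r
    unfold Same Btw at *; linarith
  refine ⟨z, mem_branch.2 ⟨hX.btw_mem h hx (h.btw_comm hb), Or.inr hzx⟩, hz.ne', ?_⟩
  intro y hy hyr
  rcases h.edge_cases hz y with h1 | h1
  · exact h1
  · have := (h.btw_of_edge hz hb h1).1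
    have hs := (mem_branch.1 hy).2.resolve_left hyr
    have := h.symm r y
    unfold Same Btw at *; linarith

end Explode

/-! ### Correctness of `explode` -/

section Config

variable {V : Type*} [DecidableEq V] {W : Finset V} {T : SimpleGraph V} {δ : V → V → ℝ}

/-- The remaining set `S` is kept closed under `Same`, so that filtering inside `S` catches every
core node of a component. Each pass removes at least the chosen node, which is why `S.card` passes
suffice. -/
theorem explodeLoop_spec (h : IsTreeMetric T δ) {c : Config W} (hc : c.Valid) {X : Finset V}
    {r : V} (hX : IsPiece T X r) (hk : c.Known δ (X, r)) (m : ℕ) (S : Finset V)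
    (hS : ∀ x ∈ S, x ∈ core W X r ∧ x ≠ r)
    (hcl : ∀ x ∈ S, ∀ y ∈ core W X r, Same δ r x y → y ∈ S) (hm : S.card ≤ m) :
    ∃ xs : List V, explodeLoop c.oracle.dist (c.name r) m (S.image c.name) =
        xs.map (fun x => mkBag W c.name (branch δ X r x, r)) ∧
      (∀ x ∈ xs, x ∈ S) ∧ xs.Pairwise (fun x y => ¬ Same δ r x y) ∧
      ∀ y ∈ S, ∃ x ∈ xs, Same δ r x y := by
  classical
  induction m generalizing S with
  | zero =>
    have : S = ∅ := by simpa using hm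
    subst this
    exact ⟨[], by simp [explodeLoop], by simp, by simp, by simp⟩
  | succ m ih =>
    by_cases hne : S.Nonempty
    swap
    · rw [Finset.not_nonempty_iff_eq_empty] at hne
      subst hne
      exact ⟨[], by simp [explodeLoop], by simp, by simp, by simp⟩
    have hr : r ∈ core W X r := mem_core.2 ⟨hX.1, Or.inr rfl⟩
    have hcn : ∀ x ∈ core W X r, x ∈ c.named := fun x hx => hc.core_named hk.root hx
    have hne' : (S.image c.name).Nonempty := hne.image _
    obtain ⟨x, hxS, hxu⟩ := Finset.mem_image.1 hne'.choose_spec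
    set C := S.filter (fun y => Same δ r x y) with hC
    have hCimg : (S.image c.name).filter (fun v => c.oracle.dist hne'.choose v <
        c.oracle.dist hne'.choose (c.name r) + c.oracle.dist v (c.name r)) = C.image c.name := by
      rw [Finset.filter_image, hC]
      refine congrArg (Finset.image c.name) (Finset.filter_congr fun y hy => ?_)
      rw [← hxu, hk.dist x (hS x hxS).1 y (hS y hy).1, hk.dist x (hS x hxS).1 r hr,
        hk.dist y (hS y hy).1 r hr]
      rfl
    have hinjS : Set.InjOn c.name (S : Set V) := hc.inj.mono fun y hy => hcn y (hS y hy).1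
    have hdiff : S.image c.name \ C.image c.name = (S \ C).image c.name := by
      ext v
      simp only [Finset.mem_sdiff, Finset.mem_image]
      constructor
      · rintro ⟨⟨y, hy, rfl⟩, hn⟩
        exact ⟨y, ⟨hy, fun hyC => hn ⟨y, hyC, rfl⟩⟩, rfl⟩
      · rintro ⟨y, ⟨hy, hyC⟩, rfl⟩
        refine ⟨⟨y, hy, rfl⟩, ?_⟩
        rintro ⟨z, hz, e⟩
        exact hyC (hinjS (Finset.mem_filter.1 hz).1 hy e ▸ hz)
    have hxC : x ∈ C := Finset.mem_filter.2 ⟨hxS, Same.refl h (hS x hxS).2⟩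
    obtain ⟨xs, e, h1, h2, h3⟩ := ih (S \ C) (fun y hy => hS y (Finset.mem_sdiff.1 hy).1)
      (fun y hy z hz hyz => by
        rw [Finset.mem_sdiff] at hy ⊢
        refine ⟨hcl y hy.1 z hz hyz, fun hzC => hy.2 ?_⟩
        exact Finset.mem_filter.2 ⟨hy.1, ((Finset.mem_filter.1 hzC).2).trans h (hyz.symm h)⟩)
      (by
        have : (S \ C).card < S.card := Finset.card_lt_card
          ⟨Finset.sdiff_subset, fun hh => (Finset.mem_sdiff.1 (hh hxS)).2 hxC⟩
        omega)
    have hcore : core W (branch δ X r x) r = insert r C := by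
      ext y
      simp only [mem_core, mem_branch, Finset.mem_insert, hC, Finset.mem_filter]
      constructor
      · rintro ⟨⟨hy, rfl | hs⟩, hw⟩
        · exact Or.inl rfl
        · exact Or.inr ⟨hcl x hxS y (mem_core.2 ⟨hy, hw⟩) hs, hs⟩
      · rintro (rfl | ⟨hy, hs⟩)
        · exact ⟨⟨hX.1, Or.inl rfl⟩, Or.inr rfl⟩
        · have := mem_core.1 (hS y hy).1
          exact ⟨⟨this.1, Or.inr hs⟩, this.2⟩
    refine ⟨x :: xs, ?_, ?_, ?_, ?_⟩
    · have e0 : explodeLoop c.oracle.dist (c.name r) (m + 1) (S.image c.name) =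
          ⟨insert (c.name r) (C.image c.name), c.name r⟩ ::
            explodeLoop c.oracle.dist (c.name r) m (S.image c.name \ C.image c.name) := by
        rw [← hCimg]
        exact dif_pos hne'
      rw [e0, hdiff, e, List.map_cons]
      unfold mkBag
      rw [hcore, Finset.image_insert]
    · intro y hy
      rcases List.mem_cons.1 hy with rfl | hy
      · exact hxS
      · exact (Finset.mem_sdiff.1 (h1 y hy)).1
    · refine List.pairwise_cons.2 ⟨fun y hy hs => ?_, h2⟩
      have := Finset.mem_sdiff.1 (h1 y hy)
      exact this.2 (Finset.mem_filter.2 ⟨this.1, hs⟩)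
    · intro y hy
      by_cases hyC : y ∈ C
      · exact ⟨x, by simp, (Finset.mem_filter.1 hyC).2⟩
      · obtain ⟨z, hz, hs⟩ := h3 y (Finset.mem_sdiff.2 ⟨hy, hyC⟩)
        exact ⟨z, by simp [hz], hs⟩

/-- The bags that `explode` returns. -/
theorem explode_spec [Finite V] (h : IsTreeMetric T δ)
    (hL : ∀ v, (T.neighborSet v).ncard ≤ 2 → v ∈ (W : Set V)) {c : Config W} (hc : c.Valid)
    {X : Finset V} {r : V} (hX : IsPiece T X r) (hk : c.Known δ (X, r)) :
    ∃ xs : List V, explode c.oracle.dist (mkBag W c.name (X, r)) =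
        xs.map (fun x => mkBag W c.name (branch δ X r x, r)) ∧
      (∀ x ∈ xs, x ∈ core W X r ∧ x ≠ r) ∧ xs.Pairwise (fun x y => ¬ Same δ r x y) ∧
      ∀ y ∈ X, y ≠ r → ∃ x ∈ xs, Same δ r x y := by
  have hr : r ∈ core W X r := mem_core.2 ⟨hX.1, Or.inr rfl⟩
  have hinj : Set.InjOn c.name (core W X r : Set V) :=
    hc.inj.mono fun y hy => hc.core_named hk.root hy
  have herase : (mkBag W c.name (X, r)).nodes.erase (mkBag W c.name (X, r)).rep =
      ((core W X r).erase r).image c.name := by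
    ext v
    simp only [mkBag, Finset.mem_erase, Finset.mem_image]
    constructor
    · rintro ⟨hv, y, hy, rfl⟩
      exact ⟨y, ⟨fun e => hv (e ▸ rfl), hy⟩, rfl⟩
    · rintro ⟨y, ⟨hyr, hy⟩, rfl⟩
      exact ⟨fun e => hyr (hinj hy hr e), y, hy, rfl⟩
  obtain ⟨xs, e, h1, h2, h3⟩ := explodeLoop_spec h hc hX hk (mkBag W c.name (X, r)).nodes.card
    ((core W X r).erase r) (fun x hx => ⟨(Finset.mem_erase.1 hx).2, (Finset.mem_erase.1 hx).1⟩)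
    (fun x _ y hy hs => Finset.mem_erase.2 ⟨fun e => not_same_root h r x (e ▸ hs), hy⟩)
    (by
      simp only [mkBag]
      rw [Finset.card_image_of_injOn hinj]
      exact Finset.card_le_card (Finset.erase_subset _ _))
  refine ⟨xs, ?_, fun x hx => ?_, h2, fun y hy hyr => ?_⟩
  · unfold explode
    rw [herase]; exact e
  · have := Finset.mem_erase.1 (h1 x hx)
    exact ⟨this.2, this.1⟩
  -- The node `y` may be latent and invisible to the loop, but its component contains a label.
  · have hyb : y ∈ branch δ X r y := mem_branch.2 ⟨hy, Or.inr (Same.refl h hyr)⟩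
    obtain ⟨l, hl, hlW, hlr⟩ := (hX.isPiece_branch h y).exists_label h hL hyb hyr
    rw [mem_branch] at hl
    obtain ⟨x, hx, hs⟩ := h3 l (Finset.mem_erase.2 ⟨hlr, mem_core.2 ⟨hl.1, Or.inl hlW⟩⟩)
    exact ⟨x, hx, hs.trans h ((hl.2.resolve_left hlr).symm h)⟩

end Config

/-! ### Splitting a bag at a node -/

section Split

variable {V : Type*} {T : SimpleGraph V} {δ : V → V → ℝ}

theorem RealizesOn.mem_edges (hT : T.IsTree) {ℓ : Sym2 V → ℝ} (hR : RealizesOn T Set.univ ℓ δ)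
    {a r : V} (p : T.Walk a r) (hp : p.IsPath) {x y : V} (hx : x ∈ p.support)
    (hy : y ∈ p.support) (hxy : T.Adj x y) : s(x, y) ∈ p.edges := by
  have h := hR.isTreeMetric hT
  induction p with
  | nil =>
    rw [SimpleGraph.Walk.support_nil, List.mem_singleton] at hx hy
    exact (hxy.ne (hx.trans hy.symm)).elim
  | @cons u v w hadj p ih =>
    have hv : Btw δ u v w := (hR.mem_support_iff hT _ hp v).1 (by simp)
    have hx' := (hR.mem_support_iff hT _ hp x).1 hx
    have hy' := (hR.mem_support_iff hT _ hp y).1 hy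
    rw [SimpleGraph.Walk.support_cons, List.mem_cons] at hx hy
    rw [SimpleGraph.Walk.edges_cons, List.mem_cons]
    rcases hx with rfl | hx
    · rw [h.toward_unique hxy hadj hy' hv]; exact Or.inl rfl
    · rcases hy with rfl | hy
      · rw [h.toward_unique hxy.symm hadj hx' hv]; exact Or.inl Sym2.eq_swap
      · exact Or.inr (ih hp.of_cons hx hy)

/-- Any two nodes are joined by a path, which consists of the nodes between them. -/
theorem RealizesOn.exists_path (hT : T.IsTree) {ℓ : Sym2 V → ℝ}
    (hR : RealizesOn T Set.univ ℓ δ) (a r : V) : ∃ p : T.Walk a r,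
      (∀ z, z ∈ p.support ↔ Btw δ a z r) ∧ p.support.Pairwise (fun x y => δ a x < δ a y) ∧
      ∀ x y, Btw δ a x r → Btw δ a y r → T.Adj x y → s(x, y) ∈ p.edges := by
  obtain ⟨p, hp, -⟩ := hT.existsUnique_path a r
  have hs := hR.mem_support_iff hT p hp
  exact ⟨p, hs, hR.support_sorted hT p hp, fun x y hx hy hxy =>
    hR.mem_edges hT p hp ((hs x).2 hx) ((hs y).2 hy) hxy⟩

variable [DecidableEq V] {W : Finset V}

/-- The invariants of the splitting of the bag of a piece `X` with representative `r`: here `c₀` is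
the configuration at the start and `c` the present one, `L` is the list of the present pieces, and
`E` is the set of the edges found so far. -/
structure RoundInv (T : SimpleGraph V) (δ : V → V → ℝ) (c₀ : Config W) (X : Finset V) (r : V)
    (c : Config W) (L : List (Finset V × V)) (E : Finset (Sym2 V)) (s : Split W) : Prop where
  valid : c.Valid
  le : c₀.Le c
  named : ∀ x ∈ c.named, x ∈ c₀.named ∨ (x ∈ X ∧ x ≠ r)
  bags : s.bags = L.map (mkBag W c.name)
  oracle : s.oracle = c.oracle
  skel : s.skel = E.image (Sym2.map c.name)
  edge : ∀ e ∈ E, e ∈ T.edgeSet ∧ ∀ v ∈ e, v ∈ c.named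
  piece : ∀ t ∈ L, IsPiece T t.1 t.2
  known : ∀ t ∈ L, c.Known δ t
  fresh : ∀ t ∈ L, c.Fresh t
  subset : ∀ t ∈ L, t.1 ⊆ X
  disj : L.Pairwise (fun t t' => Disjoint t.1 t'.1)
  cover : ∀ x ∈ X, ∃ t ∈ L, x ∈ t.1
  edges : ∀ x ∈ X, ∀ y ∈ X, T.Adj x y →
    s(x, y) ∈ E ∨ ∃ t ∈ L, (x ∈ t.1 ∧ x ≠ t.2) ∨ (y ∈ t.1 ∧ y ≠ t.2)
  roots : ∀ t ∈ L, ∀ y, Btw δ t.2 y r → ∃ t' ∈ L, t'.2 = y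

theorem eq_of_pairwise_disjoint {L : List (Finset V × V)}
    (hL : L.Pairwise (fun t t' => Disjoint t.1 t'.1)) {t t' : Finset V × V} (ht : t ∈ L)
    (ht' : t' ∈ L) {x : V} (hx : x ∈ t.1) (hx' : x ∈ t'.1) : t = t' := by
  have : Std.Symm (fun t t' : Finset V × V => Disjoint t.1 t'.1) :=
    ⟨fun _ _ hd => Disjoint.symm hd⟩
  by_contra hne
  exact Finset.disjoint_left.1 (hL.forall ht ht' hne) hx hx'

theorem RoundInv.exists_root {c₀ : Config W} {X : Finset V} {r : V} {c : Config W}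
    {L : List (Finset V × V)} {E : Finset (Sym2 V)} {s : Split W}
    (h : IsTreeMetric T δ) (hX : IsPiece T X r)
    (hI : RoundInv T δ c₀ X r c L E s) : ∃ t ∈ L, t.2 = r := by
  obtain ⟨t, ht, -⟩ := hI.cover r hX.1
  exact hI.roots t ht r (h.btw_right _ _)

/-- Only one of the disjoint pieces contains `r`, and `r` is its root. A path to `r` from any other
piece leaves it through the root of that piece. -/
theorem RoundInv.root_btw {c₀ : Config W} {X : Finset V} {r : V} {c : Config W}
    {L : List (Finset V × V)} {E : Finset (Sym2 V)} {s : Split W}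
    (h : IsTreeMetric T δ) (hX : IsPiece T X r) (hI : RoundInv T δ c₀ X r c L E s)
    {t : Finset V × V} (ht : t ∈ L) {x : V} (hx : x ∈ t.1) : Btw δ x t.2 r := by
  obtain ⟨t', ht', hr⟩ := hI.exists_root h hX
  by_cases hrt : r ∈ t.1
  · have : t = t' := eq_of_pairwise_disjoint hI.disj ht ht' hrt (hr ▸ (hI.piece t' ht').1)
    subst this
    rw [hr]; exact h.btw_right _ _
  · exact (hI.piece t ht).exit h hx hrt

/-- The piece around `a` is replaced by its fibers over the path from `a` to its root. They
partition the piece, every edge of the piece is on the path or has an end that is a non-root of a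
fiber, and the new roots are the path nodes. If `a` is already a root, nothing happens. -/
theorem splitAt_spec [Finite V] (hT : T.IsTree) {ℓ : Sym2 V → ℝ}
    (hR : RealizesOn T Set.univ ℓ δ) (hW : ∀ v, (T.neighborSet v).ncard ≤ 2 → v ∈ (W : Set V))
    {c₀ : Config W} {X : Finset V} {r : V} {c : Config W} {L : List (Finset V × V)}
    {E : Finset (Sym2 V)} {s : Split W} (hX : IsPiece T X r) (hI : RoundInv T δ c₀ X r c L E s)
    {a : V} (ha : a ∈ X) (haW : a ∈ W) :
    ∃ c' L' E', RoundInv T δ c₀ X r c' L' E' (splitAt s (c.name a)) ∧ c.Le c' ∧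
      (∀ t ∈ L, ∃ t' ∈ L', t'.2 = t.2) ∧ ∃ t' ∈ L', t'.2 = a := by
  classical
  have h := hR.isTreeMetric hT
  obtain ⟨t₀, ht₀, hat₀⟩ := hI.cover a ha
  have hac : ∀ t : Finset V × V, a ∈ t.1 → a ∈ core W t.1 t.2 := fun t hat =>
    mem_core.2 ⟨hat, Or.inl haW⟩
  have hsome : ∃ B, s.bags.find? (fun B => c.name a ∈ B.nodes) = some B := by
    rw [← Option.isSome_iff_exists, List.find?_isSome]
    refine ⟨mkBag W c.name t₀, ?_, ?_⟩
    · rw [hI.bags]; exact List.mem_map_of_mem ht₀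
    · exact decide_eq_true (Finset.mem_image_of_mem c.name (hac t₀ hat₀))
  obtain ⟨B, hB⟩ := hsome
  obtain ⟨haB, l₁, l₂, hl, hl₁⟩ := List.find?_eq_some_iff_append.1 hB
  have herase : s.bags.eraseP (fun B => c.name a ∈ B.nodes) = l₁ ++ l₂ := by
    rw [hl, List.eraseP_append_right _ (fun b hb => by simpa using hl₁ b hb),
      List.eraseP_cons_of_pos (by exact haB)]
  rw [hI.bags] at hl
  obtain ⟨L₁, L₂', hLL, rfl, hL₂'⟩ := List.map_eq_append_iff.1 hl
  obtain ⟨t, L₂, rfl, rfl, rfl⟩ := List.map_eq_cons_iff.1 hL₂'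
  have htL : t ∈ L := by simp [hLL]
  have hold : ∀ t' ∈ L, t' = t ∨ t' ∈ L₁ ++ L₂ := fun t' ht' => by
    simp only [hLL, List.mem_append, List.mem_cons] at ht' ⊢; tauto
  have hsub : ∀ t' ∈ L₁ ++ L₂, t' ∈ L := fun t' ht' => by
    simp only [hLL, List.mem_append, List.mem_cons] at ht' ⊢; tauto
  have hat : a ∈ t.1 := by
    have haB' : c.name a ∈ (core W t.1 t.2).image c.name := of_decide_eq_true haB
    obtain ⟨b, hb, e⟩ := Finset.mem_image.1 haB'
    have := hI.valid.inj (hI.valid.core_named (hI.known t htL).root hb)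
      (hI.valid.sub haW) e
    exact this ▸ (mem_core.1 hb).1
  obtain ⟨X₁, r₁⟩ := t
  dsimp only at hat
  by_cases har : a = r₁
  · refine ⟨c, L, E, ?_, Config.Le.refl c, fun t' ht' => ⟨t', ht', rfl⟩, _, htL, har.symm⟩
    have : splitAt s (c.name a) = s := by
      unfold splitAt
      rw [hB]
      simp [mkBag, har]
    rw [this]; exact hI
  have har' : c.name a ≠ (mkBag W c.name (X₁, r₁)).rep := fun e =>
    har (hI.valid.inj (hI.valid.sub haW) (hI.known _ htL).root e)
  obtain ⟨p, hp, hps, hpe⟩ := hR.exists_path hT a r₁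
  have hX₁ : IsPiece T X₁ r₁ := hI.piece _ htL
  obtain ⟨c₂, hc₂, hle, hn, hk₂, e₂⟩ := basic_spec h hW hI.valid hX₁ (hI.known _ htL)
    (hI.fresh _ htL) (hac (X₁, r₁) hat) p hp hps
  have hstep : splitAt s (c.name a) =
      { bags := L₁.map (mkBag W c.name) ++ L₂.map (mkBag W c.name) ++
          p.support.map (fun z => mkBag W c₂.name (fiber δ a r₁ X₁ z, z))
        skel := s.skel ∪ p.edges.toFinset.image (Sym2.map c₂.name)
        oracle := c₂.oracle } := by
    unfold splitAt
    rw [hB]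
    simp only [if_neg har']
    rw [herase, hI.oracle, e₂]
  have hpX₁ : ∀ z ∈ p.support, z ∈ X₁ := fun z hz => hX₁.btw_mem h hat ((hp z).1 hz)
  have hdisj := hI.disj
  rw [hLL, List.pairwise_append, List.pairwise_cons] at hdisj
  obtain ⟨hd1, ⟨hd2, hd3⟩, hd4⟩ := hdisj
  have hdt : ∀ t' ∈ L₁ ++ L₂, Disjoint t'.1 X₁ := fun t' ht' => by
    rcases List.mem_append.1 ht' with hm | hm
    · exact hd4 t' hm (X₁, r₁) (by simp)
    · exact (hd2 t' hm).symm
  have hfsub : ∀ z, fiber δ a r₁ X₁ z ⊆ X₁ := fun z x hx => (mem_fiber.1 hx).1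
  have hroot_btw : Btw δ a r₁ r := hI.root_btw h hX htL hat
  have hr₁p : r₁ ∈ p.support := (hp r₁).2 (h.btw_right _ _)
  have hmemL' : ∀ z ∈ p.support, (fiber δ a r₁ X₁ z, z) ∈
      L₁ ++ L₂ ++ p.support.map (fun z => (fiber δ a r₁ X₁ z, z)) := fun z hz =>
    List.mem_append_right _ (List.mem_map_of_mem hz)
  have hroot : ∀ t ∈ L, ∃ t' ∈ L₁ ++ L₂ ++ p.support.map (fun z => (fiber δ a r₁ X₁ z, z)),
      t'.2 = t.2 := fun t' ht' => by
    rcases hold t' ht' with rfl | hm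
    · exact ⟨_, hmemL' r₁ hr₁p, rfl⟩
    · exact ⟨t', List.mem_append_left _ hm, rfl⟩
  have hall : ∀ {P : Finset V × V → Prop}, (∀ t' ∈ L₁ ++ L₂, P t') →
      (∀ z ∈ p.support, P (fiber δ a r₁ X₁ z, z)) →
      ∀ t' ∈ L₁ ++ L₂ ++ p.support.map (fun z => (fiber δ a r₁ X₁ z, z)), P t' := by
    intro P h1 h2 t' ht'
    rcases List.mem_append.1 ht' with hm | hm
    · exact h1 t' hm
    · obtain ⟨z, hz, rfl⟩ := List.mem_map.1 hm
      exact h2 z hz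
  refine ⟨c₂, L₁ ++ L₂ ++ p.support.map (fun z => (fiber δ a r₁ X₁ z, z)),
    E ∪ p.edges.toFinset, ?_, hle, hroot, ⟨_, hmemL' a ((hp a).2 (h.btw_left _ _)), rfl⟩⟩
  rw [hstep]
  have hXr : ∀ z ∈ p.support, z ∈ c.named ∨ (z ∈ X ∧ z ≠ r) := by
    intro z hz
    by_cases hzr : z = r
    · left
      obtain ⟨t', ht', e⟩ := hI.exists_root h hX
      exact hzr ▸ e ▸ (hI.known t' ht').root
    · exact Or.inr ⟨hI.subset _ htL (hpX₁ z hz), hzr⟩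
  refine
    { valid := hc₂
      le := hI.le.trans hle
      named := ?_
      bags := ?_
      oracle := rfl
      skel := ?_
      edge := ?_
      piece := hall (fun t' ht' => hI.piece t' (hsub t' ht'))
        (fun z hz => hX₁.isPiece_fiber h ((hp z).1 hz) (hpX₁ z hz))
      known := hall (fun t' ht' => (hI.known t' (hsub t' ht')).mono hI.valid hle) hk₂
      fresh := hall ?_ ?_
      subset := hall (fun t' ht' => hI.subset t' (hsub t' ht'))
        (fun z _ => (hfsub z).trans (hI.subset _ htL))
      disj := ?_
      cover := ?_
      edges := ?_
      roots := hall ?_ ?_ }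
  · intro x hx
    rw [hn, Finset.mem_union, List.mem_toFinset] at hx
    rcases hx with hx | hx
    · rcases hXr x hx with h1 | h1
      · exact hI.named x h1
      · exact Or.inr h1
    · exact hI.named x hx
  · simp only [List.map_append, List.map_map]
    congr 1
    congr 1 <;> refine List.map_congr_left fun t' ht' => ?_
    · exact ((hI.known t' (hsub t' (List.mem_append_left _ ht'))).mkBag_eq hI.valid hle).symm
    · exact ((hI.known t' (hsub t' (List.mem_append_right _ ht'))).mkBag_eq hI.valid hle).symm
  · rw [Finset.image_union, hI.skel]
    refine congrArg (· ∪ _) (Finset.image_congr fun e he => ?_)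
    exact Sym2.map_congr fun v hv => (hle.name v ((hI.edge e he).2 v hv)).symm
  · intro e he
    rcases Finset.mem_union.1 he with he | he
    · exact ⟨(hI.edge e he).1, fun v hv => hle.sub ((hI.edge e he).2 v hv)⟩
    · rw [List.mem_toFinset] at he
      refine ⟨p.edges_subset_edgeSet he, fun v hv => ?_⟩
      rw [hn, Finset.mem_union, List.mem_toFinset]
      exact Or.inl (p.mem_support_of_mem_edges he hv)
  · intro t' ht' y hy hyn hyr
    rw [hn, Finset.mem_union, List.mem_toFinset] at hyn
    rcases hyn with hyn | hyn
    · exact (Finset.disjoint_left.1 (hdt t' ht') hy (hpX₁ y hyn)).elim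
    · exact hI.fresh t' (hsub t' ht') y hy hyn hyr
  · intro z hz y hy hyn hyz
    dsimp only at hy hyz
    have hyp : y ∉ p.support := fun hyp =>
      hyz (h.offs_inj ((hp y).1 hyp) ((hp z).1 hz) (mem_fiber.1 hy).2)
    rw [hn, Finset.mem_union, List.mem_toFinset] at hyn
    refine hI.fresh _ htL y (hfsub z hy) (hyn.resolve_left hyp) fun e => hyp ?_
    exact e ▸ hr₁p
  · rw [List.pairwise_append, List.pairwise_append, List.pairwise_map]
    refine ⟨⟨hd1, hd3, fun t' ht' t'' ht'' => hd4 t' ht' t'' (by simp [ht''])⟩, ?_, ?_⟩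
    · refine hps.imp_of_mem fun {z z'} hz hz' hlt => Finset.disjoint_left.2 fun y hy hy' => ?_
      have : z = z' := h.offs_inj ((hp z).1 hz) ((hp z').1 hz')
        ((mem_fiber.1 hy).2.symm.trans (mem_fiber.1 hy').2)
      exact absurd hlt (this ▸ lt_irrefl _)
    · intro t' ht' t'' ht''
      obtain ⟨z, hz, rfl⟩ := List.mem_map.1 ht''
      exact (hdt t' ht').mono_right (hfsub z)
  · intro y hy
    obtain ⟨t', ht', hyt⟩ := hI.cover y hy
    rcases hold t' ht' with rfl | hm
    · obtain ⟨g, hg, -, -, e⟩ := h.gate a r₁ y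
      exact ⟨_, hmemL' g ((hp g).2 hg), mem_fiber.2 ⟨hyt, e⟩⟩
    · exact ⟨t', List.mem_append_left _ hm, hyt⟩
  · intro x hx y hy hxy
    rcases hI.edges x hx y hy hxy with he | ⟨t', ht', hxy'⟩
    · exact Or.inl (Finset.mem_union_left _ he)
    rcases hold t' ht' with rfl | hm
    swap
    · exact Or.inr ⟨t', List.mem_append_left _ hm, hxy'⟩
    have hboth : x ∈ X₁ ∧ y ∈ X₁ := by
      rcases hxy' with h1 | h1
      · exact ⟨h1.1, hX₁.2 x h1.1 h1.2 y hxy⟩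
      · exact ⟨hX₁.2 y h1.1 h1.2 x hxy.symm, h1.1⟩
    rcases h.offs_adj a r₁ hxy with e | ⟨hbx, hby⟩
    · right
      obtain ⟨g, hg, -, -, eg⟩ := h.gate a r₁ x
      refine ⟨_, hmemL' g ((hp g).2 hg), ?_⟩
      by_cases hxg : x = g
      · exact Or.inr ⟨mem_fiber.2 ⟨hboth.2, e ▸ eg⟩, fun hyg => hxy.ne (hxg.trans hyg.symm)⟩
      · exact Or.inl ⟨mem_fiber.2 ⟨hboth.1, eg⟩, hxg⟩
    · left
      exact Finset.mem_union_right _ (List.mem_toFinset.2 (hpe x y hbx hby hxy))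
  · intro t' ht' y hy
    obtain ⟨t'', ht'', rfl⟩ := hI.roots t' (hsub t' ht') y hy
    exact hroot t'' ht''
  · intro z hz y hy
    dsimp only at hy
    -- A node between a new root and `r` lies before or after the old root `r₁` on the way from `a`
    -- to `r`: it is a node of the new path, or the old invariant applies.
    have hzr : Btw δ a z r := h.btw_trans ((hp z).1 hz) hroot_btw
    have hyr : Btw δ a y r := h.btw_comm (h.btw_trans (h.btw_comm hy) (h.btw_comm hzr))
    rcases h.btw_total hyr hroot_btw with h1 | h1
    · exact ⟨_, hmemL' y ((hp y).2 h1), rfl⟩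
    · obtain ⟨t'', ht'', rfl⟩ := hI.roots _ htL y (h.btw_trans_right h1 hyr)
      exact hroot t'' ht''

end Split

/-! ### One round of splitting -/

section Round

variable {V : Type*} [DecidableEq V] {W : Finset V} {T : SimpleGraph V} {δ : V → V → ℝ}

/-- A piece whose bag is correct for the configuration `c`. -/
structure PieceOK (T : SimpleGraph V) (δ : V → V → ℝ) (c : Config W) (t : Finset V × V) :
    Prop where
  piece : IsPiece T t.1 t.2
  known : c.Known δ t
  fresh : c.Fresh t
  label : ∃ x ∈ t.1, x ∈ W ∧ x ≠ t.2

/-- What a round of splitting of the piece `X` with representative `r` at the nodes `xs` gives: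
`L` is the list of the new pieces, and `S` is the set of the nodes of the skeleton. -/
structure RoundResult (T : SimpleGraph V) (δ : V → V → ℝ) (c₀ : Config W) (X : Finset V) (r : V)
    (xs : List V) (c : Config W) (L : List (Finset V × V)) (E : Finset (Sym2 V)) (S : Set V)
    (s : Split W) : Prop where
  valid : c.Valid
  le : c₀.Le c
  named : ∀ x ∈ c.named, x ∈ c₀.named ∨ (x ∈ X ∧ x ≠ r)
  bags : s.bags = L.map (mkBag W c.name)
  oracle : s.oracle = c.oracle
  skel : s.skel = E.image (Sym2.map c.name)
  edge : ∀ e ∈ E, e ∈ T.edgeSet ∧ ∀ v ∈ e, v ∈ c.named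
  piece : ∀ t ∈ L, PieceOK T δ c t
  subset : ∀ t ∈ L, t.1 ⊆ X
  disj : L.Pairwise (fun t t' => Disjoint (t.1.erase t.2) (t'.1.erase t'.2))
  cover : ∀ x ∈ X, x ∈ c.named ∨ ∃ t ∈ L, x ∈ t.1.erase t.2
  edges : ∀ x ∈ X, ∀ y ∈ X, T.Adj x y →
    s(x, y) ∈ E ∨ ∃ t ∈ L, x ∈ t.1.erase t.2 ∨ y ∈ t.1.erase t.2
  sample : ∀ x ∈ xs, x ∈ S
  root : r ∈ S
  closed : ∀ x ∈ S, ∀ y, Btw δ x y r → y ∈ S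
  avoid : ∀ t ∈ L, ∀ y ∈ t.1.erase t.2, y ∉ S
  neck : ∀ t ∈ L, ∃ z ∈ t.1.erase t.2, ∀ y ∈ t.1.erase t.2, Btw δ y z r

/-- Each sampled node becomes a root when it is treated, and roots remain roots, so in the end all
samples are roots. -/
theorem splitAt_foldl_spec [Finite V] (hT : T.IsTree) {ℓ : Sym2 V → ℝ}
    (hR : RealizesOn T Set.univ ℓ δ) (hW : ∀ v, (T.neighborSet v).ncard ≤ 2 → v ∈ (W : Set V))
    {c₀ : Config W} (hc₀ : c₀.Valid) {X : Finset V} {r : V} (hX : IsPiece T X r) (xs : List V)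
    (hxs : ∀ x ∈ xs, x ∈ X ∧ x ∈ W) {c : Config W} {L : List (Finset V × V)}
    {E : Finset (Sym2 V)} {s : Split W} (hI : RoundInv T δ c₀ X r c L E s) :
    ∃ c' L' E', RoundInv T δ c₀ X r c' L' E' ((xs.map c₀.name).foldl splitAt s) ∧
      (∀ t ∈ L, ∃ t' ∈ L', t'.2 = t.2) ∧ ∀ x ∈ xs, ∃ t' ∈ L', t'.2 = x := by
  induction xs generalizing c L E s with
  | nil => exact ⟨c, L, E, hI, fun t ht => ⟨t, ht, rfl⟩, by simp⟩
  | cons a xs ih =>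
    obtain ⟨c₁, L₁, E₁, hI₁, -, hr₁, t₁, ht₁, ha₁⟩ := splitAt_spec hT hR hW hX hI
      (hxs a (by simp)).1 (hxs a (by simp)).2
    rw [hI.le.name a (hc₀.sub (hxs a (by simp)).2)] at hI₁
    obtain ⟨c₂, L₂, E₂, hI₂, hr₂, hx₂⟩ := ih (fun x hx => hxs x (by simp [hx])) hI₁
    refine ⟨c₂, L₂, E₂, hI₂, fun t ht => ?_, fun x hx => ?_⟩
    · obtain ⟨t', ht', e⟩ := hr₁ t ht
      obtain ⟨t'', ht'', e'⟩ := hr₂ t' ht'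
      exact ⟨t'', ht'', e'.trans e⟩
    · rcases List.mem_cons.1 hx with rfl | hx
      · obtain ⟨t'', ht'', e'⟩ := hr₂ t₁ ht₁
        exact ⟨t'', ht'', e'.trans ha₁⟩
      · exact hx₂ x hx

theorem roundInv_init (h : IsTreeMetric T δ) {c₀ : Config W} (hc₀ : c₀.Valid) {X : Finset V}
    {r : V} (hX : IsPiece T X r) (hk : c₀.Known δ (X, r)) (hf : c₀.Fresh (X, r)) :
    RoundInv T δ c₀ X r c₀ [(X, r)] ∅
      { bags := [mkBag W c₀.name (X, r)], skel := ∅, oracle := c₀.oracle } where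
  valid := hc₀
  le := Config.Le.refl _
  named x hx := Or.inl hx
  bags := rfl
  oracle := rfl
  skel := by simp
  edge := by simp
  piece := by simpa using hX
  known := by simpa using hk
  fresh := by simpa using hf
  subset := by simp
  disj := by simp
  cover := by simp
  edges x hx y hy hxy := by
    right
    refine ⟨(X, r), by simp, ?_⟩
    by_cases hxr : x = r
    · exact Or.inr ⟨hy, fun e => hxy.ne (hxr.trans e.symm)⟩
    · exact Or.inl ⟨hx, hxr⟩
  roots := by
    intro t ht y hy
    rw [List.mem_singleton] at ht
    subst ht
    refine ⟨_, List.mem_singleton.2 rfl, h.btw_antisymm (h.btw_left _ _) hy⟩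

/-- Take for `S` the roots before `explode`: they include the samples and `r`, and are closed under
going toward `r`. The exploded pieces without their roots hang off `S`, and each has a single neck
through which all its paths to `r` run. -/
theorem splitRound_spec [Finite V] (hT : T.IsTree) {ℓ : Sym2 V → ℝ}
    (hR : RealizesOn T Set.univ ℓ δ) (hW : ∀ v, (T.neighborSet v).ncard ≤ 2 → v ∈ (W : Set V))
    {c₀ : Config W} (hc₀ : c₀.Valid) {X : Finset V} {r : V} (hok : PieceOK T δ c₀ (X, r))
    (xs : List V) (hxs : ∀ x ∈ xs, x ∈ X ∧ x ∈ W) :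
    ∃ c L E S, RoundResult T δ c₀ X r xs c L E S
      (splitRound c₀.oracle (mkBag W c₀.name (X, r)) (xs.map c₀.name)) := by
  classical
  have h := hR.isTreeMetric hT
  have hX : IsPiece T X r := hok.piece
  obtain ⟨c, L, E, hI, hr, hx⟩ := splitAt_foldl_spec hT hR hW hc₀ hX xs hxs
    (roundInv_init h hc₀ hX hok.known hok.fresh)
  set s := (xs.map c₀.name).foldl splitAt
    { bags := [mkBag W c₀.name (X, r)], skel := ∅, oracle := c₀.oracle } with hs
  have hexp : ∀ t ∈ L, ∃ ys : List V, explode c.oracle.dist (mkBag W c.name t) =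
        ys.map (fun x => mkBag W c.name (branch δ t.1 t.2 x, t.2)) ∧
      (∀ x ∈ ys, x ∈ core W t.1 t.2 ∧ x ≠ t.2) ∧ ys.Pairwise (fun x y => ¬ Same δ t.2 x y) ∧
      ∀ y ∈ t.1, y ≠ t.2 → ∃ x ∈ ys, Same δ t.2 x y := fun t ht =>
    explode_spec h hW hI.valid (hI.piece t ht) (hI.known t ht)
  choose! f hf1 hf2 hf3 hf4 using hexp
  set g : Finset V × V → List (Finset V × V) :=
    fun t => (f t).map (fun x => (branch δ t.1 t.2 x, t.2)) with hg
  have hbsub : ∀ t : Finset V × V, ∀ x, branch δ t.1 t.2 x ⊆ t.1 := fun t x y hy =>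
    (mem_branch.1 hy).1
  have hall : ∀ {P : Finset V × V → Prop},
      (∀ t ∈ L, ∀ x ∈ f t, P (branch δ t.1 t.2 x, t.2)) → ∀ t' ∈ L.flatMap g, P t' := by
    intro P hP t' ht'
    obtain ⟨t, ht, ht''⟩ := List.mem_flatMap.1 ht'
    obtain ⟨x, hx, rfl⟩ := List.mem_map.1 ht''
    exact hP t ht x hx
  have hnon : ∀ t ∈ L, ∀ y ∈ t.1, y ≠ t.2 → ∃ t' ∈ L.flatMap g, y ∈ t'.1.erase t'.2 := by
    intro t ht y hy hyr
    obtain ⟨x, hx, hs⟩ := hf4 t ht y hy hyr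
    exact ⟨_, List.mem_flatMap.2 ⟨t, ht, List.mem_map_of_mem hx⟩,
      Finset.mem_erase.2 ⟨hyr, mem_branch.2 ⟨hy, Or.inr hs⟩⟩⟩
  refine ⟨c, L.flatMap g, E, {y | ∃ t ∈ L, t.2 = y},
    { valid := hI.valid
      le := hI.le
      named := hI.named
      bags := ?_
      oracle := hI.oracle
      skel := hI.skel
      edge := hI.edge
      piece := hall fun t ht x hx => ?_
      subset := hall fun t ht x _ => (hbsub t x).trans (hI.subset t ht)
      disj := ?_
      cover := fun x hx => ?_
      edges := fun x hx y hy hxy => ?_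
      sample := hx
      root := hI.exists_root h hX
      closed := ?_
      avoid := hall fun t ht x hx y hy => ?_
      neck := hall fun t ht x hx => ?_ }⟩
  · change s.bags.flatMap (explode s.oracle.dist) = _
    rw [hI.bags, hI.oracle, List.flatMap_map, List.map_flatMap]
    refine List.flatMap_congr fun t ht => ?_
    rw [hf1 t ht, hg, List.map_map]
    rfl
  · have hxc := hf2 t ht x hx
    refine ⟨(hI.piece t ht).isPiece_branch h x, ⟨(hI.known t ht).root, ?_⟩, ?_, ?_⟩
    · have hsub : ∀ y ∈ core W (branch δ t.1 t.2 x) t.2, y ∈ core W t.1 t.2 := fun y hy =>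
        mem_core.2 ⟨hbsub t x (mem_core.1 hy).1, (mem_core.1 hy).2⟩
      exact fun y hy z hz => (hI.known t ht).dist y (hsub y hy) z (hsub z hz)
    · exact fun y hy hyn hyr => hI.fresh t ht y (hbsub t x hy) hyn hyr
    · exact ⟨x, mem_branch.2 ⟨(mem_core.1 hxc.1).1, Or.inr (Same.refl h hxc.2)⟩,
        (mem_core.1 hxc.1).2.resolve_right hxc.2, hxc.2⟩
  · rw [List.pairwise_flatMap]
    constructor
    · intro t ht
      rw [hg, List.pairwise_map]
      refine (hf3 t ht).imp fun {x y} hxy => Finset.disjoint_left.2 fun z hz hz' => hxy ?_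
      rw [Finset.mem_erase, mem_branch] at hz hz'
      exact (hz.2.2.resolve_left hz.1).trans h ((hz'.2.2.resolve_left hz.1).symm h)
    · refine hI.disj.imp fun {t t'} hd u hu u' hu' => ?_
      obtain ⟨x, -, rfl⟩ := List.mem_map.1 hu
      obtain ⟨x', -, rfl⟩ := List.mem_map.1 hu'
      exact hd.mono ((Finset.erase_subset _ _).trans (hbsub t x))
        ((Finset.erase_subset _ _).trans (hbsub t' x'))
  · obtain ⟨t, ht, hxt⟩ := hI.cover x hx
    by_cases hxr : x = t.2
    · exact Or.inl (hxr ▸ (hI.known t ht).root)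
    · exact Or.inr (hnon t ht x hxt hxr)
  · rcases hI.edges x hx y hy hxy with he | ⟨t, ht, h1 | h1⟩
    · exact Or.inl he
    · obtain ⟨t', ht', hm⟩ := hnon t ht x h1.1 h1.2
      exact Or.inr ⟨t', ht', Or.inl hm⟩
    · obtain ⟨t', ht', hm⟩ := hnon t ht y h1.1 h1.2
      exact Or.inr ⟨t', ht', Or.inr hm⟩
  · rintro _ ⟨t, ht, rfl⟩ y hy
    exact hI.roots t ht y hy
  · rintro ⟨t', ht', rfl⟩
    rw [Finset.mem_erase] at hy
    have := eq_of_pairwise_disjoint hI.disj ht ht' (hbsub t x hy.2) (hI.piece t' ht').1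
    exact hy.1 (congrArg Prod.snd this).symm
  · have hxc := hf2 t ht x hx
    obtain ⟨z, hz, hzr, hb⟩ := (hI.piece t ht).exists_neck h (mem_core.1 hxc.1).1 hxc.2
    refine ⟨z, Finset.mem_erase.2 ⟨hzr, hz⟩, fun y hy => ?_⟩
    rw [Finset.mem_erase] at hy
    exact h.btw_trans (h.btw_comm (hb y hy.2 hy.1)) (hI.root_btw h hX ht (hbsub t x hy.2))

end Round

/-! ### Full skeletons of small bags -/

section FullSkeleton

variable {V : Type*} {T : SimpleGraph V} {δ : V → V → ℝ}

/-- From a node of `X` other than `r`, the next node toward `r` is again in `X`, so inside `X`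
everything is connected to `r`. Acyclicity is inherited. -/
theorem IsPiece.isTree_comap [Finite V] {X : Finset V} {r : V} (hX : IsPiece T X r)
    (h : IsTreeMetric T δ) (hT : T.IsTree) {U : Type*} {ψ : U → V}
    (hψ : Function.Injective ψ) (hr : ∀ v, (∃ u, ψ u = v) ↔ v ∈ X) : (T.comap ψ).IsTree := by
  obtain ⟨u₀, hu₀⟩ := (hr r).2 hX.1
  have hreach : ∀ u, (T.comap ψ).Reachable u u₀ := by
    by_contra! hcon
    obtain ⟨u, hu⟩ := hcon
    have : Finite U := Finite.of_injective ψ hψ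
    obtain ⟨v, hv, hmin⟩ := Set.exists_min_image {u | ¬ (T.comap ψ).Reachable u u₀}
      (fun u => δ (ψ u) r) (Set.toFinite _) ⟨u, hu⟩
    have hvr : ψ v ≠ r := fun e => hv (by
      have : v = u₀ := hψ (e.trans hu₀.symm)
      rw [this])
    obtain ⟨z, hz, hb⟩ := h.toward (ψ v) r hvr
    obtain ⟨w, rfl⟩ := (hr z).2 (hX.2 _ ((hr _).1 ⟨v, rfl⟩) hvr z hz)
    have hvw : (T.comap ψ).Adj v w := hz
    by_cases hw : (T.comap ψ).Reachable w u₀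
    · exact hv (hvw.reachable.trans hw)
    · have := hmin w hw
      have := h.pos _ _ hz.ne
      unfold Btw at hb; linarith
  have : Nonempty U := ⟨u₀⟩
  refine ⟨⟨fun u v => (hreach u).trans (hreach v).symm⟩, ?_⟩
  exact hT.2.of_comap ⟨ψ, hψ⟩

theorem RealizesOn.comap {ℓ : Sym2 V → ℝ} (hR : RealizesOn T Set.univ ℓ δ) {U : Type*} {ψ : U → V}
    (hψ : Function.Injective ψ) :
    RealizesOn (T.comap ψ) Set.univ (fun e => ℓ (e.map ψ)) (fun x y => δ (ψ x) (ψ y)) := by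
  refine ⟨?_, fun i _ j _ p hp => ?_⟩
  · intro e
    induction e with
    | _ x y => exact fun he => hR.1 s(ψ x, ψ y) he
  · let F : T.comap ψ →g T := ⟨ψ, fun {a b} hab => hab⟩
    change δ (ψ i) (ψ j) = _
    rw [hR.2 (ψ i) trivial (ψ j) trivial (p.map F) (SimpleGraph.Walk.IsPath.map hψ hp),
      SimpleGraph.Walk.edges_map, List.map_map]
    rfl

/-- Except at `r`, a node of the piece keeps all its neighbours, so its degree is the one in `T`. -/
theorem IsPiece.label_comap [Finite V] {X : Finset V} {r : V} (hX : IsPiece T X r) {L : Set V}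
    (hL : ∀ v, (T.neighborSet v).ncard ≤ 2 → v ∈ L) {U : Type*} {ψ : U → V}
    (hψ : Function.Injective ψ) (hr : ∀ v, (∃ u, ψ u = v) ↔ v ∈ X) (u : U)
    (hu : ((T.comap ψ).neighborSet u).ncard ≤ 2) : ψ u ∈ L ∨ ψ u = r := by
  by_cases hur : ψ u = r
  · exact Or.inr hur
  left
  apply hL
  have : T.neighborSet (ψ u) = ψ '' (T.comap ψ).neighborSet u := by
    ext y
    constructor
    · intro hy
      obtain ⟨w, rfl⟩ := (hr y).2 (hX.2 _ ((hr _).1 ⟨u, rfl⟩) hur y hy)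
      exact ⟨w, hy, rfl⟩
    · rintro ⟨w, hw, rfl⟩
      exact hw
  rw [this, Set.ncard_image_of_injective _ hψ]
  exact hu

/-- Distances between labels which are realized by a tree extend to all of its nodes. -/
theorem exists_extension {U : Type*} {T₁ : SimpleGraph U} (hT₁ : T₁.IsTree) {B : Set U}
    {ℓ : Sym2 U → ℝ} {d : U → U → ℝ} (hd : RealizesOn T₁ B ℓ d) :
    ∃ δ₁ : U → U → ℝ, RealizesOn T₁ Set.univ ℓ δ₁ ∧ ∀ x ∈ B, ∀ y ∈ B, δ₁ x y = d x y := by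
  choose p hp hu using hT₁.existsUnique_path
  have h1 : RealizesOn T₁ Set.univ ℓ (fun x y => ((p x y).edges.map ℓ).sum) :=
    ⟨hd.1, fun x _ y _ q hq => by rw [hu x y q hq]⟩
  exact ⟨_, h1, fun x hx y hy => (hd.2 x hx y hy _ (hp x y)).symm⟩

/-- The edges inside the set `X` of nodes. -/
noncomputable def edgesIn (T : SimpleGraph V) (X : Finset V) : Finset (Sym2 V) :=
  open Classical in X.sym2.filter (fun e => e ∈ T.edgeSet)

theorem mem_edgesIn {X : Finset V} {x y : V} :
    s(x, y) ∈ edgesIn T X ↔ (x ∈ X ∧ y ∈ X) ∧ T.Adj x y := by simp [edgesIn]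

variable [DecidableEq V] {W : Finset V}

/-- The piece itself is a full skeleton, once its nodes outside the core get names from `next` on.
So the search for a skeleton never fails. -/
theorem exists_isFullSkeleton [Finite V] (hT : T.IsTree) {ℓ : Sym2 V → ℝ}
    (hR : RealizesOn T Set.univ ℓ δ) (hW : ∀ v, (T.neighborSet v).ncard ≤ 2 → v ∈ (W : Set V))
    {c : Config W} (hc : c.Valid) {X : Finset V} {r : V} (hX : IsPiece T X r)
    (hk : c.Known δ (X, r)) :
    ∃ q, IsFullSkeleton c.oracle.dist c.oracle.next (mkBag W c.name (X, r)).nodes q := by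
  classical
  have h := hR.isTreeMetric hT
  set K := core W X r with hK
  set N := X \ K with hN
  have hKX : K ⊆ X := fun x hx => (mem_core.1 hx).1
  have hKn : ∀ x ∈ K, x ∈ c.named := fun x hx => hc.core_named hk.root hx
  let name' : V → Node W := fun x =>
    if hx : x ∈ N then Sum.inr (c.oracle.next + (N.equivFin ⟨x, hx⟩ : ℕ)) else c.name x
  have hn1 : ∀ x (hx : x ∈ N), name' x = Sum.inr (c.oracle.next + (N.equivFin ⟨x, hx⟩ : ℕ)) :=
    fun x hx => dif_pos hx
  have hn2 : ∀ x ∈ K, name' x = c.name x := fun x hx =>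
    dif_neg (fun hh => (Finset.mem_sdiff.1 hh).2 hx)
  have hcase : ∀ x ∈ X, x ∈ N ∨ x ∈ K := fun x hx => by
    by_cases hxK : x ∈ K
    · exact Or.inr hxK
    · exact Or.inl (Finset.mem_sdiff.2 ⟨hx, hxK⟩)
  have hKN : ∀ x ∈ K, ∀ y ∈ N, name' x ≠ name' y := fun x hx y hy e => by
    rw [hn2 x hx, hn1 y hy] at e
    have := hc.lt x (hKn x hx) _ e
    omega
  have hinj : Set.InjOn name' (X : Set V) := by
    intro x hx y hy e
    rcases hcase x hx with hx | hx <;> rcases hcase y hy with hy | hy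
    · rw [hn1 x hx, hn1 y hy] at e
      have e' := Sum.inr.inj e
      have : N.equivFin ⟨x, hx⟩ = N.equivFin ⟨y, hy⟩ := Fin.ext (by omega)
      exact congrArg Subtype.val (N.equivFin.injective this)
    · exact (hKN y hy x hx e.symm).elim
    · exact (hKN x hx y hy e).elim
    · rw [hn2 x hx, hn2 y hy] at e
      exact hc.inj (hKn x hx) (hKn y hy) e
  have hB : (mkBag W c.name (X, r)).nodes = K.image name' :=
    Finset.image_congr fun x hx => (hn2 x hx).symm
  set U := X.image name' with hU
  have hex : ∀ u : U, ∃ x ∈ X, name' x = u.1 := fun u => Finset.mem_image.1 u.2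
  choose ψ hψX hψ using hex
  have hψinj : Function.Injective ψ := fun u v e => Subtype.ext (by rw [← hψ u, ← hψ v, e])
  have hψname : ∀ x (hx : x ∈ X), ψ ⟨name' x, Finset.mem_image_of_mem _ hx⟩ = x := fun x hx =>
    hinj (hψX _) hx (hψ _)
  have hrange : ∀ v, (∃ u, ψ u = v) ↔ v ∈ X := fun v =>
    ⟨fun ⟨u, hu⟩ => hu ▸ hψX u, fun hv => ⟨_, hψname v hv⟩⟩
  have hψB : ∀ u : U, u.1 ∈ (mkBag W c.name (X, r)).nodes ↔ ψ u ∈ K := fun u => by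
    rw [hB, ← hψ u]
    constructor
    · intro hu
      obtain ⟨x, hx, e⟩ := Finset.mem_image.1 hu
      exact hinj (hKX hx) (hψX u) e ▸ hx
    · exact fun hu => Finset.mem_image_of_mem _ hu
  have hRc := hR.comap hψinj
  refine ⟨((Set.toFinite (Sym2.map Subtype.val '' (T.comap ψ).edgeSet)).toFinset,
    c.oracle.next + N.card), by simp, U, ?_, ?_, T.comap ψ, _, ⟨hX.isTree_comap h hT hψinj hrange,
      fun u hu => ?_⟩, ⟨hRc.1, fun u hu v hv p hp => ?_⟩, by simp⟩
  · rw [hB]; exact Finset.image_subset_image hKX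
  · intro v hv hvB
    obtain ⟨x, hx, rfl⟩ := Finset.mem_image.1 hv
    rcases hcase x hx with hx | hx
    · refine ⟨_, ?_, ?_, hn1 x hx⟩
      · omega
      · have := (N.equivFin ⟨x, hx⟩).2
        omega
    · exact (hvB (hB ▸ Finset.mem_image_of_mem _ hx)).elim
  · refine (hψB u).2 (mem_core.2 ⟨hψX u, ?_⟩)
    simpa using hX.label_comap hW hψinj hrange u hu
  · have hu' := (hψB u).1 hu
    have hv' := (hψB v).1 hv
    rw [← hRc.2 u trivial v trivial p hp]
    change c.oracle.dist u v = δ (ψ u) (ψ v)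
    rw [← hk.dist _ hu' _ hv', ← hn2 _ hu', ← hn2 _ hv', hψ, hψ]

/-- Solving a small bag directly finds the edges of its piece. -/
theorem findFullSkeleton_spec [Finite V] (hT : T.IsTree) {ℓ : Sym2 V → ℝ}
    (hR : RealizesOn T Set.univ ℓ δ) (hW : ∀ v, (T.neighborSet v).ncard ≤ 2 → v ∈ (W : Set V))
    {c : Config W} (hc : c.Valid) {X : Finset V} {r : V} (hX : IsPiece T X r)
    (hk : c.Known δ (X, r)) (hf : c.Fresh (X, r)) :
    ∃ c' : Config W, c'.Valid ∧ c.Le c' ∧ c'.named = c.named ∪ X ∧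
      (findFullSkeleton c.oracle (mkBag W c.name (X, r)).nodes).1 =
        (edgesIn T X).image (Sym2.map c'.name) ∧
      c'.oracle = { c.oracle with
        next := (findFullSkeleton c.oracle (mkBag W c.name (X, r)).nodes).2 } := by
  classical
  have h := hR.isTreeMetric hT
  have hex := exists_isFullSkeleton hT hR hW hc hX hk
  have hq : IsFullSkeleton c.oracle.dist c.oracle.next (mkBag W c.name (X, r)).nodes
      (findFullSkeleton c.oracle (mkBag W c.name (X, r)).nodes) := by
    unfold findFullSkeleton
    rw [dif_pos hex]
    exact hex.choose_spec
  generalize findFullSkeleton c.oracle (mkBag W c.name (X, r)).nodes = q at hq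
  obtain ⟨hnext, U, hBU, hUn, T₁, ℓ₁, hsl, hreal, hedge⟩ := hq
  obtain ⟨δ₁, hR₁, hδ₁⟩ := exists_extension hsl.1 hreal
  have h₁ := hR₁.isTreeMetric hsl.1
  set K := core W X r with hK
  have hKn : ∀ x ∈ K, x ∈ c.named := fun x hx => hc.core_named hk.root hx
  have hKB : ∀ l : K, c.name l ∈ (mkBag W c.name (X, r)).nodes := fun l =>
    Finset.mem_image_of_mem _ l.2
  let i₁ : K → U := fun l => ⟨c.name l, hBU (hKB l)⟩
  let i₂ : K → X := fun l => ⟨l, (mem_core.1 l.2).1⟩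
  have hsub : Function.Injective (Subtype.val : X → V) := Subtype.val_injective
  have hrange : ∀ v, (∃ u : X, (u : V) = v) ↔ v ∈ X := by simp
  have h₂ := (hR.comap hsub).isTreeMetric (hX.isTree_comap h hT hsub hrange)
  -- The tree that was found and the piece have the same labels with the same distances; the
  -- isomorphism between them tells which tree nodes the new names denote.
  obtain ⟨e, he⟩ := h₂.exists_isometry (i₁ := i₂) (i₂ := i₁) h₁
    (fun v hv => by
      have := hX.label_comap hW hsub hrange v hv
      exact ⟨⟨v, mem_core.2 ⟨v.2, by simpa using this⟩⟩, rfl⟩)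
    (fun v hv => by
      obtain ⟨x, hx, e⟩ := Finset.mem_image.1 (hsl.2 v hv)
      exact ⟨⟨x, hx⟩, Subtype.ext e⟩)
    (fun a b => by
      rw [hδ₁ _ (hKB a) _ (hKB b)]
      exact (hk.dist a a.2 b b.2).symm)
  let name' : V → Node W := fun x => if hx : x ∈ X then (e ⟨x, hx⟩).1 else c.name x
  have hn1 : ∀ x (hx : x ∈ X), name' x = (e ⟨x, hx⟩).1 := fun x hx => dif_pos hx
  have hnK : ∀ x ∈ K, name' x = c.name x := fun x hx => by
    rw [hn1 x (mem_core.1 hx).1]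
    exact congrArg Subtype.val (he ⟨x, hx⟩)
  -- By freshness no node of `X` outside the core has a name yet, so renaming the piece does not
  -- conflict with older names.
  have hXn : ∀ x ∈ X, x ∈ c.named → x ∈ K := fun x hx hxn => by
    by_cases hxr : x = r
    · exact mem_core.2 ⟨hx, Or.inr hxr⟩
    · exact mem_core.2 ⟨hx, Or.inl (hf x hx hxn hxr)⟩
  have hname : ∀ x ∈ c.named, name' x = c.name x := fun x hxn => by
    by_cases hx : x ∈ X
    · exact hnK x (hXn x hx hxn)
    · exact dif_neg hx
  have hlat : ∀ x ∈ X, x ∉ K → ∃ n, c.oracle.next ≤ n ∧ n < q.2 ∧ name' x = Sum.inr n := by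
    intro x hx hxK
    rw [hn1 x hx]
    refine hUn _ (e ⟨x, hx⟩).2 fun hB => hxK ?_
    obtain ⟨l, hl, e'⟩ := Finset.mem_image.1 hB
    have e'' : e (i₂ ⟨l, hl⟩) = e ⟨x, hx⟩ := Subtype.ext ((congrArg Subtype.val (he ⟨l, hl⟩)).trans e')
    have : l = x := congrArg Subtype.val (e.injective e'')
    exact this ▸ hl
  have hnl : ∀ x ∈ c.named, ∀ y ∈ X, y ∉ K → name' x ≠ name' y := fun x hx y hy hyK e' => by
    obtain ⟨n, hn, -, hyn⟩ := hlat y hy hyK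
    rw [hname x hx, hyn] at e'
    have := hc.lt x hx n e'
    omega
  refine ⟨⟨name', c.named ∪ X, { c.oracle with next := q.2 }⟩,
    ⟨hc.sub.trans Finset.subset_union_left, fun w => (hname w (hc.sub w.2)).trans (hc.label w),
      ?_, ?_⟩, ⟨Finset.subset_union_left, hname, fun _ _ _ _ => rfl⟩, rfl, ?_, rfl⟩
  · have key : ∀ x ∈ c.named ∪ X, x ∈ c.named ∨ (x ∈ X ∧ x ∉ K) := fun x hx => by
      by_cases hxn : x ∈ c.named
      · exact Or.inl hxn
      · exact Or.inr ⟨(Finset.mem_union.1 hx).resolve_left hxn, fun hxK => hxn (hKn x hxK)⟩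
    intro x hx y hy e'
    dsimp only at e'
    rcases key x hx with hx | hx <;> rcases key y hy with hy | hy
    · rw [hname x hx, hname y hy] at e'
      exact hc.inj hx hy e'
    · exact (hnl x hx y hy.1 hy.2 e').elim
    · exact (hnl y hy x hx.1 hx.2 e'.symm).elim
    · rw [hn1 x hx.1, hn1 y hy.1] at e'
      exact congrArg Subtype.val (e.injective (Subtype.ext e'))
  · intro x hx n e'
    dsimp only at *
    by_cases hxn : x ∈ c.named
    · rw [hname x hxn] at e'
      exact (hc.lt x hxn n e').trans_le hnext
    · have hxX := (Finset.mem_union.1 hx).resolve_left hxn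
      obtain ⟨m, -, hm, e''⟩ := hlat x hxX (fun hxK => hxn (hKn x hxK))
      rw [e''] at e'
      exact Sum.inr.inj e' ▸ hm
  · rw [← Finset.coe_inj, hedge, Finset.coe_image]
    dsimp only
    ext f
    constructor
    · rintro ⟨g, hg, rfl⟩
      induction g with
      | _ u v =>
        refine ⟨s(e.symm u, e.symm v), ?_, ?_⟩
        · exact Finset.mem_coe.2 (mem_edgesIn.2 ⟨⟨(e.symm u).2, (e.symm v).2⟩,
            e.symm.map_rel_iff.2 hg⟩)
        · simp only [Sym2.map_mk]
          rw [hn1 _ (e.symm u).2, hn1 _ (e.symm v).2]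
          simp
    · rintro ⟨g, hg, rfl⟩
      induction g with
      | _ x y =>
        obtain ⟨⟨hx, hy⟩, hxy⟩ := mem_edgesIn.1 (Finset.mem_coe.1 hg)
        refine ⟨s(e ⟨x, hx⟩, e ⟨y, hy⟩), e.map_rel_iff.2 (show T.Adj _ _ from hxy), ?_⟩
        simp only [Sym2.map_mk, hn1 x hx, hn1 y hy]

end FullSkeleton

/-! ### The invariants of the queue -/

section Queue

variable {V : Type*} [DecidableEq V] {W : Finset V} {T : SimpleGraph V} {δ : V → V → ℝ}

/-- The regular nodes of a piece other than its representative. -/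
def inner (W : Finset V) (t : Finset V × V) : Finset V := t.1.erase t.2 ∩ W

/-- The invariants of the algorithm: `L` is the list of the pieces in the queue, and `E` is the set
of the edges found so far. -/
structure QueueInv (T : SimpleGraph V) (δ : V → V → ℝ) (c : Config W) (L : List (Finset V × V))
    (E : Finset (Sym2 V)) (s : State W) : Prop where
  valid : c.Valid
  queue : s.queue = L.map (mkBag W c.name)
  oracle : s.oracle = c.oracle
  skel : s.skel = E.image (Sym2.map c.name)
  edge : ∀ e ∈ E, e ∈ T.edgeSet ∧ ∀ v ∈ e, v ∈ c.named
  piece : ∀ t ∈ L, PieceOK T δ c t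
  disj : L.Pairwise (fun t t' => Disjoint (t.1.erase t.2) (t'.1.erase t'.2))
  cover : ∀ x, x ∈ c.named ∨ ∃ t ∈ L, x ∈ t.1.erase t.2
  edges : ∀ x y, T.Adj x y → s(x, y) ∈ E ∨ ∃ t ∈ L, x ∈ t.1.erase t.2 ∨ y ∈ t.1.erase t.2

/-- The number of nodes in the queue which are not representatives. -/
def State.weight (s : State W) : ℕ := (s.queue.map (fun B => B.nodes.card - 1)).sum

theorem core_eq_insert {X : Finset V} {r : V} (hr : r ∈ X) :
    core W X r = insert r (inner W (X, r)) := by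
  ext x
  simp only [mem_core, inner, Finset.mem_insert, Finset.mem_inter, Finset.mem_erase]
  constructor
  · rintro ⟨hx, hw⟩
    by_cases hxr : x = r
    · exact Or.inl hxr
    · exact Or.inr ⟨⟨hxr, hx⟩, hw.resolve_right hxr⟩
  · rintro (rfl | ⟨⟨-, hx⟩, hw⟩)
    · exact ⟨hr, Or.inr rfl⟩
    · exact ⟨hx, Or.inl hw⟩

theorem PieceOK.card_nodes {c : Config W} (hc : c.Valid) {t : Finset V × V}
    (ht : PieceOK T δ c t) : (mkBag W c.name t).nodes.card = (inner W t).card + 1 := by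
  simp only [mkBag]
  rw [Finset.card_image_of_injOn (hc.inj.mono fun y hy => hc.core_named ht.known.root hy),
    core_eq_insert ht.piece.1, Finset.card_insert_of_notMem (by simp [inner])]

theorem PieceOK.inner_pos {c : Config W} {t : Finset V × V} (ht : PieceOK T δ c t) :
    0 < (inner W t).card := by
  obtain ⟨x, hx, hxW, hxr⟩ := ht.label
  exact Finset.card_pos.2 ⟨x, Finset.mem_inter.2 ⟨Finset.mem_erase.2 ⟨hxr, hx⟩, hxW⟩⟩

theorem PieceOK.mono {c c' : Config W} (hc : c.Valid) (hle : c.Le c') {t u : Finset V × V}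
    (ht : PieceOK T δ c t) (hd : Disjoint (t.1.erase t.2) (u.1.erase u.2))
    (hn : ∀ x ∈ c'.named, x ∈ c.named ∨ x ∈ u.1.erase u.2) : PieceOK T δ c' t where
  piece := ht.piece
  known := ht.known.mono hc hle
  label := ht.label
  fresh x hx hxn hxr := by
    rcases hn x hxn with h | h
    · exact ht.fresh x hx h hxr
    · exact (Finset.disjoint_left.1 hd (Finset.mem_erase.2 ⟨hxr, hx⟩) h).elim

theorem map_weight {c : Config W} (hc : c.Valid) {L : List (Finset V × V)}
    (hL : ∀ t ∈ L, PieceOK T δ c t) :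
    ((L.map (mkBag W c.name)).map (fun B => B.nodes.card - 1)).sum =
      (L.map (fun t => (inner W t).card)).sum := by
  rw [List.map_map]
  congr 1
  refine List.map_congr_left fun t ht => ?_
  simp only [Function.comp_apply]
  rw [(hL t ht).card_nodes hc]
  simp

theorem sum_card_le {L : List (Finset V × V)} {A : Finset V}
    (hd : L.Pairwise (fun t t' => Disjoint (t.1.erase t.2) (t'.1.erase t'.2)))
    (hA : ∀ t ∈ L, inner W t ⊆ A) : (L.map (fun t => (inner W t).card)).sum ≤ A.card := by
  induction L generalizing A with
  | nil => simp
  | cons t L ih =>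
    rw [List.pairwise_cons] at hd
    have := ih hd.2 (A := A \ inner W t) (fun t' ht' => Finset.subset_sdiff.2
      ⟨hA t' (by simp [ht']), ((hd.1 t' ht').mono Finset.inter_subset_left
        Finset.inter_subset_left).symm⟩)
    have h2 := Finset.card_sdiff_add_card_eq_card (hA t (by simp))
    simp only [List.map_cons, List.sum_cons]
    omega

theorem QueueInv.weight_eq {c : Config W} {L : List (Finset V × V)} {E : Finset (Sym2 V)}
    {s : State W} (hI : QueueInv T δ c L E s) :
    s.weight = (L.map (fun t => (inner W t).card)).sum := by
  unfold State.weight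
  rw [hI.queue, map_weight hI.valid hI.piece]

theorem QueueInv.weight_le {c : Config W} {L : List (Finset V × V)} {E : Finset (Sym2 V)}
    {s : State W} (hI : QueueInv T δ c L E s) : s.weight ≤ W.card := by
  rw [hI.weight_eq]
  exact sum_card_le hI.disj fun t _ => Finset.inter_subset_right

theorem QueueInv.weight_pos {c : Config W} {L : List (Finset V × V)} {E : Finset (Sym2 V)}
    {s : State W} (hI : QueueInv T δ c L E s) (hs : ¬ s.Halted) : 0 < s.weight := by
  rw [hI.weight_eq]
  unfold State.Halted at hs
  rw [hI.queue] at hs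
  cases L with
  | nil => simp at hs
  | cons t L =>
    have := (hI.piece t (by simp)).inner_pos
    simp only [List.map_cons, List.sum_cons]
    omega

/-- When the queue is empty, the tree has been found. -/
theorem QueueInv.isSkeletonOf {c : Config W} {L : List (Finset V × V)} {E : Finset (Sym2 V)}
    {s : State W} (hI : QueueInv T δ c L E s) (hs : s.Halted) : IsSkeletonOf T W s.skel := by
  have hL : L = [] := by
    have := hI.queue
    rw [hs] at this
    exact List.map_eq_nil_iff.1 this.symm
  subst hL
  have hnamed : ∀ x, x ∈ c.named := fun x => by simpa using hI.cover x
  refine ⟨⟨c.name, fun x y e => hI.valid.inj (hnamed x) (hnamed y) e⟩, hI.valid.label, ?_⟩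
  rw [hI.skel, Finset.coe_image]
  have hE : (E : Set (Sym2 V)) = T.edgeSet := by
    ext e
    refine ⟨fun he => (hI.edge e he).1, ?_⟩
    induction e with
    | _ x y => exact fun hxy => by simpa using hI.edges x y hxy
  rw [hE]
  rfl

/-- A small bag is solved correctly. -/
theorem QueueInv.small_step [Finite V] (hT : T.IsTree) {ℓ : Sym2 V → ℝ}
    (hR : RealizesOn T Set.univ ℓ δ) (hW : ∀ v, (T.neighborSet v).ncard ≤ 2 → v ∈ (W : Set V))
    {c : Config W} {t : Finset V × V} {L : List (Finset V × V)} {E : Finset (Sym2 V)}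
    {s : State W} (hI : QueueInv T δ c (t :: L) E s) (s' : State W)
    (hs' : s' = { queue := L.map (mkBag W c.name)
                  skel := s.skel ∪ (findFullSkeleton s.oracle (mkBag W c.name t).nodes).1
                  oracle := { s.oracle with
                    next := (findFullSkeleton s.oracle (mkBag W c.name t).nodes).2 } }) :
    ∃ c' E', QueueInv T δ c' L E' s' ∧ s'.weight < s.weight := by
  classical
  have htok := hI.piece t (by simp)
  obtain ⟨X, r⟩ := t
  obtain ⟨c', hc', hle, hn, hq, ho⟩ := findFullSkeleton_spec hT hR hW hI.valid htok.piece
    htok.known htok.fresh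
  have hn' : ∀ x ∈ c'.named, x ∈ c.named ∨ x ∈ X.erase r := fun x hx => by
    rw [hn, Finset.mem_union] at hx
    rcases hx with hx | hx
    · exact Or.inl hx
    · by_cases hxr : x = r
      · exact Or.inl (hxr ▸ htok.known.root)
      · exact Or.inr (Finset.mem_erase.2 ⟨hxr, hx⟩)
  have hd := List.pairwise_cons.1 hI.disj
  have hX : IsPiece T X r := htok.piece
  have hI' : QueueInv T δ c' L (E ∪ edgesIn T X) s' := by
    subst hs'
    refine
      { valid := hc'
        queue := ?_
        oracle := by simp only; rw [hI.oracle, ho]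
        skel := ?_
        edge := ?_
        piece := fun t' ht' => (hI.piece t' (by simp [ht'])).mono hI.valid hle
          (hd.1 t' ht').symm hn'
        disj := hd.2
        cover := fun x => ?_
        edges := fun x y hxy => ?_ }
    · exact List.map_congr_left fun t' ht' =>
        ((hI.piece t' (by simp [ht'])).known.mkBag_eq hI.valid hle).symm
    · simp only
      rw [Finset.image_union, hI.skel, hI.oracle, hq]
      refine congrArg (· ∪ _) (Finset.image_congr fun e he => ?_)
      exact Sym2.map_congr fun v hv => (hle.name v ((hI.edge e he).2 v hv)).symm
    · intro e he
      rcases Finset.mem_union.1 he with he | he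
      · exact ⟨(hI.edge e he).1, fun v hv => hle.sub ((hI.edge e he).2 v hv)⟩
      · induction e with
        | _ x y =>
          obtain ⟨⟨hx, hy⟩, hxy⟩ := mem_edgesIn.1 he
          refine ⟨hxy, fun v hv => ?_⟩
          rw [hn]
          rcases Sym2.mem_iff.1 hv with rfl | rfl
          exacts [Finset.mem_union_right _ hx, Finset.mem_union_right _ hy]
    · rcases hI.cover x with hx | ⟨t', ht', hx⟩
      · exact Or.inl (hle.sub hx)
      · rcases List.mem_cons.1 ht' with rfl | ht'
        · left; rw [hn]; exact Finset.mem_union_right _ (Finset.mem_erase.1 hx).2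
        · exact Or.inr ⟨t', ht', hx⟩
    · rcases hI.edges x y hxy with he | ⟨t', ht', hxy'⟩
      · exact Or.inl (Finset.mem_union_left _ he)
      · rcases List.mem_cons.1 ht' with rfl | ht'
        · left
          refine Finset.mem_union_right _ (mem_edgesIn.2 ⟨?_, hxy⟩)
          simp only [Finset.mem_erase] at hxy'
          rcases hxy' with h1 | h1
          · exact ⟨h1.2, hX.2 x h1.2 h1.1 y hxy⟩
          · exact ⟨hX.2 y h1.2 h1.1 x hxy.symm, h1.2⟩
        · exact Or.inr ⟨t', ht', hxy'⟩
  refine ⟨c', _, hI', ?_⟩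
  rw [hI.weight_eq, hI'.weight_eq]
  have := htok.inner_pos
  simp only [List.map_cons, List.sum_cons]
  omega

/-- A successful round of splitting is correct. -/
theorem QueueInv.split_step {c : Config W} {t : Finset V × V} {L : List (Finset V × V)}
    {E : Finset (Sym2 V)} {s : State W} (hI : QueueInv T δ c (t :: L) E s) {xs : List V}
    (hxs : ∀ x ∈ xs, x ∈ inner W t) (hne : xs ≠ []) {c' : Config W} {L' : List (Finset V × V)}
    {E' : Finset (Sym2 V)} {S : Set V} {r : Split W}
    (hr : RoundResult T δ c t.1 t.2 xs c' L' E' S r) :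
    QueueInv T δ c' (L ++ L') (E ∪ E') { queue := L.map (mkBag W c.name) ++ r.bags
                                         skel := s.skel ∪ r.skel, oracle := r.oracle } ∧
      State.weight { queue := L.map (mkBag W c.name) ++ r.bags
                     skel := s.skel ∪ r.skel, oracle := r.oracle } < s.weight := by
  have htok := hI.piece t (by simp)
  have hd := List.pairwise_cons.1 hI.disj
  have hn' : ∀ x ∈ c'.named, x ∈ c.named ∨ x ∈ t.1.erase t.2 := fun x hx => by
    rcases hr.named x hx with h1 | h1
    · exact Or.inl h1
    · exact Or.inr (Finset.mem_erase.2 ⟨h1.2, h1.1⟩)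
  have hsub : ∀ t' ∈ L', t'.1.erase t'.2 ⊆ t.1.erase t.2 := fun t' ht' x hx => by
    refine Finset.mem_erase.2 ⟨?_, hr.subset t' ht' (Finset.mem_erase.1 hx).2⟩
    rintro rfl
    exact hr.avoid t' ht' _ hx hr.root
  have hI' : QueueInv T δ c' (L ++ L') (E ∪ E') { queue := L.map (mkBag W c.name) ++ r.bags
                                                  skel := s.skel ∪ r.skel
                                                  oracle := r.oracle } := by
    refine
      { valid := hr.valid
        queue := ?_
        oracle := hr.oracle
        skel := ?_
        edge := ?_
        piece := fun t' ht' => ?_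
        disj := ?_
        cover := fun x => ?_
        edges := fun x y hxy => ?_ }
    · simp only
      rw [List.map_append, hr.bags]
      refine congrArg (· ++ _) (List.map_congr_left fun t' ht' => ?_)
      exact ((hI.piece t' (by simp [ht'])).known.mkBag_eq hI.valid hr.le).symm
    · simp only
      rw [Finset.image_union, hI.skel, hr.skel]
      refine congrArg (· ∪ _) (Finset.image_congr fun e he => ?_)
      exact Sym2.map_congr fun v hv => (hr.le.name v ((hI.edge e he).2 v hv)).symm
    · intro e he
      rcases Finset.mem_union.1 he with he | he
      · exact ⟨(hI.edge e he).1, fun v hv => hr.le.sub ((hI.edge e he).2 v hv)⟩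
      · exact hr.edge e he
    · rcases List.mem_append.1 ht' with ht' | ht'
      · exact (hI.piece t' (by simp [ht'])).mono hI.valid hr.le (hd.1 t' ht').symm hn'
      · exact hr.piece t' ht'
    · refine List.pairwise_append.2 ⟨hd.2, hr.disj, fun t₁ h₁ t₂ h₂ => ?_⟩
      exact (hd.1 t₁ h₁).symm.mono_right (hsub t₂ h₂)
    · rcases hI.cover x with hx | ⟨t', ht', hx⟩
      · exact Or.inl (hr.le.sub hx)
      · rcases List.mem_cons.1 ht' with rfl | ht'
        · rcases hr.cover x (Finset.mem_erase.1 hx).2 with h1 | ⟨t', ht', hx'⟩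
          · exact Or.inl h1
          · exact Or.inr ⟨t', List.mem_append_right _ ht', hx'⟩
        · exact Or.inr ⟨t', List.mem_append_left _ ht', hx⟩
    · rcases hI.edges x y hxy with he | ⟨t', ht', hxy'⟩
      · exact Or.inl (Finset.mem_union_left _ he)
      · rcases List.mem_cons.1 ht' with rfl | ht'
        · have hboth : x ∈ t'.1 ∧ y ∈ t'.1 := by
            simp only [Finset.mem_erase] at hxy'
            rcases hxy' with h1 | h1
            · exact ⟨h1.2, htok.piece.2 x h1.2 h1.1 y hxy⟩
            · exact ⟨htok.piece.2 y h1.2 h1.1 x hxy.symm, h1.2⟩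
          rcases hr.edges x hboth.1 y hboth.2 hxy with h1 | ⟨t'', ht'', h1⟩
          · exact Or.inl (Finset.mem_union_right _ h1)
          · exact Or.inr ⟨t'', List.mem_append_right _ ht'', h1⟩
        · exact Or.inr ⟨t', List.mem_append_left _ ht', hxy'⟩
  refine ⟨hI', ?_⟩
  rw [hI.weight_eq, hI'.weight_eq]
  obtain ⟨x, hx⟩ := List.exists_mem_of_ne_nil xs hne
  -- The new inner sets are disjoint, and a sampled node `x` belongs to none of them, since it is in
  -- `S`. This loss makes the weight drop.
  have h1 : (L'.map (fun t => (inner W t).card)).sum ≤ ((inner W t).erase x).card := by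
    refine sum_card_le hr.disj fun t' ht' y hy => ?_
    have hy' := Finset.mem_inter.1 hy
    refine Finset.mem_erase.2 ⟨?_, Finset.mem_inter.2 ⟨hsub t' ht' hy'.1, hy'.2⟩⟩
    rintro rfl
    exact hr.avoid t' ht' _ hy'.1 (hr.sample _ hx)
  have h2 := Finset.card_erase_add_one (hxs x hx)
  simp only [List.map_cons, List.sum_cons, List.map_append, List.sum_append]
  omega

end Queue

/-! ### Good samples -/

section Good

variable {V : Type*} [Finite V] [DecidableEq V] {T : SimpleGraph V} {δ : V → V → ℝ}

open Classical in
/-- A set `A` of nodes has a subset of `Δ` nodes such that below each node `z` with at least `q`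
nodes of `A` below it, there is a node of the subset. -/
theorem exists_good_sample (h : IsTreeMetric T δ) (A : Finset V) (r : V) {Δ q : ℕ} (hq : 0 < q)
    (hA : A.card < (Δ + 1) * q) (hΔ : Δ ≤ A.card) :
    ∃ G ⊆ A, G.card = Δ ∧
      ∀ z, q ≤ (A.filter (fun y => Btw δ y z r)).card → ∃ u ∈ G, Btw δ u z r := by
  have := Fintype.ofFinite V
  set D : V → Finset V := fun z => A.filter (fun y => Btw δ y z r) with hD
  set H : Finset V := Finset.univ.filter (fun z => q ≤ (D z).card) with hH
  -- Call a node heavy if at least `q` nodes of `A` are below it. The lowest heavy nodes `M` have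
  -- disjoint sets below them, so `M.card * q ≤ A.card < (Δ + 1) * q` and there are at most `Δ` of
  -- them. The sample takes one node below each and is filled up to size `Δ`.
  set M : Finset V := H.filter (fun z => ∀ z' ∈ H, Btw δ z' z r → z' = z) with hM
  have hmin : ∀ z ∈ H, ∃ z' ∈ M, Btw δ z' z r := by
    intro z hz
    obtain ⟨z', hz', hmax⟩ := Finset.exists_max_image (H.filter (fun z' => Btw δ z' z r))
      (fun z' => δ z' r) ⟨z, Finset.mem_filter.2 ⟨hz, h.btw_left _ _⟩⟩
    rw [Finset.mem_filter] at hz'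
    refine ⟨z', Finset.mem_filter.2 ⟨hz'.1, fun z'' hz'' hb => ?_⟩, hz'.2⟩
    have hb' : Btw δ z'' z r := h.btw_comm (h.btw_trans (h.btw_comm hz'.2) (h.btw_comm hb))
    have := hmax z'' (Finset.mem_filter.2 ⟨hz'', hb'⟩)
    apply h.eq_of_le
    unfold Btw at hb; linarith
  have hMq : ∀ z ∈ M, q ≤ (D z).card := fun z hz =>
    (Finset.mem_filter.1 (Finset.mem_filter.1 hz).1).2
  have hdisj : (M : Set V).PairwiseDisjoint D := by
    intro z hz z' hz' hne
    refine Finset.disjoint_left.2 fun y hy hy' => hne ?_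
    have hz := Finset.mem_filter.1 hz
    have hz' := Finset.mem_filter.1 hz'
    have h1 := h.btw_comm (Finset.mem_filter.1 hy).2
    have h2 := h.btw_comm (Finset.mem_filter.1 hy').2
    rcases h.btw_total h1 h2 with h3 | h3
    · exact (hz.2 z' hz'.1 (h.btw_comm h3)).symm
    · exact hz'.2 z hz.1 (h.btw_comm h3)
  have hMΔ : M.card ≤ Δ := by
    have h1 : M.card * q ≤ A.card := calc
      M.card * q = ∑ z ∈ M, q := by simp
      _ ≤ ∑ z ∈ M, (D z).card := Finset.sum_le_sum hMq
      _ = (M.biUnion D).card := (Finset.card_biUnion hdisj).symm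
      _ ≤ A.card := Finset.card_le_card (Finset.biUnion_subset.2 fun z _ => Finset.filter_subset _ _)
    have : M.card < Δ + 1 := Nat.lt_of_mul_lt_mul_right (h1.trans_lt hA)
    omega
  have hne : ∀ z ∈ M, ∃ y ∈ A, Btw δ y z r := fun z hz => by
    obtain ⟨y, hy⟩ := Finset.card_pos.1 (hq.trans_le (hMq z hz))
    exact ⟨y, Finset.mem_filter.1 hy⟩
  choose! g hgA hg using hne
  obtain ⟨G, hG1, hG2, hG3⟩ := Finset.exists_subsuperset_card_eq
    (Finset.image_subset_iff.2 hgA) ((Finset.card_image_le (f := g)).trans hMΔ) hΔ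
  refine ⟨G, hG2, hG3, fun z hz => ?_⟩
  obtain ⟨z', hz', hb⟩ := hmin z (Finset.mem_filter.2 ⟨Finset.mem_univ _, hz⟩)
  exact ⟨g z', hG1 (Finset.mem_image_of_mem _ hz'),
    h.btw_comm (h.btw_trans (h.btw_comm hb) (h.btw_comm (hg z' hz')))⟩

end Good

/-! ### Steps of the algorithm -/

section Step

variable {V : Type*} [DecidableEq V] {W : Finset V} {T : SimpleGraph V} {δ : V → V → ℝ}

theorem PieceOK.erase_nodes {c : Config W} (hc : c.Valid) {t : Finset V × V}
    (ht : PieceOK T δ c t) :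
    (mkBag W c.name t).nodes.erase (mkBag W c.name t).rep = (inner W t).image c.name := by
  obtain ⟨X, r⟩ := t
  simp only [mkBag]
  rw [core_eq_insert ht.piece.1, Finset.image_insert, Finset.erase_insert]
  intro hr
  obtain ⟨x, hx, e⟩ := Finset.mem_image.1 hr
  have hx' := Finset.mem_inter.1 hx
  exact (Finset.mem_erase.1 hx'.1).1 (hc.inj (hc.sub hx'.2) ht.known.root e)

theorem exists_sample_list {c : Config W} (hc : c.Valid) {t : Finset V × V}
    (ht : PieceOK T δ c t) {Δ : ℕ}
    (u : Fin Δ ↪ ↥((mkBag W c.name t).nodes.erase (mkBag W c.name t).rep)) :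
    ∃ xs : List V, List.ofFn (fun i => (u i : Node W)) = xs.map c.name ∧
      xs.length = Δ ∧ ∀ x ∈ xs, x ∈ inner W t := by
  have : ∀ i, ∃ x ∈ inner W t, c.name x = u i := fun i =>
    Finset.mem_image.1 ((Finset.ext_iff.1 (ht.erase_nodes hc) _).1 (u i).2)
  choose f hf hfu using this
  refine ⟨List.ofFn f, ?_, by simp, ?_⟩
  · rw [List.map_ofFn]
    congr 1
    funext i
    exact (hfu i).symm
  · intro x hx
    obtain ⟨i, rfl⟩ := (List.mem_ofFn' f x).1 hx
    exact hf i

/-- With `q` the floor, `n / √Δ < q + 1 ≤ 2 q`, and `2 √Δ ≤ Δ + 1` turns this into `n < (Δ + 1) q`.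
This is the counting hypothesis of `exists_good_sample` for the `n - 1` nodes other than the
representative. -/
theorem floor_bound {Δ n : ℕ} (hΔ : 0 < Δ) (hn : Δ < n) :
    0 < ⌊(n : ℝ) / Real.sqrt Δ⌋₊ ∧ n - 1 < (Δ + 1) * ⌊(n : ℝ) / Real.sqrt Δ⌋₊ := by
  have h1 : (1 : ℝ) ≤ Δ := by exact_mod_cast hΔ
  have h2 : (Δ : ℝ) < n := by exact_mod_cast hn
  have hs1 : 1 ≤ Real.sqrt Δ := Real.one_le_sqrt.2 h1
  have hs2 : Real.sqrt Δ * Real.sqrt Δ = Δ := Real.mul_self_sqrt (by linarith)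
  have hq : 0 < ⌊(n : ℝ) / Real.sqrt Δ⌋₊ := by
    rw [Nat.floor_pos, le_div_iff₀ (by linarith)]
    nlinarith
  refine ⟨hq, ?_⟩
  have hlt := Nat.lt_floor_add_one ((n : ℝ) / Real.sqrt Δ)
  rw [div_lt_iff₀ (by linarith)] at hlt
  set q := ⌊(n : ℝ) / Real.sqrt Δ⌋₊
  have hq1 : (1 : ℝ) ≤ q := by exact_mod_cast hq
  have h3 : 2 * Real.sqrt Δ ≤ Δ + 1 := by nlinarith [sq_nonneg (Real.sqrt Δ - 1)]
  have h4 : (n : ℝ) < (Δ + 1) * q := by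
    calc (n : ℝ) < (q + 1) * Real.sqrt Δ := hlt
      _ ≤ (2 * q) * Real.sqrt Δ := by gcongr; linarith
      _ = (2 * Real.sqrt Δ) * q := by ring
      _ ≤ _ := by gcongr
  have h5 : n < (Δ + 1) * q := by exact_mod_cast h4
  omega

/-- A round of splitting of a large bag either changes nothing or makes progress, and there is a
sample with which it makes progress. -/
theorem QueueInv.trySplit_spec [Finite V] (hT : T.IsTree) {ℓ : Sym2 V → ℝ}
    (hR : RealizesOn T Set.univ ℓ δ) (hW : ∀ v, (T.neighborSet v).ncard ≤ 2 → v ∈ (W : Set V))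
    {c : Config W} {t : Finset V × V} {L : List (Finset V × V)} {E : Finset (Sym2 V)}
    {s : State W} (hI : QueueInv T δ c (t :: L) E s) {Δ : ℕ} (hΔ : 0 < Δ) :
    (∀ u : Fin Δ ↪ ↥((mkBag W c.name t).nodes.erase (mkBag W c.name t).rep), ∀ s',
      s' = s.trySplit Δ (mkBag W c.name t) (L.map (mkBag W c.name))
        (List.ofFn (fun i => (u i : Node W))) →
      s' = s ∨ (∃ c' L' E', QueueInv T δ c' L' E' s') ∧ s'.weight < s.weight) ∧
    (Δ < (mkBag W c.name t).nodes.card →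
      ∃ u : Fin Δ ↪ ↥((mkBag W c.name t).nodes.erase (mkBag W c.name t).rep),
        (s.trySplit Δ (mkBag W c.name t) (L.map (mkBag W c.name))
          (List.ofFn (fun i => (u i : Node W)))).weight < s.weight) := by
  classical
  have h := hR.isTreeMetric hT
  have htok := hI.piece t (by simp)
  have key : ∀ xs : List V, xs.length = Δ → (∀ x ∈ xs, x ∈ inner W t) →
      ∃ c' L' E' S, RoundResult T δ c t.1 t.2 xs c' L' E' S
        (splitRound s.oracle (mkBag W c.name t) (xs.map c.name)) := fun xs _ hxs => by
    rw [hI.oracle]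
    exact splitRound_spec hT hR hW hI.valid htok xs fun x hx =>
      ⟨Finset.mem_of_mem_erase (Finset.mem_inter.1 (hxs x hx)).1, (Finset.mem_inter.1 (hxs x hx)).2⟩
  have hne : ∀ xs : List V, xs.length = Δ → xs ≠ [] := fun xs hxs e => by simp [e] at hxs; omega
  constructor
  · rintro u s' rfl
    obtain ⟨xs, e, hlen, hxs⟩ := exists_sample_list hI.valid htok u
    obtain ⟨c', L', E', S, hr⟩ := key xs hlen hxs
    rw [e]
    obtain ⟨hI', hw⟩ := hI.split_step hxs (hne xs hlen) hr
    unfold State.trySplit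
    dsimp only
    split_ifs with hcond
    · exact Or.inr ⟨⟨_, _, _, hI'⟩, hw⟩
    · exact Or.inl rfl
  · intro hcard
    have hcardB := htok.card_nodes hI.valid
    obtain ⟨hq, hn⟩ := floor_bound hΔ hcard
    have hfloor := Nat.floor_le (a := ((mkBag W c.name t).nodes.card : ℝ) / Real.sqrt Δ)
      (by positivity)
    set q := ⌊((mkBag W c.name t).nodes.card : ℝ) / Real.sqrt Δ⌋₊
    obtain ⟨G, hGA, hGc, hG⟩ := exists_good_sample h (inner W t) t.2 (Δ := Δ) hq (by omega)
      (by omega)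
    let e := G.equivFinOfCardEq hGc
    have hmem : ∀ i, c.name (e.symm i) ∈
        (mkBag W c.name t).nodes.erase (mkBag W c.name t).rep := fun i => by
      rw [htok.erase_nodes hI.valid]
      exact Finset.mem_image_of_mem _ (hGA (e.symm i).2)
    have hinW : ∀ x ∈ inner W t, x ∈ c.named := fun x hx =>
      hI.valid.sub (Finset.mem_inter.1 hx).2
    let u : Fin Δ ↪ ↥((mkBag W c.name t).nodes.erase (mkBag W c.name t).rep) :=
      ⟨fun i => ⟨c.name (e.symm i), hmem i⟩, fun i j hij => by
        have := hI.valid.inj (hinW _ (hGA (e.symm i).2)) (hinW _ (hGA (e.symm j).2))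
          (congrArg Subtype.val hij)
        exact e.symm.injective (Subtype.ext this)⟩
    refine ⟨u, ?_⟩
    obtain ⟨xs, exs, hlen, hxs⟩ := exists_sample_list hI.valid htok u
    obtain ⟨c', L', E', S, hr⟩ := key xs hlen hxs
    have hGxs : ∀ x ∈ G, x ∈ xs := fun x hx => by
      have h1 : c.name x ∈ List.ofFn (fun i => (u i : Node W)) := by
        rw [List.mem_ofFn']
        exact ⟨e ⟨x, hx⟩, by
          change c.name (e.symm (e ⟨x, hx⟩)) = c.name x
          rw [Equiv.symm_apply_apply]⟩
      rw [exs] at h1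
      obtain ⟨x', hx', e'⟩ := List.mem_map.1 h1
      exact hI.valid.inj (hinW _ (hxs x' hx')) (hinW _ (hGA hx)) e' ▸ hx'
    rw [exs]
    obtain ⟨hI', hw⟩ := hI.split_step hxs (hne xs hlen) hr
    unfold State.trySplit
    dsimp only
    rw [if_pos]
    · exact hw
    intro B' hB'
    rw [hr.bags] at hB'
    obtain ⟨t', ht', rfl⟩ := List.mem_map.1 hB'
    refine le_trans ?_ hfloor
    rw [(hr.piece t' ht').card_nodes hr.valid]
    norm_cast
    -- A bag with more than `q` nodes has at least `q` besides its representative, all below the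
    -- neck `z`. Then a sampled node is below `z`, and closure toward the root puts `z` into `S`,
    -- which the piece avoids.
    by_contra hlt
    obtain ⟨z, hz, hzb⟩ := hr.neck t' ht'
    obtain ⟨x, hx, hxz⟩ := hG z (by
      have : inner W t' ⊆ (inner W t).filter (fun y => Btw δ y z t.2) := fun y hy => by
        have hy' := Finset.mem_inter.1 hy
        refine Finset.mem_filter.2 ⟨Finset.mem_inter.2 ⟨Finset.mem_erase.2 ⟨?_,
          hr.subset t' ht' (Finset.mem_of_mem_erase hy'.1)⟩, hy'.2⟩, hzb y hy'.1⟩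
        rintro rfl
        exact hr.avoid t' ht' _ hy'.1 hr.root
      have := Finset.card_le_card this
      omega)
    exact hr.avoid t' ht' z hz (hr.closed x (hr.sample x (hGxs x hx)) z hxz)

end Step

/-! ### Expectations of functions of the state -/

section Expectation

/-- The expectation of `g` under the law `μ`. -/
noncomputable def expect {α : Type*} (μ : PMF α) (g : α → ℝ≥0∞) : ℝ≥0∞ := ∑' a, μ a * g a

theorem expect_pure {α : Type*} (a : α) (g : α → ℝ≥0∞) : expect (PMF.pure a) g = g a := by
  classical
  unfold expect
  rw [tsum_eq_single a]
  · simp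
  · intro b hb
    simp [PMF.pure_apply, hb]

theorem expect_bind {α β : Type*} (μ : PMF α) (f : α → PMF β) (g : β → ℝ≥0∞) :
    expect (μ.bind f) g = expect μ (fun a => expect (f a) g) := by
  unfold expect
  simp only [PMF.bind_apply, ← ENNReal.tsum_mul_right, ← ENNReal.tsum_mul_left]
  rw [ENNReal.tsum_comm]
  simp only [mul_assoc]

theorem expect_map {α β : Type*} (μ : PMF α) (f : α → β) (g : β → ℝ≥0∞) :
    expect (μ.map f) g = expect μ (fun a => g (f a)) := by
  rw [← PMF.bind_pure_comp, expect_bind]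
  simp only [Function.comp_apply, expect_pure]

theorem expect_mono {α : Type*} (μ : PMF α) {g g' : α → ℝ≥0∞} (h : ∀ a ∈ μ.support, g a ≤ g' a) :
    expect μ g ≤ expect μ g' := by
  refine ENNReal.tsum_le_tsum fun a => ?_
  by_cases ha : a ∈ μ.support
  · gcongr; exact h a ha
  · rw [PMF.mem_support_iff, not_not] at ha
    simp [ha]

theorem expect_const_mul {α : Type*} (μ : PMF α) (g : α → ℝ≥0∞) (k : ℝ≥0∞) :
    expect μ (fun a => k * g a) = k * expect μ g := by
  unfold expect
  rw [← ENNReal.tsum_mul_left]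
  simp only [mul_left_comm]

theorem expect_uniform {α : Type*} [Fintype α] [Nonempty α] (g : α → ℕ) :
    expect (PMF.uniformOfFintype α) (fun a => (g a : ℝ≥0∞)) =
      ((∑ a, g a : ℕ) : ℝ≥0∞) / (Fintype.card α : ℕ) := by
  unfold expect
  rw [tsum_fintype]
  simp only [PMF.uniformOfFintype_apply]
  rw [← Finset.mul_sum, Nat.cast_sum, div_eq_mul_inv, mul_comm]

/-- Here `a` is the sum of `K` values that are at most `m` and not all equal to `m`. Their mean is
at most `m - 1/K`, and `1/K ≥ m/C`. -/
theorem div_le_contraction {C K m a : ℕ} (hK : 0 < K) (hC : K * m ≤ C) (hC0 : 0 < C)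
    (ha : a + 1 ≤ K * m) :
    (a : ℝ≥0∞) / (K : ℕ) ≤ (((C - 1 : ℕ) : ℝ≥0∞) / (C : ℕ)) * (m : ℕ) := by
  have h1 : a * C ≤ (C - 1) * m * K := by
    obtain ⟨C, rfl⟩ : ∃ C', C = C' + 1 := ⟨C - 1, by omega⟩
    simp only [Nat.add_sub_cancel]
    have h2 : a ≤ K * m - 1 := by omega
    calc a * (C + 1) = a * C + a := by ring
      _ ≤ a * C + C := by omega
      _ = (a + 1) * C := by ring
      _ ≤ (K * m) * C := Nat.mul_le_mul_right _ ha
      _ = _ := by ring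
  have hK' : (K : ℝ≥0∞) ≠ 0 := by exact_mod_cast hK.ne'
  have hC' : (C : ℝ≥0∞) ≠ 0 := by exact_mod_cast hC0.ne'
  rw [ENNReal.div_le_iff hK' (ENNReal.natCast_ne_top K), ENNReal.mul_div_right_comm.symm,
    ENNReal.mul_div_right_comm.symm, ENNReal.le_div_iff_mul_le (Or.inl hC')
    (Or.inl (ENNReal.natCast_ne_top C))]
  exact_mod_cast h1

end Expectation

/-! ### Correctness and termination -/

section Run

variable {V : Type*} [DecidableEq V] {W : Finset V} {T : SimpleGraph V} {δ : V → V → ℝ}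

/-- The state `s` satisfies the invariants of the algorithm. -/
def StateInv (T : SimpleGraph V) (δ : V → V → ℝ) (s : State W) : Prop :=
  ∃ c L E, QueueInv T δ c L E s

/-- A bound for the inverse of the probability that a step makes progress. -/
def progressBound (n w Δ : ℕ) : ℕ := (n ^ Δ + 1) * (w + 1)

/-- A step never raises the weight, and at least one of its equally likely outcomes lowers it. There
are at most `n ^ Δ` samples and the weight is at most `W.card`, so the mean shrinks by a fixed
factor below one. -/
theorem step_spec [Fintype V] (hT : T.IsTree) {ℓ : Sym2 V → ℝ}
    (hR : RealizesOn T Set.univ ℓ δ) (hW : ∀ v, (T.neighborSet v).ncard ≤ 2 → v ∈ (W : Set V))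
    {Δ : ℕ} (hΔ : 0 < Δ) {s : State W} (hs : StateInv T δ s) :
    (∀ s' ∈ (State.step Δ s).support, StateInv T δ s') ∧
    expect (State.step Δ s) (fun s' => (s'.weight : ℝ≥0∞)) ≤
      (((progressBound (Fintype.card V) W.card Δ - 1 : ℕ) : ℝ≥0∞) /
        (progressBound (Fintype.card V) W.card Δ : ℕ)) * (s.weight : ℕ) := by
  classical
  obtain ⟨c, L, E, hI⟩ := hs
  have hw := hI.weight_le
  set C := progressBound (Fintype.card V) W.card Δ with hC
  have hC0 : 0 < C := by rw [hC]; unfold progressBound; positivity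
  have hC1 : ∀ K, K ≤ Fintype.card V ^ Δ + 1 → K * s.weight ≤ C := fun K hK =>
    Nat.mul_le_mul hK (hw.trans (Nat.le_succ _))
  cases L with
  | nil =>
    have hq : s.queue = [] := hI.queue
    have hstep : State.step Δ s = PMF.pure s := by unfold State.step; rw [hq]
    rw [hstep]
    refine ⟨fun s' hs' => ?_, ?_⟩
    · rw [PMF.mem_support_pure_iff] at hs'
      exact ⟨c, [], E, hs' ▸ hI⟩
    · rw [expect_pure]
      simp [State.weight, hq]
  | cons t L =>
    have htok := hI.piece t (by simp)
    have hq : s.queue = mkBag W c.name t :: L.map (mkBag W c.name) := hI.queue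
    by_cases hcard : (mkBag W c.name t).nodes.card ≤ Δ
    · have hstep : State.step Δ s = PMF.pure
          { queue := L.map (mkBag W c.name)
            skel := s.skel ∪ (findFullSkeleton s.oracle (mkBag W c.name t).nodes).1
            oracle := { s.oracle with
              next := (findFullSkeleton s.oracle (mkBag W c.name t).nodes).2 } } := by
        unfold State.step
        rw [hq]
        simp only [if_pos hcard]
      obtain ⟨c', E', hI', hlt⟩ := hI.small_step hT hR hW _ rfl
      rw [hstep]
      refine ⟨fun s' hs' => ?_, ?_⟩
      · rw [PMF.mem_support_pure_iff] at hs'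
        exact ⟨c', L, E', hs' ▸ hI'⟩
      · rw [expect_pure]
        have := div_le_contraction (K := 1) one_pos (hC1 1 (by simp)) hC0
          (by rw [one_mul]; exact hlt)
        simpa using this
    · rw [not_le] at hcard
      obtain ⟨h1, h2⟩ := hI.trySplit_spec hT hR hW hΔ
      obtain ⟨u₀, hu₀⟩ := h2 hcard
      have hne : Nonempty (Fin Δ ↪ ↥((mkBag W c.name t).nodes.erase (mkBag W c.name t).rep)) :=
        ⟨u₀⟩
      have hstep : State.step Δ s = (PMF.uniformOfFintype
          (Fin Δ ↪ ↥((mkBag W c.name t).nodes.erase (mkBag W c.name t).rep))).map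
          (fun u => s.trySplit Δ (mkBag W c.name t) (L.map (mkBag W c.name))
            (List.ofFn (fun i => (u i : Node W)))) := by
        unfold State.step
        rw [hq]
        simp only [if_neg (not_le.2 hcard), dif_pos hne]
      rw [hstep]
      refine ⟨fun s' hs' => ?_, ?_⟩
      · obtain ⟨u, -, rfl⟩ := (PMF.mem_support_map_iff _ _ _).1 hs'
        rcases h1 u _ rfl with e | ⟨hI', -⟩
        · rw [e]; exact ⟨c, _, E, hI⟩
        · exact hI'
      · rw [expect_map, expect_uniform (fun u : Fin Δ ↪
          ↥((mkBag W c.name t).nodes.erase (mkBag W c.name t).rep) => (s.trySplit Δ (mkBag W c.name t)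
          (L.map (mkBag W c.name)) (List.ofFn (fun i => (u i : Node W)))).weight)]
        refine div_le_contraction Fintype.card_pos (hC1 _ ?_) hC0 ?_
        · rw [Fintype.card_embedding_eq, Fintype.card_coe, Fintype.card_fin]
          refine (Nat.descFactorial_le_pow _ _).trans ((Nat.pow_le_pow_left ?_ _).trans
            (Nat.le_succ _))
          rw [htok.erase_nodes hI.valid]
          exact Finset.card_image_le.trans (Finset.card_le_univ _)
        · rw [Nat.succ_le_iff, ← smul_eq_mul, ← Finset.card_univ, ← Finset.sum_const]
          refine Finset.sum_lt_sum (fun u _ => ?_) ⟨u₀, Finset.mem_univ _, hu₀⟩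
          rcases h1 u _ rfl with e | ⟨-, hlt⟩
          · rw [e]
          · exact hlt.le

theorem run_support [Fintype V] (hT : T.IsTree) {ℓ : Sym2 V → ℝ}
    (hR : RealizesOn T Set.univ ℓ δ) (hW : ∀ v, (T.neighborSet v).ncard ≤ 2 → v ∈ (W : Set V))
    {Δ : ℕ} (hΔ : 0 < Δ) {d : W → W → ℝ} {u : W}
    (h0 : StateInv T δ (State.init d u)) (t : ℕ) :
    ∀ s ∈ (run Δ d u t).support, StateInv T δ s := by
  induction t with
  | zero =>
    intro s hs
    rw [run, PMF.mem_support_pure_iff] at hs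
    exact hs ▸ h0
  | succ t ih =>
    intro s hs
    rw [run, PMF.mem_support_bind_iff] at hs
    obtain ⟨s₀, hs₀, hs⟩ := hs
    exact (step_spec hT hR hW hΔ (ih s₀ hs₀)).1 s hs

theorem run_expect [Fintype V] (hT : T.IsTree) {ℓ : Sym2 V → ℝ}
    (hR : RealizesOn T Set.univ ℓ δ) (hW : ∀ v, (T.neighborSet v).ncard ≤ 2 → v ∈ (W : Set V))
    {Δ : ℕ} (hΔ : 0 < Δ) {d : W → W → ℝ} {u : W}
    (h0 : StateInv T δ (State.init d u)) (t : ℕ) :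
    expect (run Δ d u t) (fun s => (s.weight : ℝ≥0∞)) ≤
      (((progressBound (Fintype.card V) W.card Δ - 1 : ℕ) : ℝ≥0∞) /
        (progressBound (Fintype.card V) W.card Δ : ℕ)) ^ t * (State.init d u).weight := by
  induction t with
  | zero => rw [run, expect_pure]; simp
  | succ t ih =>
    rw [run, expect_bind, pow_succ', mul_assoc]
    refine (expect_mono _ fun s hs =>
      (step_spec hT hR hW hΔ (run_support hT hR hW hΔ h0 t s hs)).2).trans ?_
    rw [expect_const_mul]
    gcongr

/-- A reachable state that has not halted has weight at least one, so its probability is at most the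
expected weight, which tends to zero. -/
theorem tendsto_halted [Fintype V] (hT : T.IsTree) {ℓ : Sym2 V → ℝ}
    (hR : RealizesOn T Set.univ ℓ δ) (hW : ∀ v, (T.neighborSet v).ncard ≤ 2 → v ∈ (W : Set V))
    {Δ : ℕ} (hΔ : 0 < Δ) {d : W → W → ℝ} {u : W}
    (h0 : StateInv T δ (State.init d u)) :
    Tendsto (fun t => (run Δ d u t).toOuterMeasure {s | s.Halted}) atTop (𝓝 1) := by
  classical
  set C := progressBound (Fintype.card V) W.card Δ with hC
  have hC0 : 0 < C := by rw [hC]; unfold progressBound; positivity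
  set q : ℝ≥0∞ := ((C - 1 : ℕ) : ℝ≥0∞) / (C : ℕ) with hq
  have hq1 : q < 1 := by
    rw [hq, ENNReal.div_lt_iff (Or.inl (by exact_mod_cast hC0.ne'))
      (Or.inl (ENNReal.natCast_ne_top C)), one_mul]
    exact_mod_cast (by omega : C - 1 < C)
  have hbound : ∀ t, 1 - q ^ t * (State.init d u).weight ≤
      (run Δ d u t).toOuterMeasure {s | s.Halted} := by
    intro t
    rw [tsub_le_iff_right]
    have h1 : (run Δ d u t).toOuterMeasure {s | ¬ s.Halted} ≤
        q ^ t * (State.init d u).weight := by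
      refine le_trans ?_ (run_expect hT hR hW hΔ h0 t)
      rw [PMF.toOuterMeasure_apply]
      refine ENNReal.tsum_le_tsum fun s => ?_
      by_cases hs : s.Halted
      · simp [Set.indicator, hs]
      · simp only [Set.indicator, Set.mem_ofPred_eq, hs, not_false_eq_true, if_true]
        by_cases hsup : s ∈ (run Δ d u t).support
        · obtain ⟨c, L, E, hI⟩ := run_support hT hR hW hΔ h0 t s hsup
          have : (1 : ℝ≥0∞) ≤ s.weight := by exact_mod_cast hI.weight_pos hs
          calc run Δ d u t s = run Δ d u t s * 1 := (mul_one _).symm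
            _ ≤ _ := by gcongr
        · rw [PMF.mem_support_iff, not_not] at hsup
          simp [hsup]
    calc (1 : ℝ≥0∞) = (run Δ d u t).toOuterMeasure Set.univ :=
          ((PMF.toOuterMeasure_apply_eq_one_iff _ _).2 (Set.subset_univ _)).symm
      _ = (run Δ d u t).toOuterMeasure ({s | s.Halted} ∪ {s | ¬ s.Halted}) := by
          congr 1; ext s; simp [em]
      _ ≤ _ := measure_union_le _ _
      _ ≤ _ := by gcongr
  refine tendsto_of_tendsto_of_tendsto_of_le_of_le ?_ tendsto_const_nhds hbound fun t => ?_
  · have h2 : Tendsto (fun t => q ^ t * ((State.init d u).weight : ℝ≥0∞)) atTop (𝓝 0) := by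
      have := ENNReal.Tendsto.mul_const (ENNReal.tendsto_pow_atTop_nhds_zero_of_lt_one hq1)
        (Or.inr (ENNReal.natCast_ne_top (State.init d u).weight))
      simpa using this
    have h3 := ENNReal.Tendsto.sub (tendsto_const_nhds (x := (1 : ℝ≥0∞))) h2
      (Or.inl ENNReal.one_ne_top)
    simpa using h3
  · calc (run Δ d u t).toOuterMeasure {s | s.Halted} ≤ (run Δ d u t).toOuterMeasure Set.univ :=
          measure_mono (Set.subset_univ _)
      _ = 1 := (PMF.toOuterMeasure_apply_eq_one_iff _ _).2 (Set.subset_univ _)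

/-- A second node is needed: the bag of a one-node tree contains no label besides its
representative, against `PieceOK.label`. -/
theorem init_inv [Fintype V] (h : IsTreeMetric T δ)
    (hW : ∀ v, (T.neighborSet v).ncard ≤ 2 → v ∈ (W : Set V)) {d : W → W → ℝ}
    (hd : ∀ i j : W, d i j = δ i j) (u : W) (hV : ∃ y : V, y ≠ u) :
    StateInv T δ (State.init d u) := by
  have hX : IsPiece T Finset.univ (u : V) := ⟨Finset.mem_univ _, fun _ _ _ _ _ => Finset.mem_univ _⟩
  set c : Config W := ⟨fun v => if hv : v ∈ W then Sum.inl ⟨v, hv⟩ else Sum.inr 0, W,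
    Oracle.init d⟩ with hc
  have hname : ∀ v (hv : v ∈ W), c.name v = Sum.inl ⟨v, hv⟩ := fun v hv => dif_pos hv
  have hcore : core W Finset.univ (u : V) = W := by
    ext x
    simp only [mem_core, Finset.mem_univ, true_and]
    constructor
    · rintro (hx | rfl)
      exacts [hx, u.2]
    · exact Or.inl
  have hvalid : c.Valid := by
    refine ⟨subset_rfl, fun w => hname w w.2, ?_, ?_⟩
    · intro x hx y hy e
      rw [hname x hx, hname y hy] at e
      exact congrArg Subtype.val (Sum.inl.inj e)
    · intro x hx n e
      rw [hname x hx] at e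
      cases e
  have hok : PieceOK T δ c (Finset.univ, (u : V)) := by
    refine ⟨hX, ⟨u.2, ?_⟩, fun x _ hx _ => hx, ?_⟩
    · rw [hcore]
      intro x hx y hy
      rw [hname x hx, hname y hy]
      exact hd ⟨x, hx⟩ ⟨y, hy⟩
    · obtain ⟨y, hy⟩ := hV
      exact hX.exists_label h hW (Finset.mem_univ y) hy
  refine ⟨c, [(Finset.univ, (u : V))], ∅, hvalid, ?_, rfl, ?_, by simp, by simpa using hok, by simp,
    fun x => ?_, fun x y hxy => ?_⟩
  · simp only [State.init, List.map_cons, List.map_nil, mkBag, hcore, List.cons.injEq, and_true]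
    rw [hname u u.2]
    congr 1
    ext v
    simp only [Finset.mem_image, Finset.mem_univ, true_and]
    constructor
    · rintro ⟨w, rfl⟩
      exact ⟨w, w.2, hname w w.2⟩
    · rintro ⟨w, hw, rfl⟩
      exact ⟨⟨w, hw⟩, (hname w hw).symm⟩
  · simp [State.init]
  · by_cases hxu : x = u
    · exact Or.inl (hxu ▸ u.2)
    · exact Or.inr ⟨_, List.mem_singleton.2 rfl, Finset.mem_erase.2 ⟨hxu, Finset.mem_univ _⟩⟩
  · right
    refine ⟨_, List.mem_singleton.2 rfl, ?_⟩
    by_cases hxu : x = u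
    · exact Or.inr (Finset.mem_erase.2 ⟨fun e => hxy.ne (hxu.trans e.symm), Finset.mem_univ _⟩)
    · exact Or.inl (Finset.mem_erase.2 ⟨hxu, Finset.mem_univ _⟩)

/-- A tree with a single node is recovered at once. -/
theorem recovers_of_subsingleton [Fintype V] [Subsingleton V] [DecidableRel T.Adj]
    (d : W → W → ℝ) : AlgorithmRecovers T W d := by
  classical
  have hdeg : T.maxDegree = 0 := by
    refine Nat.le_zero.1 (T.maxDegree_le_of_forall_degree_le 0 fun v => ?_)
    rw [Nat.le_zero, SimpleGraph.degree, Finset.card_eq_zero]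
    ext w
    simp only [SimpleGraph.mem_neighborFinset, Finset.notMem_empty, iff_false]
    exact fun hvw => hvw.ne (Subsingleton.elim _ _)
  intro u
  have hedge : T.edgeSet = ∅ := by
    ext e
    induction e with
    | _ x y =>
      simp only [SimpleGraph.mem_edgeSet, Set.mem_empty_iff_false, iff_false]
      exact fun hxy => hxy.ne (Subsingleton.elim _ _)
  have hmemW : ∀ v : V, v ∈ W := fun v => Subsingleton.elim (u : V) v ▸ u.2
  have hskel : ∀ s : State W, s.skel = ∅ → IsSkeletonOf T W s.skel := by
    intro s hs
    refine ⟨⟨fun v => Sum.inl ⟨v, hmemW v⟩, fun x y _ => Subsingleton.elim _ _⟩, fun w => rfl, ?_⟩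
    rw [hs, hedge]
    simp
  have hBag : (Finset.univ.image (Sum.inl : W → Node W)) = {Sum.inl u} := by
    ext v
    simp only [Finset.mem_image, Finset.mem_univ, true_and, Finset.mem_singleton]
    constructor
    · rintro ⟨w, rfl⟩
      exact congrArg _ (Subsingleton.elim _ _)
    · rintro rfl
      exact ⟨u, rfl⟩
  set s₁ : State W := { queue := [], skel := ∅, oracle := Oracle.init d } with hs₁
  have hstep0 : State.step 0 (State.init d u) = PMF.pure s₁ := by
    -- For `Δ = 0` even a bag of one node counts as large. The only sample is empty, `explode`
    -- returns no bag, and the size test holds vacuously, whatever the value of the division by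
    -- `√0`.
    have htry : ∀ us, us = [] → (State.init d u).trySplit 0 ⟨Finset.univ.image Sum.inl, Sum.inl u⟩ [] us = s₁ := by
      rintro us rfl
      have hexp : explode (Oracle.init d).dist ⟨Finset.univ.image Sum.inl, Sum.inl u⟩ = [] := by
        unfold explode
        dsimp only
        rw [hBag]
        simp [explodeLoop]
      have hround : splitRound (Oracle.init d) ⟨Finset.univ.image Sum.inl, Sum.inl u⟩ [] =
          { bags := [], skel := ∅, oracle := Oracle.init d } := by
        unfold splitRound
        simp only [List.foldl_nil, List.flatMap_cons, List.flatMap_nil, hexp, List.append_nil]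
      have ho : (State.init d u).oracle = Oracle.init d := rfl
      unfold State.trySplit
      dsimp only
      rw [ho, hround, if_pos (by simp)]
      simp [State.init, hs₁]
    unfold State.step
    simp only [State.init]
    rw [if_neg (by rw [hBag]; simp)]
    rw [dif_pos ⟨⟨fun i => i.elim0, fun i => i.elim0⟩⟩]
    refine (congrArg (fun f => PMF.map f _) (funext fun v => ?_)).trans (PMF.map_const _ s₁)
    exact htry _ (by simp)
  have hrun : ∀ t, run 0 d u (t + 1) = PMF.pure s₁ := by
    intro t
    induction t with
    | zero => rw [run, run, PMF.pure_bind, hstep0]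
    | succ t ih =>
      rw [run, ih, PMF.pure_bind]
      rfl
  rw [hdeg]
  refine ⟨fun t s hs hh => ?_, ?_⟩
  · cases t with
    | zero =>
      rw [run, PMF.mem_support_pure_iff] at hs
      subst hs
      exact hskel _ rfl
    | succ t =>
      rw [hrun, PMF.mem_support_pure_iff] at hs
      subst hs
      exact hskel _ rfl
  · refine tendsto_const_nhds.congr' ?_
    filter_upwards [eventually_ge_atTop 1] with t ht
    obtain ⟨t, rfl⟩ := Nat.exists_eq_add_of_le' ht
    rw [hrun, PMF.toOuterMeasure_pure_apply]
    simp [hs₁, State.Halted]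

/-- The algorithm recovers a semi-labelled tree from the path metric between its regular nodes. -/
theorem algorithmRecovers_of_realizes [Fintype V] [DecidableRel T.Adj]
    (hT : IsSemiLabelledTree T (W : Set V)) {ℓ : Sym2 V → ℝ} (hR : RealizesOn T Set.univ ℓ δ)
    {d : W → W → ℝ} (hd : ∀ i j : W, d i j = δ i j) : AlgorithmRecovers T W d := by
  rcases subsingleton_or_nontrivial V with hV | hV
  · exact recovers_of_subsingleton d
  have h := hR.isTreeMetric hT.1
  have hΔ : 0 < T.maxDegree := by
    obtain ⟨x, y, hxy⟩ := exists_pair_ne V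
    obtain ⟨z, hz, -⟩ := h.toward x y hxy
    refine lt_of_lt_of_le ?_ (T.degree_le_maxDegree x)
    rw [SimpleGraph.degree, Finset.card_pos]
    exact ⟨z, by simpa using hz⟩
  intro u
  have h0 := init_inv h hT.2 hd u (exists_ne _)
  refine ⟨fun t s hs hh => ?_, tendsto_halted hT.1 hR hT.2 hΔ h0⟩
  obtain ⟨c, L, E, hI⟩ := run_support hT.1 hR hT.2 hΔ h0 t s hs
  exact hI.isSkeletonOf hh

end Run

/-! ### Determinants of positive semidefinite matrices -/

section Determinants

variable {n : Type*} [Fintype n] [DecidableEq n] {A B : Matrix n n ℝ}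

/-- All eigenvalues lie in `[0, 1]`, and the determinant is their product. -/
theorem det_le_one_of_posSemidef (hA : A.PosSemidef) (h : (1 - A).PosSemidef) : A.det ≤ 1 := by
  rw [hA.isHermitian.det_eq_prod_eigenvalues]
  refine Finset.prod_le_one (fun i _ => by simpa using hA.eigenvalues_nonneg i) fun i _ => ?_
  have h1 := h.re_dotProduct_nonneg (WithLp.ofLp (hA.isHermitian.eigenvectorBasis i))
  have h2 : (star (WithLp.ofLp (hA.isHermitian.eigenvectorBasis i))) ⬝ᵥ
      (WithLp.ofLp (hA.isHermitian.eigenvectorBasis i)) = (1 : ℝ) := by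
    have := EuclideanSpace.inner_eq_star_dotProduct (hA.isHermitian.eigenvectorBasis i)
      (hA.isHermitian.eigenvectorBasis i)
    rw [dotProduct_comm, ← this, real_inner_self_eq_norm_sq,
      hA.isHermitian.eigenvectorBasis.orthonormal.1 i, one_pow]
  rw [Matrix.sub_mulVec, Matrix.one_mulVec, dotProduct_sub, h2] at h1
  have h3 := hA.isHermitian.eigenvalues_eq i
  simp only [RCLike.re_to_real] at h1 h3
  simp only [RCLike.ofReal_real_eq_id, id_eq]
  linarith

theorem PosSemidef.isUnit_det_sqrt (hA : A.PosSemidef) (hu : IsUnit A.det) :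
    IsUnit (CFC.sqrt A).det := by
  have h : (CFC.sqrt A).det * (CFC.sqrt A).det = A.det := by
    rw [← Matrix.det_mul, CFC.sqrt_mul_sqrt_self A hA.nonneg]
  exact isUnit_of_mul_isUnit_left (h ▸ hu)

/-- Conjugation with the inverse square root of `B` reduces to the case `B = 1`. -/
theorem PosSemidef.det_le_det (hA : A.PosSemidef) (hB : B.PosSemidef) (hu : IsUnit B.det)
    (h : (B - A).PosSemidef) : A.det ≤ B.det := by
  set S := CFC.sqrt B with hS
  have hSu : IsUnit S.det := PosSemidef.isUnit_det_sqrt hB hu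
  have hSS : S * S = B := CFC.sqrt_mul_sqrt_self B hB.nonneg
  have hSh : S.IsHermitian := (Matrix.nonneg_iff_posSemidef.1 (CFC.sqrt_nonneg B)).isHermitian
  have hTh : (S⁻¹).conjTranspose = S⁻¹ := hSh.inv
  have h1 : (S⁻¹ * A * S⁻¹).PosSemidef := by
    have h3 := hA.mul_mul_conjTranspose_same S⁻¹
    rwa [hTh] at h3
  have h2 : (1 - S⁻¹ * A * S⁻¹).PosSemidef := by
    have h3 := h.mul_mul_conjTranspose_same S⁻¹
    rw [hTh, Matrix.mul_sub, Matrix.sub_mul, ← hSS, ← Matrix.mul_assoc S⁻¹ S S,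
      Matrix.nonsing_inv_mul _ hSu, Matrix.one_mul, Matrix.mul_nonsing_inv _ hSu] at h3
    exact h3
  have h4 := det_le_one_of_posSemidef h1 h2
  rw [Matrix.det_mul, Matrix.det_mul, Matrix.det_nonsing_inv, Ring.inverse_eq_inv'] at h4
  have h5 : S.det * S.det = B.det := by rw [← Matrix.det_mul, hSS]
  have h6 : S.det ≠ 0 := hSu.ne_zero
  have h7 : 0 < B.det := by rw [← h5]; exact mul_self_pos.2 h6
  have h8 : S.det⁻¹ * A.det * S.det⁻¹ = A.det / B.det := by rw [← h5]; field_simp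
  rw [h8, div_le_one h7] at h4
  exact h4

end Determinants

/-! ### Covariance matrices -/

section Covariance

variable {Ω : Type*} [MeasurableSpace Ω] {P : Measure Ω} [IsProbabilityMeasure P] {k : ℕ}

/-- The quadratic form at `x` is the variance of `∑ x i * X i`. -/
theorem posSemidef_covariance {X : Fin k → Ω → ℝ} (hX : ∀ i, MemLp (X i) 2 P) :
    (Matrix.of fun i j => cov[X i, X j; P] : Matrix (Fin k) (Fin k) ℝ).PosSemidef := by
  refine Matrix.PosSemidef.of_dotProduct_mulVec_nonneg ?_ fun x => ?_
  · ext i j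
    simp [covariance_comm]
  · have h : cov[fun ω => ∑ i, x i * X i ω, fun ω => ∑ i, x i * X i ω; P] =
        star x ⬝ᵥ (Matrix.of fun i j => cov[X i, X j; P] : Matrix (Fin k) (Fin k) ℝ).mulVec x := by
      rw [covariance_fun_sum_fun_sum (fun i => (hX i).const_mul _) (fun i => (hX i).const_mul _)]
      simp only [covariance_const_mul_left, covariance_const_mul_right, dotProduct, Matrix.mulVec,
        Matrix.of_apply, Finset.mul_sum, star_trivial]
      exact Finset.sum_congr rfl fun i _ => Finset.sum_congr rfl fun j _ => by ring
    rw [← h, covariance_self]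
    · exact variance_nonneg _ _
    · exact (memLp_finsetSum _ fun i _ => (hX i).const_mul (x i)).aestronglyMeasurable.aemeasurable

end Covariance

/-! ### Conditional independence from a factorizing density -/

section Marginals

variable {V E : Type*} [DecidableEq V] [MeasurableSpace E] (μ : V → Measure E)
  {f g : (V → E) → ℝ≥0∞} {C D : Finset V} {s : Set V}

theorem dependsOn_lmarginal (hf : DependsOn f s) : DependsOn (∫⋯∫⁻_C, f ∂μ) (s \ C) := by
  intro x y hxy
  unfold lmarginal
  refine lintegral_congr fun z => hf fun i hi => ?_
  by_cases hiC : i ∈ C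
  · simp [Function.updateFinset, hiC]
  · simpa [Function.updateFinset, hiC] using hxy i ⟨hi, hiC⟩

theorem lmarginal_mul_of_dependsOn (hf : Measurable f) (hg : DependsOn g s)
    (hs : Disjoint s (C : Set V)) (y : V → E) :
    (∫⋯∫⁻_C, (fun x => f x * g x) ∂μ) y = (∫⋯∫⁻_C, f ∂μ) y * g y := by
  unfold lmarginal
  have hm : Measurable fun z : (i : C) → E => f (Function.updateFinset y C z) :=
    hf.comp measurable_updateFinset
  rw [← lintegral_mul_const _ hm]
  refine lintegral_congr fun z => ?_
  change f _ * g _ = f _ * g _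
  refine congrArg _ (hg fun i hi => ?_)
  have : i ∉ C := fun h => Set.disjoint_left.1 hs hi h
  simp [Function.updateFinset, this]

variable [Fintype V] [∀ v, SigmaFinite (μ v)] {v : V}

/-- Tonelli: with the coordinate `v` fixed, `f` involves only coordinates in `C` and `g` only the
remaining ones, so the inner integral is a product. -/
theorem lintegral_mul_eq_of_dependsOn (hf : Measurable f) (hg : Measurable g)
    (hv : v ∉ C) (hfd : DependsOn f (insert v (C : Set V))) (hgd : DependsOn g (C : Set V)ᶜ)
    (y : V → E) :
    ∫⁻ x, f x * g x ∂Measure.pi μ =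
      ∫⁻ z, (∫⋯∫⁻_C, f ∂μ) (Function.update y v z) *
        (∫⋯∫⁻_(Cᶜ.erase v), g ∂μ) (Function.update y v z) ∂μ v := by
  have hu : (Finset.univ : Finset V) = {v} ∪ (Cᶜ.erase v ∪ C) := by
    ext x
    by_cases h1 : x = v <;> by_cases h2 : x ∈ C <;> simp [h1, h2]
  have hd1 : Disjoint {v} (Cᶜ.erase v ∪ C) := by
    simp [hv]
  have hd2 : Disjoint (Cᶜ.erase v) C :=
    Finset.disjoint_of_subset_left (Finset.erase_subset _ _) disjoint_compl_left
  have hfg : Measurable fun x => f x * g x := hf.mul hg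
  rw [lintegral_eq_lmarginal_univ y, hu, lmarginal_union _ _ hfg hd1, lmarginal_singleton]
  refine lintegral_congr fun z => ?_
  rw [lmarginal_union _ _ hfg hd2]
  have h1 : (∫⋯∫⁻_C, (fun x => f x * g x) ∂μ) = fun x => g x * (∫⋯∫⁻_C, f ∂μ) x := by
    ext x
    rw [lmarginal_mul_of_dependsOn μ hf hgd disjoint_compl_left, mul_comm]
  rw [h1, lmarginal_mul_of_dependsOn μ hg (dependsOn_lmarginal μ hfd), mul_comm]
  rw [Set.disjoint_left]
  rintro x ⟨hx, hxC⟩ hx'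
  rcases hx with rfl | hx
  · simp at hx'
  · exact hxC hx

/-- If a density is a product of a function of the coordinates in `insert v C` and a function of
the coordinates outside `C`, then for integration against functions of the former coordinates,
a function of the latter coordinates can be replaced by a function of the coordinate `v`. -/
theorem exists_conditional [Nonempty E] {h ψ : (V → E) → ℝ≥0∞} (hg : Measurable g)
    (hh : Measurable h) (hψ : Measurable ψ) (hv : v ∉ C)
    (hgd : DependsOn g (insert v (C : Set V))) (hhd : DependsOn h (C : Set V)ᶜ)
    (hψd : DependsOn ψ (C : Set V)ᶜ) :
    ∃ φ : E → ℝ≥0∞, Measurable φ ∧ ∀ F : (V → E) → ℝ≥0∞, Measurable F →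
      DependsOn F (insert v (C : Set V)) → ∫⁻ y, (g y * h y) * F y ∂Measure.pi μ ≠ ∞ →
      ∫⁻ y, (g y * h y) * (F y * ψ y) ∂Measure.pi μ =
        ∫⁻ y, (g y * h y) * (F y * φ (y v)) ∂Measure.pi μ := by
  obtain ⟨e⟩ := ‹Nonempty E›
  set y₀ : V → E := fun _ => e
  set D := Cᶜ.erase v with hD
  set H := ∫⋯∫⁻_D, h ∂μ with hH
  set K := ∫⋯∫⁻_D, (fun y => h y * ψ y) ∂μ with hK
  have hHm : Measurable H := hh.lmarginal μ
  have hKm : Measurable K := (hh.mul hψ).lmarginal μ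
  have hup : Measurable fun z => Function.update y₀ v z := measurable_update y₀
  -- This ratio is the conditional expectation of `ψ` given the coordinate `v`. The marginals `K`
  -- and `H` depend on that coordinate alone, so the filler `y₀` is immaterial.
  refine ⟨fun z => K (Function.update y₀ v z) / H (Function.update y₀ v z),
    (hKm.comp hup).div (hHm.comp hup), fun F hF hFd hfin => ?_⟩
  set φ : E → ℝ≥0∞ := fun z => K (Function.update y₀ v z) / H (Function.update y₀ v z) with hφ
  have hφm : Measurable φ := (hKm.comp hup).div (hHm.comp hup)
  have hFg : Measurable fun y => F y * g y := hF.mul hg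
  have hFgd : DependsOn (fun y => F y * g y) (insert v (C : Set V)) := fun x y hxy => by
    simp only [hFd hxy, hgd hxy]
  have hhψd : DependsOn (fun y => h y * ψ y) (C : Set V)ᶜ := fun x y hxy => by
    simp only [hhd hxy, hψd hxy]
  have hφd : DependsOn (fun y : V → E => φ (y v)) {v} := fun x y hxy => by
    simp only [hxy v rfl]
  have hhφd : DependsOn (fun y => h y * φ (y v)) (C : Set V)ᶜ := fun x y hxy => by
    simp only [hhd hxy, hxy v hv]
  have hφvm : Measurable fun y : V → E => φ (y v) := hφm.comp (measurable_pi_apply v)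
  have e0 : ∫⁻ y, (g y * h y) * F y ∂Measure.pi μ = ∫⁻ y, (F y * g y) * h y ∂Measure.pi μ :=
    lintegral_congr fun y => by ring
  have e1 : ∫⁻ y, (g y * h y) * (F y * ψ y) ∂Measure.pi μ =
      ∫⁻ y, (F y * g y) * (h y * ψ y) ∂Measure.pi μ := lintegral_congr fun y => by ring
  have e2 : ∫⁻ y, (g y * h y) * (F y * φ (y v)) ∂Measure.pi μ =
      ∫⁻ y, (F y * g y) * (h y * φ (y v)) ∂Measure.pi μ := lintegral_congr fun y => by ring
  rw [e0, lintegral_mul_eq_of_dependsOn μ hFg hh hv hFgd hhd y₀] at hfin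
  have hhψ : Measurable fun y => h y * ψ y := hh.mul hψ
  have hhφ : Measurable fun y => h y * φ (y v) := hh.mul hφvm
  rw [e1, e2, lintegral_mul_eq_of_dependsOn μ hFg hhψ hv hFgd hhψd y₀,
    lintegral_mul_eq_of_dependsOn μ hFg hhφ hv hFgd hhφd y₀]
  have hae := ae_lt_top (((hFg.lmarginal μ).comp hup).mul (hHm.comp hup)) hfin
  refine lintegral_congr_ae ?_
  filter_upwards [hae] with z hz
  have hvD : Disjoint ({v} : Set V) (D : Set V) := by simp [hD]
  change _ * K _ = _
  rw [lmarginal_mul_of_dependsOn μ hh hφd hvD, Function.update_self]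
  change _ = _ * (H _ * _)
  simp only [hφ]
  set z' := Function.update y₀ v z
  -- The ratio is harmless where it degenerates: `H = 0` forces `K = 0`, and where `H = ∞`,
  -- finiteness of the integral makes the other factor vanish for almost every `z`.
  by_cases h0 : H z' = 0
  · have hK0 : K z' = 0 := by
      rw [hH] at h0
      unfold lmarginal at h0
      have hm₁ : Measurable fun x : (i : D) → E => h (Function.updateFinset z' D x) :=
        hh.comp measurable_updateFinset
      have hm₂ : Measurable fun x : (i : D) → E => h (Function.updateFinset z' D x) *
          ψ (Function.updateFinset z' D x) := hm₁.mul (hψ.comp measurable_updateFinset)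
      rw [lintegral_eq_zero_iff hm₁] at h0
      rw [hK]
      unfold lmarginal
      rw [lintegral_eq_zero_iff hm₂]
      filter_upwards [h0] with x hx
      simp only [Pi.zero_apply] at hx ⊢
      rw [hx, zero_mul]
    simp [hK0]
  · by_cases h1 : H z' = ∞
    · have hM : (∫⋯∫⁻_C, (fun y => F y * g y) ∂μ) z' = 0 := by
        by_contra hne
        simp only [Function.comp_apply, Pi.mul_apply] at hz
        change _ * H z' < ∞ at hz
        rw [h1, ENNReal.mul_top hne] at hz
        exact lt_irrefl _ hz
      rw [hM, zero_mul, zero_mul]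
    · rw [ENNReal.mul_div_cancel h0 h1]

end Marginals

/-! ### The Markov property of tree models -/

section Markov

/-- Let `C` be the component of `u` after deletion of the bridge `uv`. Only this edge crosses, and
it lies in `insert v C`. The walk `p` avoids `u`, so it does not use the bridge and keeps `w` on the
side of `v`. -/
theorem separating_set {V : Type*} {T : SimpleGraph V} (hT : T.IsAcyclic) {u v w : V}
    (huv : T.Adj u v) (p : T.Walk v w) (hp : u ∉ p.support) :
    ∃ C : Set V, u ∈ C ∧ v ∉ C ∧ w ∉ C ∧
      ∀ e ∈ T.edgeSet, {x | x ∈ e} ⊆ insert v C ∨ {x | x ∈ e} ⊆ Cᶜ := by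
  have hb : ¬ (T.deleteEdges {s(u, v)}).Reachable u v :=
    SimpleGraph.isBridge_iff.1 (SimpleGraph.isAcyclic_iff_forall_adj_isBridge.1 hT huv)
  refine ⟨{x | (T.deleteEdges {s(u, v)}).Reachable u x}, SimpleGraph.Reachable.refl _, hb,
    fun hw => ?_, ?_⟩
  · have hvw : (T.deleteEdges {s(u, v)}).Reachable v w := by
      refine ⟨p.toDeleteEdges {s(u, v)} fun e he h => ?_⟩
      rw [Set.mem_singleton_iff] at h
      subst h
      exact hp (p.fst_mem_support_of_mem_edges he)
    exact hb (SimpleGraph.Reachable.trans hw hvw.symm)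
  · intro e he
    induction e with | _ a b
    by_cases hab : s(a, b) = s(u, v)
    · left
      rw [hab]
      intro x hx
      rcases Sym2.mem_iff.1 hx with rfl | rfl
      · exact Or.inr (SimpleGraph.Reachable.refl _)
      · exact Or.inl rfl
    · have hadj : (T.deleteEdges {s(u, v)}).Adj a b := by
        rw [SimpleGraph.deleteEdges_adj]
        exact ⟨he, hab⟩
      by_cases ha : (T.deleteEdges {s(u, v)}).Reachable u a
      · left
        intro x hx
        rcases Sym2.mem_iff.1 hx with rfl | rfl
        · exact Or.inr ha
        · exact Or.inr (ha.trans hadj.reachable)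
      · right
        intro x hx
        rcases Sym2.mem_iff.1 hx with rfl | rfl
        · exact ha
        · exact fun h => ha (SimpleGraph.Reachable.trans h hadj.reachable.symm)

theorem dependsOn_prod {V E : Type*} {ψ : Sym2 V → (V → E) → ℝ≥0} {S : Finset (Sym2 V)}
    {s : Set V}
    (h : ∀ e ∈ S, DependsOn (ψ e) s) : DependsOn (fun y => ∏ e ∈ S, (ψ e y : ℝ≥0∞)) s :=
  fun _ _ hxy => Finset.prod_congr rfl fun e he => by rw [h e he hxy]

variable {V Ω : Type*} [Fintype V] [DecidableEq V] [MeasurableSpace Ω] {T : SimpleGraph V}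
  [DecidableRel T.Adj] {P : Measure Ω} {k : ℕ} {Y : V → Ω → Fin k → ℝ} {u v w : V}

/-- The bridge `uv` splits the density as in `exists_conditional`, and `φ` plays the part of the
conditional probability of `Y w ∈ s` given `Y v`. Since `φ` does not depend on `F`, it serves for
the positive and the negative part of a residual at once. -/
theorem Factorizes.markov (hT : T.IsAcyclic) (hY : ∀ v, Measurable (Y v)) (h : Factorizes T P Y)
    (huv : T.Adj u v) (p : T.Walk v w) (hp : u ∉ p.support) {s : Set (Fin k → ℝ)}
    (hs : MeasurableSet s) :
    ∃ φ : (Fin k → ℝ) → ℝ≥0∞, Measurable φ ∧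
      ∀ F : (Fin k → ℝ) × (Fin k → ℝ) → ℝ≥0∞, Measurable F →
        ∫⁻ ω, F (Y u ω, Y v ω) ∂P ≠ ∞ →
        ∫⁻ ω in Y w ⁻¹' s, F (Y u ω, Y v ω) ∂P = ∫⁻ ω, F (Y u ω, Y v ω) * φ (Y v ω) ∂P := by
  obtain ⟨μ, ψ, hμ, hψ, hP⟩ := h
  obtain ⟨C', huC, hvC, hwC, hC⟩ := separating_set hT huv p hp
  obtain ⟨C, rfl⟩ : ∃ C : Finset V, (C : Set V) = C' := ⟨C'.toFinite.toFinset, by simp⟩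
  classical
  set S₁ := T.edgeFinset.filter fun e => {x | x ∈ e} ⊆ insert v (C : Set V)
  set S₂ := T.edgeFinset.filter fun e => ¬ {x | x ∈ e} ⊆ insert v (C : Set V)
  set g : (V → Fin k → ℝ) → ℝ≥0∞ := fun y => ∏ e ∈ S₁, (ψ e y : ℝ≥0∞) with hg
  set h : (V → Fin k → ℝ) → ℝ≥0∞ := fun y => ∏ e ∈ S₂, (ψ e y : ℝ≥0∞) with hh
  have hmem₁ : ∀ e ∈ S₁, e ∈ T.edgeSet := fun e he =>
    SimpleGraph.mem_edgeFinset.1 (Finset.mem_filter.1 he).1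
  have hmem₂ : ∀ e ∈ S₂, e ∈ T.edgeSet := fun e he =>
    SimpleGraph.mem_edgeFinset.1 (Finset.mem_filter.1 he).1
  have hgm : Measurable g := Finset.measurable_prod _ fun e he =>
    measurable_coe_nnreal_ennreal.comp (hψ e (hmem₁ e he)).1
  have hhm : Measurable h := Finset.measurable_prod _ fun e he =>
    measurable_coe_nnreal_ennreal.comp (hψ e (hmem₂ e he)).1
  have hgd : DependsOn g (insert v (C : Set V)) := dependsOn_prod fun e he =>
    (hψ e (hmem₁ e he)).2.mono (Finset.mem_filter.1 he).2
  have hhd : DependsOn h (C : Set V)ᶜ := dependsOn_prod fun e he =>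
    (hψ e (hmem₂ e he)).2.mono ((hC e (hmem₂ e he)).resolve_left (Finset.mem_filter.1 he).2)
  have hsm : MeasurableSet {y : V → Fin k → ℝ | y w ∈ s} := measurable_pi_apply w hs
  set χ : (V → Fin k → ℝ) → ℝ≥0∞ := Set.indicator {y | y w ∈ s} 1 with hχ
  have hχm : Measurable χ := measurable_one.indicator hsm
  have hχd : DependsOn χ (C : Set V)ᶜ := fun x y hxy => by
    simp only [hχ, Set.indicator_apply, Set.mem_ofPred_eq, hxy w hwC, Pi.one_apply]
  obtain ⟨φ, hφm, hφ⟩ := exists_conditional μ hgm hhm hχm hvC hgd hhd hχd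
  refine ⟨φ, hφm, fun F hF hfin => ?_⟩
  have hYm : Measurable fun ω v => Y v ω := measurable_pi_lambda _ hY
  have key : ∀ G : (V → Fin k → ℝ) → ℝ≥0∞, Measurable G →
      ∫⁻ ω, G (fun v => Y v ω) ∂P = ∫⁻ y, (g y * h y) * G y ∂Measure.pi μ := by
    intro G hG
    rw [← lintegral_map hG hYm, hP,
      show (fun y => ∏ e ∈ T.edgeFinset, (ψ e y : ℝ≥0∞)) = fun y => g y * h y from
        funext fun y => (Finset.prod_filter_mul_prod_filter_not _ _ _).symm,
      lintegral_withDensity_eq_lintegral_mul (Measure.pi μ) (f := fun y => g y * h y)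
        (hgm.mul hhm) hG]
    rfl
  have hF' : Measurable fun y : V → Fin k → ℝ => F (y u, y v) :=
    hF.comp ((measurable_pi_apply u).prodMk (measurable_pi_apply v))
  have hFd : DependsOn (fun y : V → Fin k → ℝ => F (y u, y v)) (insert v (C : Set V)) :=
    fun x y hxy => by simp only [hxy u (Or.inr huC), hxy v (Or.inl rfl)]
  have h1 := hφ _ hF' hFd (by rw [← key _ hF']; exact hfin)
  rw [← key (fun y => F (y u, y v) * χ y) (hF'.mul hχm),
    ← key (fun y => F (y u, y v) * φ (y v)) (hF'.mul (hφm.comp (measurable_pi_apply v)))] at h1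
  rw [← lintegral_indicator (hY w hs)]
  refine Eq.trans (lintegral_congr fun ω => ?_) h1
  by_cases hω : Y w ω ∈ s <;> simp [hχ, hω]

end Markov

/-! ### Residuals with vanishing conditional mean -/

section Residuals

variable {Ω : Type*} [mΩ : MeasurableSpace Ω] {P : Measure Ω} {f : Ω → ℝ}

theorem integral_eq_zero_iff_lintegral_eq (hf : Integrable f P) :
    ∫ ω, f ω ∂P = 0 ↔
      ∫⁻ ω, ENNReal.ofReal (f ω) ∂P = ∫⁻ ω, ENNReal.ofReal (-f ω) ∂P := by
  have hn : ∫⁻ ω, ENNReal.ofReal (-f ω) ∂P ≠ ∞ := hf.neg.lintegral_lt_top.ne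
  rw [integral_eq_lintegral_pos_part_sub_lintegral_neg_part hf, sub_eq_zero,
    ENNReal.toReal_eq_toReal_iff' hf.lintegral_lt_top.ne hn]

/-- The measures with densities `a` and `b` have the same image under `Z`, so they integrate `φ ∘ Z`
alike. -/
theorem lintegral_mul_eq_of_setLIntegral_eq {E : Type*} [MeasurableSpace E] {a b : Ω → ℝ≥0∞}
    (ha : Measurable a) (hb : Measurable b) {Z : Ω → E} (hZ : Measurable Z)
    (h : ∀ s, MeasurableSet s → ∫⁻ ω in Z ⁻¹' s, a ω ∂P = ∫⁻ ω in Z ⁻¹' s, b ω ∂P)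
    {φ : E → ℝ≥0∞} (hφ : Measurable φ) :
    ∫⁻ ω, a ω * φ (Z ω) ∂P = ∫⁻ ω, b ω * φ (Z ω) ∂P := by
  have h1 : (P.withDensity a).map Z = (P.withDensity b).map Z := by
    ext s hs
    rw [Measure.map_apply hZ hs, Measure.map_apply hZ hs, withDensity_apply _ (hZ hs),
      withDensity_apply _ (hZ hs), h s hs]
  have h2 : ∀ c : Ω → ℝ≥0∞, Measurable c →
      ∫⁻ ω, c ω * φ (Z ω) ∂P = ∫⁻ z, φ z ∂((P.withDensity c).map Z) := fun c hc => by
    rw [lintegral_map hφ hZ, lintegral_withDensity_eq_lintegral_mul P hc (g := fun ω => φ (Z ω))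
      (hφ.comp hZ)]
    rfl
  rw [h2 a ha, h2 b hb, h1]

theorem covariance_eq_zero_of_condExp_eq_zero [IsProbabilityMeasure P] {m : MeasurableSpace Ω}
    (hm : m ≤ mΩ) {g : Ω → ℝ} (hf : MemLp f 2 P) (hg : MemLp g 2 P)
    (hgm : StronglyMeasurable[m] g) (h : P[f | m] =ᵐ[P] 0) : cov[f, g; P] = 0 := by
  have h0 : ∫ ω, f ω ∂P = 0 := by
    rw [← integral_condExp hm, integral_congr_ae h]
    simp
  have hfg : Integrable (f * g) P := hf.integrable_mul hg
  have h1 : ∫ ω, (f * g) ω ∂P = 0 := by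
    rw [← integral_condExp hm, integral_congr_ae
      (condExp_mul_of_stronglyMeasurable_right hgm hfg (hf.integrable one_le_two))]
    have : P[f | m] * g =ᵐ[P] 0 := by
      filter_upwards [h] with ω hω
      simp [hω]
    rw [integral_congr_ae this]
    simp
  rw [covariance_eq_sub hf hg, h1, h0, zero_mul, sub_zero]

variable {V : Type*} [Fintype V] [DecidableEq V] {T : SimpleGraph V} [DecidableRel T.Adj]
  {k : ℕ} {Y : V → Ω → Fin k → ℝ} {u v w : V}

/-- The positive and negative parts of the residual have equal integrals over events of `Y v`, hence
against every nonnegative measurable function of `Y v`. By the Markov property, integrating over an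
event of `Y w` amounts to such a weight. -/
theorem Factorizes.condExp_eq_zero [IsProbabilityMeasure P] (hT : T.IsAcyclic)
    (hY : ∀ v, Measurable (Y v)) (h : Factorizes T P Y) (huv : T.Adj u v) (p : T.Walk v w)
    (hp : u ∉ p.support) {f₀ : (Fin k → ℝ) × (Fin k → ℝ) → ℝ} (hf₀ : Measurable f₀)
    (hf : Integrable (fun ω => f₀ (Y u ω, Y v ω)) P)
    (hc : P[fun ω => f₀ (Y u ω, Y v ω) | MeasurableSpace.comap (Y v) inferInstance] =ᵐ[P] 0) :
    P[fun ω => f₀ (Y u ω, Y v ω) | MeasurableSpace.comap (Y w) inferInstance] =ᵐ[P] 0 := by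
  have hpair : Measurable fun ω => (Y u ω, Y v ω) := (hY u).prodMk (hY v)
  have hv : ∀ s, MeasurableSet s → ∫⁻ ω in Y v ⁻¹' s, ENNReal.ofReal (f₀ (Y u ω, Y v ω)) ∂P =
      ∫⁻ ω in Y v ⁻¹' s, ENNReal.ofReal (-f₀ (Y u ω, Y v ω)) ∂P := fun s hs => by
    rw [← integral_eq_zero_iff_lintegral_eq hf.integrableOn,
      ← setIntegral_condExp (hY v).comap_le hf ⟨s, hs, rfl⟩,
      setIntegral_congr_ae ((hY v) hs) (hc.mono fun ω hω _ => hω)]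
    simp
  symm
  refine ae_eq_condExp_of_forall_setIntegral_eq (hY w).comap_le hf
    (fun s _ _ => integrableOn_zero) ?_ aestronglyMeasurable_zero
  rintro s ⟨t, ht, rfl⟩ -
  rw [eq_comm]
  simp only [Pi.zero_apply, integral_zero]
  rw [integral_eq_zero_iff_lintegral_eq hf.integrableOn]
  obtain ⟨φ, hφ, hF⟩ := h.markov hT hY huv p hp ht
  rw [hF (fun x => ENNReal.ofReal (f₀ x)) hf₀.ennreal_ofReal hf.lintegral_lt_top.ne,
    hF (fun x => ENNReal.ofReal (-f₀ x)) hf₀.neg.ennreal_ofReal hf.neg.lintegral_lt_top.ne]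
  exact lintegral_mul_eq_of_setLIntegral_eq (hf₀.comp hpair).ennreal_ofReal
    (hf₀.neg.comp hpair).ennreal_ofReal (hY v) hv hφ

end Residuals

/-! ### The correlation determinants of linear models -/

section LinearModels

variable {V Ω : Type*} [MeasurableSpace Ω] {P : Measure Ω} {k : ℕ}
  {Y : V → Ω → Fin k → ℝ} {u v w : V}

theorem memLp_coord (hY : ∀ v, MemLp (Y v) 2 P) (v : V) (i : Fin k) :
    MemLp (fun ω => Y v ω i) 2 P := memLp_pi_iff.1 (hY v) i

theorem covMatrix_transpose (u v : V) : (covMatrix P Y u v).transpose = covMatrix P Y v u := by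
  ext i j
  exact covariance_comm _ _

theorem tau_eq (u v : V) : tau P Y u v = (covMatrix P Y u v).det /
    ((CFC.sqrt (covMatrix P Y u u)).det * (CFC.sqrt (covMatrix P Y v v)).det) := by
  unfold tau
  rw [Matrix.det_mul, Matrix.det_mul, Matrix.det_nonsing_inv, Matrix.det_nonsing_inv,
    Ring.inverse_eq_inv', div_eq_mul_inv, mul_inv]
  ring

theorem tau_comm (u v : V) : tau P Y u v = tau P Y v u := by
  rw [tau_eq, tau_eq, ← covMatrix_transpose u v, Matrix.det_transpose, mul_comm]

theorem memLp_mulVec (hY : ∀ v, MemLp (Y v) 2 P) (A : Matrix (Fin k) (Fin k) ℝ) (v : V)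
    (i : Fin k) : MemLp (fun ω => A.mulVec (Y v ω) i) 2 P := by
  simp only [Matrix.mulVec, dotProduct]
  exact memLp_finsetSum _ fun j _ => (memLp_coord hY v j).const_mul _

variable [IsProbabilityMeasure P]

theorem posSemidef_covMatrix (hY : ∀ v, MemLp (Y v) 2 P) (v : V) :
    (covMatrix P Y v v).PosSemidef :=
  posSemidef_covariance (memLp_coord hY v)

theorem covariance_mulVec_left (hY : ∀ v, MemLp (Y v) 2 P) (A : Matrix (Fin k) (Fin k) ℝ)
    (v : V) (i : Fin k) {Z : Ω → ℝ} (hZ : MemLp Z 2 P) :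
    cov[fun ω => A.mulVec (Y v ω) i, Z; P] = ∑ l, A i l * cov[fun ω => Y v ω l, Z; P] := by
  simp only [Matrix.mulVec, dotProduct]
  rw [covariance_fun_sum_left (fun l => (memLp_coord hY v l).const_mul _) hZ]
  simp only [covariance_const_mul_left]

theorem det_sqrt_mul_self (hY : ∀ v, MemLp (Y v) 2 P) (v : V) :
    (CFC.sqrt (covMatrix P Y v v)).det * (CFC.sqrt (covMatrix P Y v v)).det =
      (covMatrix P Y v v).det := by
  rw [← Matrix.det_mul, CFC.sqrt_mul_sqrt_self _ (posSemidef_covMatrix hY v).nonneg]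

theorem det_sqrt_ne_zero (hcov : ∀ v, IsUnit (covMatrix P Y v v).det)
    (hY : ∀ v, MemLp (Y v) 2 P) (v : V) :
    (CFC.sqrt (covMatrix P Y v v)).det ≠ 0 :=
  (PosSemidef.isUnit_det_sqrt (posSemidef_covMatrix hY v) (hcov v)).ne_zero

theorem tau_self (hcov : ∀ v, IsUnit (covMatrix P Y v v).det)
    (hY : ∀ v, MemLp (Y v) 2 P) (v : V) : tau P Y v v = 1 := by
  rw [tau_eq, det_sqrt_mul_self hY, div_self (hcov v).ne_zero]

/-- The coordinates of `Y_u - A Y_v - b`. -/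
def residual (Y : V → Ω → Fin k → ℝ) (u v : V) (A : Matrix (Fin k) (Fin k) ℝ) (b : Fin k → ℝ)
    (i : Fin k) (ω : Ω) : ℝ := Y u ω i - (A.mulVec (Y v ω) + b) i

variable {A : Matrix (Fin k) (Fin k) ℝ} {b : Fin k → ℝ}

theorem memLp_residual (hY : ∀ v, MemLp (Y v) 2 P) (i : Fin k) :
    MemLp (residual Y u v A b i) 2 P :=
  (memLp_coord hY u i).sub ((memLp_mulVec hY A v i).add (memLp_const (b i)))

theorem covariance_residual_left (hY : ∀ v, MemLp (Y v) 2 P) (i : Fin k) {Z : Ω → ℝ}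
    (hZ : MemLp Z 2 P) :
    cov[residual Y u v A b i, Z; P] =
      cov[fun ω => Y u ω i, Z; P] - ∑ l, A i l * cov[fun ω => Y v ω l, Z; P] := by
  rw [← covariance_mulVec_left hY A v i hZ,
    ← covariance_add_const_left ((memLp_mulVec hY A v i).integrable one_le_two) (b i)]
  exact covariance_fun_sub_left (memLp_coord hY u i)
    ((memLp_mulVec hY A v i).add (memLp_const (b i))) hZ

theorem condExp_residual (hYm : ∀ v, Measurable (Y v)) (hY : ∀ v, MemLp (Y v) 2 P)
    (h : P[Y u | MeasurableSpace.comap (Y v) inferInstance] =ᵐ[P]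
      fun ω => A.mulVec (Y v ω) + b) (i : Fin k) :
    P[residual Y u v A b i | MeasurableSpace.comap (Y v) inferInstance] =ᵐ[P] 0 := by
  have hm := (hYm v).comap_le
  have h1 := (ContinuousLinearMap.proj (R := ℝ) (φ := fun _ : Fin k => ℝ) i).comp_condExp_comm
    ((hY u).integrable one_le_two) (m := MeasurableSpace.comap (Y v) inferInstance)
  have hg : Measurable fun z : Fin k → ℝ => (A.mulVec z + b) i := by
    simp only [Matrix.mulVec, dotProduct, Pi.add_apply]
    fun_prop
  have h2 : StronglyMeasurable[MeasurableSpace.comap (Y v) inferInstance]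
      fun ω => (A.mulVec (Y v ω) + b) i :=
    (hg.comp (comap_measurable (Y v))).stronglyMeasurable
  have h3 : Integrable (fun ω => (A.mulVec (Y v ω) + b) i) P :=
    ((memLp_mulVec hY A v i).add (memLp_const (b i))).integrable one_le_two
  have h4 := condExp_sub (m := MeasurableSpace.comap (Y v) inferInstance)
    ((memLp_coord hY u i).integrable one_le_two) h3
  rw [condExp_of_stronglyMeasurable hm h2 h3] at h4
  refine h4.trans ?_
  filter_upwards [h, h1] with ω hω h1ω
  have h5 : (P[fun ω => Y u ω i | MeasurableSpace.comap (Y v) inferInstance]) ω =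
      (A.mulVec (Y v ω) + b) i := by
    rw [← hω]
    exact h1ω.symm
  rw [Pi.sub_apply, h5, sub_self, Pi.zero_apply]

variable [Fintype V] [DecidableEq V] {T : SimpleGraph V} [DecidableRel T.Adj]

/-- `A` is the slope of the conditional mean. The residual is uncorrelated with `Y w` for every `w`
beyond `v`, which gives the first identity; with `w = v` the matrix in the second claim is the
covariance of the residual. -/
theorem IsLinearModel.exists_regression (hT : T.IsAcyclic) (h : IsLinearModel T P Y)
    (huv : T.Adj u v) :
    ∃ A : Matrix (Fin k) (Fin k) ℝ,
      (∀ w (p : T.Walk v w), u ∉ p.support → covMatrix P Y u w = A * covMatrix P Y v w) ∧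
      (covMatrix P Y u u - A * covMatrix P Y v v * A.transpose).PosSemidef := by
  obtain ⟨A, b, hA⟩ := h.affine u v huv
  have hc := condExp_residual h.measurable h.memLp hA
  have hz : ∀ w (p : T.Walk v w), u ∉ p.support → ∀ i j,
      cov[residual Y u v A b i, fun ω => Y w ω j; P] = 0 := by
    intro w p hp i j
    have hf₀ : Measurable fun x : (Fin k → ℝ) × (Fin k → ℝ) => x.1 i - (A.mulVec x.2 + b) i := by
      simp only [Matrix.mulVec, dotProduct, Pi.add_apply]
      fun_prop
    refine covariance_eq_zero_of_condExp_eq_zero (h.measurable w).comap_le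
      (memLp_residual h.memLp i) (memLp_coord h.memLp w j)
      ((measurable_pi_apply j).comp (comap_measurable (Y w))).stronglyMeasurable ?_
    exact h.factorizes.condExp_eq_zero hT h.measurable huv p hp hf₀
      ((memLp_residual h.memLp i).integrable one_le_two) (hc i)
  have hreg : ∀ w (p : T.Walk v w), u ∉ p.support →
      covMatrix P Y u w = A * covMatrix P Y v w := by
    intro w p hp
    ext i j
    have h1 := hz w p hp i j
    rw [covariance_residual_left h.memLp i (memLp_coord h.memLp w j), sub_eq_zero] at h1
    simpa [covMatrix, Matrix.mul_apply] using h1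
  refine ⟨A, hreg, ?_⟩
  have hnil : u ∉ (SimpleGraph.Walk.nil : T.Walk v v).support := by simpa using huv.ne
  have hvu : covMatrix P Y v u = covMatrix P Y v v * A.transpose := by
    rw [← covMatrix_transpose u v, hreg v .nil hnil, Matrix.transpose_mul, covMatrix_transpose]
  have hR : (Matrix.of fun i j => cov[residual Y u v A b i, residual Y u v A b j; P] :
      Matrix (Fin k) (Fin k) ℝ) = covMatrix P Y u u - A * covMatrix P Y v v * A.transpose := by
    rw [Matrix.mul_assoc, ← hvu]
    ext i j
    have h1 : cov[residual Y u v A b i, residual Y u v A b j; P] =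
        cov[residual Y u v A b i, fun ω => Y u ω j; P] := by
      rw [covariance_comm, covariance_residual_left h.memLp j (memLp_residual h.memLp i),
        covariance_comm, sub_eq_self]
      exact Finset.sum_eq_zero fun l _ => by
        rw [covariance_comm, hz v .nil hnil, mul_zero]
    rw [Matrix.of_apply, h1, covariance_residual_left h.memLp i (memLp_coord h.memLp u j)]
    simp [covMatrix, Matrix.mul_apply]
  rw [← hR]
  exact posSemidef_covariance (memLp_residual h.memLp)

/-- The same `A` appears in `Σ_uw = A Σ_vw` and in `Σ_uv = A Σ_vv`; eliminating `det A` leaves the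
product formula. -/
theorem IsLinearModel.tau_mul (hcov : ∀ v, IsUnit (covMatrix P Y v v).det)
    (hT : T.IsAcyclic) (h : IsLinearModel T P Y)
    (huv : T.Adj u v) (p : T.Walk v w) (hp : u ∉ p.support) :
    tau P Y u w = tau P Y u v * tau P Y v w := by
  obtain ⟨A, hA, -⟩ := h.exists_regression hT huv
  have hnil : u ∉ (SimpleGraph.Walk.nil : T.Walk v v).support := by simpa using huv.ne
  rw [tau_eq, tau_eq, tau_eq, hA w p hp, hA v .nil hnil, Matrix.det_mul, Matrix.det_mul,
    ← det_sqrt_mul_self h.memLp v]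
  have h1 := det_sqrt_ne_zero hcov h.memLp u
  have h2 := det_sqrt_ne_zero hcov h.memLp v
  have h3 := det_sqrt_ne_zero hcov h.memLp w
  field_simp

/-- Regression leaves a positive semidefinite residual covariance, so `(det A)² det Σ_vv ≤ det
Σ_uu`. As `Σ_uv = A Σ_vv`, this says `τ² ≤ 1`. -/
theorem IsLinearModel.abs_tau_le_one (hcov : ∀ v, IsUnit (covMatrix P Y v v).det)
    (hT : T.IsAcyclic) (h : IsLinearModel T P Y)
    (huv : T.Adj u v) : |tau P Y u v| ≤ 1 := by
  obtain ⟨A, hA, hps⟩ := h.exists_regression hT huv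
  have hnil : u ∉ (SimpleGraph.Walk.nil : T.Walk v v).support := by simpa using huv.ne
  have h1 : (A * covMatrix P Y v v * A.transpose).PosSemidef := by
    simpa using (posSemidef_covMatrix h.memLp v).mul_mul_conjTranspose_same A
  have h2 := PosSemidef.det_le_det h1 (posSemidef_covMatrix h.memLp u) (hcov u) hps
  rw [Matrix.det_mul, Matrix.det_mul, Matrix.det_transpose, ← det_sqrt_mul_self h.memLp u,
    ← det_sqrt_mul_self h.memLp v] at h2
  have h3 := det_sqrt_ne_zero hcov h.memLp u
  have h4 := det_sqrt_ne_zero hcov h.memLp v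
  rw [← sq_le_one_iff_abs_le_one, tau_eq, hA v .nil hnil, Matrix.det_mul,
    ← det_sqrt_mul_self h.memLp v, div_pow, div_le_one (by positivity)]
  rw [mul_pow, mul_pow]
  nlinarith [mul_le_mul_of_nonneg_right h2 (sq_nonneg (CFC.sqrt (covMatrix P Y v v)).det)]

/-- The distances `-log |τ_uv|` of a linear model form a tree metric for its tree. -/
theorem IsLinearModel.realizesOn (hcov : ∀ v, IsUnit (covMatrix P Y v v).det)
    (hT : T.IsAcyclic) (h : IsLinearModel T P Y)
    (hτ : ∀ u v, T.Adj u v → tau P Y u v ≠ 0 ∧ |tau P Y u v| ≠ 1) :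
    RealizesOn T Set.univ
      (Sym2.lift ⟨fun u v => -Real.log |tau P Y u v|, fun u v => by simp only [tau_comm u v]⟩)
      (fun u v => -Real.log |tau P Y u v|) := by
  have hpath : ∀ {i j} (p : T.Walk i j), p.IsPath → tau P Y i j ≠ 0 ∧ -Real.log |tau P Y i j| =
      (p.edges.map (Sym2.lift ⟨fun u v => -Real.log |tau P Y u v|,
        fun u v => by simp only [tau_comm u v]⟩)).sum := by
    intro i j p
    induction p with
    | nil => intro _; simp [tau_self hcov h.memLp]
    | cons huv q ih =>
      intro hp
      rw [SimpleGraph.Walk.cons_isPath_iff] at hp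
      obtain ⟨h1, h2⟩ := ih hp.1
      have h3 := (hτ _ _ huv).1
      rw [h.tau_mul hcov hT huv q hp.2]
      refine ⟨mul_ne_zero h3 h1, ?_⟩
      rw [abs_mul, Real.log_mul (abs_ne_zero.2 h3) (abs_ne_zero.2 h1), neg_add, h2]
      simp
  refine ⟨fun e he => ?_, fun i _ j _ p hp => (hpath p hp).2⟩
  induction e with | _ u v
  have h1 : T.Adj u v := he
  have h2 : |tau P Y u v| < 1 := lt_of_le_of_ne (h.abs_tau_le_one hcov hT h1) (hτ u v h1).2
  simp only [Sym2.lift_mk]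
  rw [neg_pos]
  exact Real.log_neg (abs_pos.2 (hτ u v h1).1) h2

end LinearModels

end LatentTree

theorem mainTheorem7 {V Ω : Type*} [Fintype V] [DecidableEq V] [MeasurableSpace Ω]
    (T : SimpleGraph V) [DecidableRel T.Adj] (W : Finset V)
    (hT : LatentTree.IsSemiLabelledTree T (W : Set V))
    {k : ℕ} (P : Measure Ω) [IsProbabilityMeasure P] (Y : V → Ω → Fin k → ℝ)
    (hY : LatentTree.IsLinearModel T P Y)
    (hcov : ∀ v, IsUnit (LatentTree.covMatrix P Y v v).det)
    (hτ : ∀ u v, T.Adj u v →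
      LatentTree.tau P Y u v ≠ 0 ∧ |LatentTree.tau P Y u v| ≠ 1) :
    LatentTree.AlgorithmRecovers T W
      (fun i j => -Real.log |LatentTree.tau P Y i j|) := by
  have hR := hY.realizesOn hcov hT.1.isAcyclic hτ
  exact LatentTree.algorithmRecovers_of_realizes hT hR fun _ _ => rfl
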